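/- Let $p=p(\rho)$ be continuous on $[0,\infty)$, and regard it also as a function $p(\tau)$ of the specific volume $\tau=1/\rho>0$. Assume that $p$ is of one of the following types. * Type I: $p(\tau)$ is $C^2$, $p'(\tau)<0$ and $p''(\tau)>0$ for all $\tau>0$. * Type II: $p(\tau)$ is $C^2$, $p'(\tau)<0$ for all $\tau>0$, and for some $0<\tau_1^i<\tau_2^i$ one has $p''>0$ on $(0,\tau_1^i)\cup(\tau_2^i,\infty)$ and $p''<0$ on $(\tau_1^i,\tau_2^i)$. * Type III: for some $0<\tilde\tau_1<\tilde\tau_2$, $p(\tau)$ is constant on $[\tilde\tau_1,\tilde\tau_2]$, is $C^2$ on $(0,\tilde\tau_1]$ and on $[\tilde\tau_2,\infty)$ (one-sided derivatives at the end points), and satisfies $p'<0$, $p''>0$ on $(0,\tilde\tau_1)\cup(\tilde\tau_2,\infty)$. Assume moreover: * (A1) there is $\nu>0$ with $\lim_{\rho\to0}p'(\rho)/\rho^{\nu}=0$; * (A2) for type III, $\lim_{\tau\to\tilde\tau_1^-}p'(\tau)<p'(\tau_c)$, where $\tau_c>\tilde\tau_2$ is determined by $\frac{p(\tau_c)-p(\tilde\tau_1)}{\tau_c-\tilde\tau_1}=p'(\tau_c)$;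 * (A3) if $u_0<0$, then $p'(\rho)$ is bounded below by a positive constant for all sufficiently large $\rho$. Then for all $u_0\in\mathbb R$ and $\rho_0>0$ the initial-boundary value problem, for $x>0$, $t>0$, $$\rho_t+(\rho u)_x+\frac{2\rho u}{x}=0,\qquad (\rho u)_t+(\rho u^2+p)_x+\frac{2\rho u^2}{x}=0,$$ $$(u,\rho)(x,0)=(u_0,\rho_0),\qquad (\rho u)(0,t)=0,$$ has a bounded weak solution with $\rho\ge 0$ that is self-similar, $(u,\rho)(x,t)=(U,R)(s)$ with $s=t/x$, and that attains the initial and boundary conditions also as pointwise limits ($t\to0^+$ for each $x>0$; $x\to0^+$ for each $t>0$). Off finitely many values $s>0$, either $R>0$ and $(U,R)$ solves $$\frac{du}{ds}=\frac{2p'(\rho)us}{s^2p'(\rho)-(1-us)^2},\qquad \frac{d\rho}{ds}=\frac{2\rho u(1-us)}{s^2p'(\rho)-(1-us)^2}$$ with non-zero denominator, or $R=0$ near $s$ (vacuum). At each of the finitely many exceptional $s$, either $(U,R)$ is continuous, or it jumps by a forward shock of speed $\sigma=1/s$: with $(u_1,\rho_1)$ the state in front (the limit from smaller $s$) and $(u_2,\rho_2)$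 the state behind (the limit from larger $s$), $\rho_1,\rho_2>0$, $\rho_1\ne\rho_2$, the Rankine-Hugoniot conditions $$\rho_1u_1-\rho_2u_2=\sigma(\rho_1-\rho_2),\qquad \rho_1u_1^2+p(\rho_1)-\rho_2u_2^2-p(\rho_2)=\sigma(\rho_1u_1-\rho_2u_2)$$ hold, $u_1,u_2<\sigma$, and Liu's entropy condition holds: if a state $(u,\rho)$ with $\rho$ strictly between $\rho_1$ and $\rho_2$ satisfies the Rankine-Hugoniot conditions with $(u_1,\rho_1)$ and speed $\sigma'$, then $\sigma'\le\sigma$. The solution can be chosen with the following structure. * If $u_0>0$, there is at most one shock, and it is a rarefaction shock ($\rho_2<\rho_1$); and one of the following holds: there is $s_*>0$ with $(U,R)=(1/s_*,0)$ for $s\ge s_*$ and $U,R>0$ for $0<s<s_*$ (vacuum); or $R>0$ throughout and $(U,R)$ is constant with $U=0$ for all large $s$ (quiet state); or $U,R>0$ for all $s>0$ and $U,R\to0$ as $s\to\infty$. For type I there is no shock. * If $u_0\le0$, there are at most two shocks, all of them compression shocks ($\rho_2>\rho_1$); $R>0$ throughout, and $(U,R)$ is constant with $U=0$ for all large $s$.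 For type I and $u_0<0$ there is exactly one shock. -/

import Mathlib

open Set Filter Topology MeasureTheory
open scoped ContDiff

/-! ### Equations of state

`P` is the pressure as a function of the density `ρ ≥ 0`; only its values on `[0, ∞)` matter. -/

/-- The pressure as a function of the specific volume `τ = 1 / ρ`. -/
noncomputable def pressureOfVolume (P : ℝ → ℝ) (τ : ℝ) : ℝ := P τ⁻¹

/-- Type I: `p' < 0` and `p'' > 0` for `τ > 0`. -/
structure IsTypeI (p : ℝ → ℝ) : Prop where
  contDiffOn : ContDiffOn ℝ 2 p (Ioi 0)
  deriv_neg : ∀ τ > 0, deriv p τ < 0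
  deriv2_pos : ∀ τ > 0, 0 < deriv (deriv p) τ

/-- Type II: `p' < 0` for `τ > 0`, and `p` is convex, concave, convex on the three intervals cut
out by the inflection points `τ₁ < τ₂`. -/
structure IsTypeII (p : ℝ → ℝ) (τ₁ τ₂ : ℝ) : Prop where
  pos : 0 < τ₁
  lt : τ₁ < τ₂
  contDiffOn : ContDiffOn ℝ 2 p (Ioi 0)
  deriv_neg : ∀ τ > 0, deriv p τ < 0
  deriv2_pos : ∀ τ ∈ Ioo 0 τ₁ ∪ Ioi τ₂, 0 < deriv (deriv p) τ
  deriv2_neg : ∀ τ ∈ Ioo τ₁ τ₂, deriv (deriv p) τ < 0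

/-- Type III: `p` is constant on `[τ₁, τ₂]`, decreasing and convex on either side of it, and twice
continuously differentiable up to the (possible) corners at `τ₁` and `τ₂`. -/
structure IsTypeIII (p : ℝ → ℝ) (τ₁ τ₂ : ℝ) : Prop where
  pos : 0 < τ₁
  lt : τ₁ < τ₂
  contDiffOn_left : ContDiffOn ℝ 2 p (Ioc 0 τ₁)
  contDiffOn_right : ContDiffOn ℝ 2 p (Ici τ₂)
  deriv_neg : ∀ τ ∈ Ioo 0 τ₁ ∪ Ioi τ₂, deriv p τ < 0
  deriv2_pos : ∀ τ ∈ Ioo 0 τ₁ ∪ Ioi τ₂, 0 < deriv (deriv p) τ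
  plateau : ∀ τ ∈ Icc τ₁ τ₂, p τ = p τ₁

/-- Assumption (A1): `p'(ρ) / ρ ^ ν → 0` as `ρ → 0`, for some `ν > 0`. -/
def AssumptionA1 (P : ℝ → ℝ) : Prop :=
  ∃ ν : ℝ, 0 < ν ∧ Tendsto (fun ρ : ℝ => deriv P ρ / ρ ^ ν) (𝓝[>] 0) (𝓝 0)

/-- Assumption (A2), for type III with plateau `[τ₁, τ₂]`: the left limit of `p'` at `τ₁` is
smaller than `p'(τc)`, where `τc > τ₂` is the point at which the tangent to the graph of `p`
passes through `(τ₁, p τ₁)`. -/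
def AssumptionA2 (p : ℝ → ℝ) (τ₁ τ₂ : ℝ) : Prop :=
  ∃ τc L : ℝ, τ₂ < τc ∧ (p τc - p τ₁) / (τc - τ₁) = deriv p τc ∧
    Tendsto (deriv p) (𝓝[<] τ₁) (𝓝 L) ∧ L < deriv p τc

/-! ### Shocks -/

/-- The Rankine-Hugoniot conditions between `(u₁, ρ₁)` and `(u₂, ρ₂)` with speed `σ`. For fixed
`(u₁, ρ₁)` the states `(u₂, ρ₂)` that satisfy them for some `σ` form the shock set. -/
def RankineHugoniot (P : ℝ → ℝ) (σ u₁ ρ₁ u₂ ρ₂ : ℝ) : Prop :=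
  ρ₁ * u₁ - ρ₂ * u₂ = σ * (ρ₁ - ρ₂) ∧
  (ρ₁ * u₁ ^ 2 + P ρ₁) - (ρ₂ * u₂ ^ 2 + P ρ₂) = σ * (ρ₁ * u₁ - ρ₂ * u₂)

/-- Liu's entropy condition (E): the speed `σ` of the discontinuity between `(u₁, ρ₁)` and
`(u₂, ρ₂)` is at least the speed of the discontinuity between `(u₁, ρ₁)` and any state of the
shock set through `(u₁, ρ₁)` that lies between the two. -/
def LiuEntropy (P : ℝ → ℝ) (σ u₁ ρ₁ ρ₂ : ℝ) : Prop :=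
  ∀ u ρ σ' : ℝ, min ρ₁ ρ₂ < ρ → ρ < max ρ₁ ρ₂ → RankineHugoniot P σ' u₁ ρ₁ u ρ → σ' ≤ σ

/-- An admissible forward shock with speed `σ`; `1` is the state in front of it (on the right)
and `2` is the state behind it. -/
structure IsAdmissibleForwardShock (P : ℝ → ℝ) (σ u₁ ρ₁ u₂ ρ₂ : ℝ) : Prop where
  pos₁ : 0 < ρ₁
  pos₂ : 0 < ρ₂
  ne : ρ₁ ≠ ρ₂
  rankineHugoniot : RankineHugoniot P σ u₁ ρ₁ u₂ ρ₂
  forward₁ : u₁ < σ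
  forward₂ : u₂ < σ
  entropy : LiuEntropy P σ u₁ ρ₁ ρ₂

/-- The profile `(U, R)`, a function of `s = t / x`, jumps at `s`, along the ray `x = t / s`, by an
admissible forward shock. Smaller `s` is larger `x`, hence in front of the shock. -/
structure IsShockAt (P U R : ℝ → ℝ) (s u₁ ρ₁ u₂ ρ₂ : ℝ) : Prop where
  front_u : Tendsto U (𝓝[<] s) (𝓝 u₁)
  front_ρ : Tendsto R (𝓝[<] s) (𝓝 ρ₁)
  back_u : Tendsto U (𝓝[>] s) (𝓝 u₂)
  back_ρ : Tendsto R (𝓝[>] s) (𝓝 ρ₂)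
  shock : IsAdmissibleForwardShock P (1 / s) u₁ ρ₁ u₂ ρ₂

/-- The shock compresses the gas. -/
def IsCompressionShockAt (P U R : ℝ → ℝ) (s : ℝ) : Prop :=
  ∃ u₁ ρ₁ u₂ ρ₂ : ℝ, IsShockAt P U R s u₁ ρ₁ u₂ ρ₂ ∧ ρ₁ < ρ₂

/-- The shock rarefies the gas. -/
def IsRarefactionShockAt (P U R : ℝ → ℝ) (s : ℝ) : Prop :=
  ∃ u₁ ρ₁ u₂ ρ₂ : ℝ, IsShockAt P U R s u₁ ρ₁ u₂ ρ₂ ∧ ρ₂ < ρ₁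

/-! ### Self-similar profiles -/

/-- At `s` the density is positive and `(U, R)` solves the non-autonomous system
`u' = 2 p'(ρ) u s / (s² p'(ρ) - (1 - u s)²)`, `ρ' = 2 ρ u (1 - u s) / (s² p'(ρ) - (1 - u s)²)`. -/
structure SolvesODEAt (P U R : ℝ → ℝ) (s : ℝ) : Prop where
  pos : 0 < R s
  ne : s ^ 2 * deriv P (R s) - (1 - U s * s) ^ 2 ≠ 0
  deriv_u : HasDerivAt U
    (2 * deriv P (R s) * U s * s / (s ^ 2 * deriv P (R s) - (1 - U s * s) ^ 2)) s
  deriv_ρ : HasDerivAt R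
    (2 * R s * U s * (1 - U s * s) / (s ^ 2 * deriv P (R s) - (1 - U s * s) ^ 2)) s

/-- `(U, R)` is put together from solutions of the system of ordinary differential equations
and vacuum, joined continuously at finitely many points `K` and by admissible forward shocks at
finitely many points `S`. -/
structure IsAdmissibleProfile (P U R : ℝ → ℝ) (S K : Finset ℝ) : Prop where
  shock_pos : ∀ s ∈ S, 0 < s
  kink_pos : ∀ s ∈ K, 0 < s
  smooth : ∀ s : ℝ, 0 < s → s ∉ S → s ∉ K → SolvesODEAt P U R s ∨ ∀ᶠ r in 𝓝 s, R r = 0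
  kink : ∀ s ∈ K, ContinuousAt U s ∧ ContinuousAt R s
  shock : ∀ s ∈ S, IsCompressionShockAt P U R s ∨ IsRarefactionShockAt P U R s

/-- The gas is at rest with constant positive density for large `s`, and there is no vacuum. -/
def EndsAtRest (U R : ℝ → ℝ) : Prop :=
  (∀ s > 0, 0 < R s) ∧ ∃ s₁ > 0, ∃ ρ₁ > 0, ∀ s > s₁, U s = 0 ∧ R s = ρ₁

/-- There is vacuum exactly for `s ≥ s₁` (with the convention `u = 1 / s₁` there). -/
def EndsInVacuum (U R : ℝ → ℝ) : Prop :=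
  ∃ s₁ > 0, (∀ s ∈ Ioo 0 s₁, 0 < U s ∧ 0 < R s) ∧ ∀ s ≥ s₁, U s = 1 / s₁ ∧ R s = 0

/-- Velocity and density stay positive and tend to zero as `s → ∞`. -/
def DecaysAtInfinity (U R : ℝ → ℝ) : Prop :=
  (∀ s > 0, 0 < U s ∧ 0 < R s) ∧ Tendsto U atTop (𝓝 0) ∧ Tendsto R atTop (𝓝 0)

/-! ### Weak solutions of the initial-boundary value problem -/

/-- `(u, ρ)`, functions of `x > 0` and `t > 0`, is a bounded weak solution of
`ρ_t + (ρ u)_x + 2 ρ u / x = 0`, `(ρ u)_t + (ρ u² + p)_x + 2 ρ u² / x = 0`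
with `(u, ρ)(x, 0) = (u₀, ρ₀)` and `(ρ u)(0, t) = 0`. The initial data and the boundary values are
also attained as pointwise limits. The test functions are smooth functions of `(x, t)`
with compact support in `x > 0`. -/
structure IsWeakSolution (P : ℝ → ℝ) (u₀ ρ₀ : ℝ) (u ρ : ℝ → ℝ → ℝ) : Prop where
  measurable_u : AEStronglyMeasurable (fun z : ℝ × ℝ => u z.1 z.2)
    (volume.restrict (Ioi (0 : ℝ) ×ˢ Ioi (0 : ℝ)))
  measurable_ρ : AEStronglyMeasurable (fun z : ℝ × ℝ => ρ z.1 z.2)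
    (volume.restrict (Ioi (0 : ℝ) ×ˢ Ioi (0 : ℝ)))
  bounded : ∃ C : ℝ, ∀ x > 0, ∀ t > 0, |u x t| ≤ C ∧ ρ x t ≤ C
  nonneg : ∀ x > 0, ∀ t > 0, 0 ≤ ρ x t
  mass : ∀ φ : ℝ × ℝ → ℝ, ContDiff ℝ ∞ φ → HasCompactSupport φ →
    tsupport φ ⊆ {z : ℝ × ℝ | 0 < z.1} →
    (∫ z : ℝ × ℝ in Ioi (0 : ℝ) ×ˢ Ioi (0 : ℝ),
        (ρ z.1 z.2 * fderiv ℝ φ z (0, 1)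
          + ρ z.1 z.2 * u z.1 z.2 * fderiv ℝ φ z (1, 0)
          - 2 * ρ z.1 z.2 * u z.1 z.2 / z.1 * φ z))
      + ∫ x : ℝ in Ioi (0 : ℝ), ρ₀ * φ (x, 0) = 0
  momentum : ∀ φ : ℝ × ℝ → ℝ, ContDiff ℝ ∞ φ → HasCompactSupport φ →
    tsupport φ ⊆ {z : ℝ × ℝ | 0 < z.1} →
    (∫ z : ℝ × ℝ in Ioi (0 : ℝ) ×ˢ Ioi (0 : ℝ),
        (ρ z.1 z.2 * u z.1 z.2 * fderiv ℝ φ z (0, 1)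
          + (ρ z.1 z.2 * u z.1 z.2 ^ 2 + P (ρ z.1 z.2)) * fderiv ℝ φ z (1, 0)
          - 2 * ρ z.1 z.2 * u z.1 z.2 ^ 2 / z.1 * φ z))
      + ∫ x : ℝ in Ioi (0 : ℝ), ρ₀ * u₀ * φ (x, 0) = 0
  initial : ∀ x > 0, u x 0 = u₀ ∧ ρ x 0 = ρ₀
  initial_u : ∀ x > 0, Tendsto (fun t => u x t) (𝓝[>] 0) (𝓝 u₀)
  initial_ρ : ∀ x > 0, Tendsto (fun t => ρ x t) (𝓝[>] 0) (𝓝 ρ₀)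
  boundary : ∀ t > 0, Tendsto (fun x => ρ x t * u x t) (𝓝[>] 0) (𝓝 0)

/-!
For a profile that depends only on `s = t / x` the system becomes an ordinary differential equation
that is singular where the gap `(1 - u s)² - s² p'(ρ)` vanishes, that is, where the flow passes from
supersonic to subsonic relative to the ray `x = t / s`. The initial data are the values at `s = 0`,
where the flow is supersonic, and the solution has to be continued to `s = ∞` with `ρ u → 0`.

The density is used as independent variable: it decreases for gas that moves outwards (`u₀ > 0`,
`ε = -1`) and increases for gas that moves inwards (`u₀ < 0`, `ε = 1`). With `v = |u|`, both `s` and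
`v` solve equations that are regular even at sonic points (`IsCurve`), with a maximal solution
(`PressureShape.exists_maximal_curve`), and `s` increases exactly while the flow is
supersonic (`IsCurve.strictMonoOn`), so that the curve can be read as a profile. Types I, II and III
are treated together through `PressureShape`: as a function of the specific volume the pressure is
convex, concave, convex, with transitions at the densities `β` and `α`.

Two facts keep the flow supersonic. First, the gap divided by `ρ v` is monotone along a curve where
the convexity is favourable (`IsCurve.gap_pos_of_convexity`). Second, consider the Rayleigh line in
the plane of volume and pressure: it passes through the current state, and its slope is minus the
square of the mass flux across the ray. It meets the graph of the pressure exactly at the states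
that a shock of speed `1 / s` can reach, and the gas is at rest at one volume on it
(`restVolume`). As long as it does not meet the graph between the current state and the
rest state (or `α⁻¹`) again, the chord condition and the convexity give the supersonic condition.
When it touches for the first time (`exists_first_touch`), the graph lies on one side of the line
between the two states, which is Liu's condition (`isAdmissibleForwardShock_of_rayleigh`), and the
profile jumps there.

* For outward motion, gas of density at most `α` expands without shocks until it is at rest, is
  followed by vacuum, or decays (`PressureShape.isSolvableFrom_dilute`); the assumption on
  `p'(ρ)` at `ρ = 0` enters through the logarithmic divergence of `s` that rules out other ends.
  From higher densities the first touch leads either to rest or to a dilute state that is still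
  supersonic (`PressureShape.isSolvableFrom_expansion`).
* For inward motion, gas of density at least `α` is brought to rest by one shock or, at a density
  of at most `β`, smoothly (`PressureShape.isSolvableFrom_dense`). The lower bound on `p'` at large
  densities prevents the compression from going on forever. From lower densities there may be one
  more shock in front (`PressureShape.isSolvableFrom_compression`).

A profile is a weak solution because the fluxes `R (1 - U s)` and `R U (1 - U s) - s p(R)` across the
rays are continuous, also at the shocks, and satisfy balance laws in `s`
(`IsProfileOn.isWeakSolution`).
-/

/-! ### Maximal solutions of ordinary differential equations -/

/-- `z` solves `z' = F t z` on `[0, T)` with `z 0 = z₀` and stays in `Ω`; the equation itself may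
fail at the times in `bad`, where `z` is only required to be continuous. -/
structure IsSolutionUpTo {E : Type*} [NormedAddCommGroup E] [NormedSpace ℝ E]
    (F : ℝ → E → E) (bad : Set ℝ) (Ω : Set (ℝ × E)) (z₀ : E) (T : EReal) (z : ℝ → E) : Prop where
  pos : 0 < T
  init : z 0 = z₀
  mem : ∀ t : ℝ, 0 ≤ t → (t : EReal) < T → (t, z t) ∈ Ω
  cont : ∀ t : ℝ, 0 ≤ t → (t : EReal) < T → ContinuousWithinAt z (Ici 0) t
  deriv : ∀ t : ℝ, 0 < t → (t : EReal) < T → t ∉ bad → HasDerivAt z (F t (z t)) t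

section maximal

variable {E : Type*} [NormedAddCommGroup E] [NormedSpace ℝ E] {F : ℝ → E → E} {bad : Set ℝ}
  {Ω : Set (ℝ × E)} {z₀ : E}

lemma EReal.eventually_coe_lt {t : ℝ} {T : EReal} (h : (t : EReal) < T) :
    ∀ᶠ r : ℝ in 𝓝 t, (r : EReal) < T :=
  (continuous_coe_real_ereal.tendsto t).eventually (Iio_mem_nhds h)

/-- A function that is continuous at `t` and whose derivative near `t` tends to `e` has derivative
`e` at `t`. -/
lemma hasDerivAt_of_eventually_nhdsNE {f : ℝ → E} {g : ℝ → E} {t : ℝ} {e : E}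
    (hc : ContinuousAt f t) (hd : ∀ᶠ r in 𝓝[≠] t, HasDerivAt f (g r) r)
    (hg : Tendsto g (𝓝[≠] t) (𝓝 e)) : HasDerivAt f e t := by
  have hl : ∀ᶠ r in 𝓝[<] t, HasDerivAt f (g r) r :=
    hd.filter_mono (nhdsWithin_mono _ fun x hx => ne_of_lt hx)
  have hr : ∀ᶠ r in 𝓝[>] t, HasDerivAt f (g r) r :=
    hd.filter_mono (nhdsWithin_mono _ fun x hx => ne_of_gt hx)
  have h1 : HasDerivWithinAt f e (Iic t) t := by
    refine hasDerivWithinAt_Iic_of_tendsto_deriv (s := {r | HasDerivAt f (g r) r})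
      (fun r hr => (HasDerivAt.differentiableAt hr).differentiableWithinAt)
      hc.continuousWithinAt hl ?_
    exact (hg.mono_left (nhdsWithin_mono _ fun x hx => ne_of_lt hx)).congr'
      (hl.mono fun r hr => hr.deriv.symm)
  have h2 : HasDerivWithinAt f e (Ici t) t := by
    refine hasDerivWithinAt_Ici_of_tendsto_deriv (s := {r | HasDerivAt f (g r) r})
      (fun r hr => (HasDerivAt.differentiableAt hr).differentiableWithinAt)
      hc.continuousWithinAt hr ?_
    exact (hg.mono_left (nhdsWithin_mono _ fun x hx => ne_of_gt hx)).congr'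
      (hr.mono fun r hr => hr.deriv.symm)
  simpa using h1.union h2

/-- Local forward solvability lets a solution that has a limit inside `Ω` be continued. -/
lemma IsSolutionUpTo.extend (hbad : bad.Finite)
    (hF : ∀ t z, (t, z) ∈ Ω → t ∉ bad → ContinuousAt (Function.uncurry F) (t, z))
    (hloc : ∀ t₀ z₀, 0 ≤ t₀ → (t₀, z₀) ∈ Ω → ∃ δ > 0, ∃ y : ℝ → E, y t₀ = z₀ ∧
      ContinuousOn y (Ico t₀ (t₀ + δ)) ∧
      ∀ t ∈ Ioo t₀ (t₀ + δ), HasDerivAt y (F t (y t)) t ∧ (t, y t) ∈ Ω)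
    {T : ℝ} {z : ℝ → E} (hz : IsSolutionUpTo F bad Ω z₀ T z) {w : E}
    (hw : Tendsto z (𝓝[<] T) (𝓝 w)) (hmem : (T, w) ∈ Ω) :
    ∃ (T' : ℝ) (z' : ℝ → E), T < T' ∧ IsSolutionUpTo F bad Ω z₀ T' z' ∧
      ∀ t < T, z' t = z t := by
  have hT : 0 < T := by exact_mod_cast hz.pos
  obtain ⟨δ, hδ, y, hyT, hyc, hy⟩ := hloc T w hT.le hmem
  set z' : ℝ → E := fun t => if t < T then z t else y t with hz'
  have hlt : ∀ t < T, z' t = z t := fun t ht => by simp [hz', ht]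
  have hge : ∀ t, T ≤ t → z' t = y t := fun t ht => by simp [hz', not_lt.2 ht]
  have hlt' : ∀ t < T, z' =ᶠ[𝓝 t] z := fun t ht => by
    filter_upwards [Iio_mem_nhds ht] with r hr using hlt r hr
  have hgt' : ∀ t, T < t → z' =ᶠ[𝓝 t] y := fun t ht => by
    filter_upwards [Ioi_mem_nhds ht] with r hr using hge r (le_of_lt hr)
  have hcT : ContinuousAt z' T := by
    refine continuousAt_iff_continuous_left'_right'.2 ⟨?_, ?_⟩
    · rw [ContinuousWithinAt, hge T le_rfl, hyT]
      exact hw.congr' (eventually_mem_nhdsWithin.mono fun r hr => (hlt r hr).symm)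
    · rw [ContinuousWithinAt, hge T le_rfl]
      have h1 : ContinuousWithinAt y (Ioi T) T :=
        ((hyc T ⟨le_rfl, by linarith⟩).mono_of_mem_nhdsWithin
          (Ico_mem_nhdsGE (by linarith))).mono Ioi_subset_Ici_self
      exact h1.tendsto.congr' (eventually_mem_nhdsWithin.mono fun r hr => (hge r (le_of_lt hr)).symm)
  refine ⟨T + δ, z', by linarith, ⟨by exact_mod_cast (by linarith : (0 : ℝ) < T + δ), ?_, ?_, ?_, ?_⟩,
    hlt⟩
  · rw [hlt 0 hT, hz.init]
  · intro t h0 h1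
    have h1' : t < T + δ := by exact_mod_cast h1
    rcases lt_trichotomy t T with h | h | h
    · rw [hlt t h]; exact hz.mem t h0 (by exact_mod_cast h)
    · rw [hge t h.ge, h, hyT]; exact hmem
    · rw [hge t h.le]; exact (hy t ⟨h, h1'⟩).2
  · intro t h0 h1
    have h1' : t < T + δ := by exact_mod_cast h1
    rcases lt_trichotomy t T with h | h | h
    · exact (hz.cont t h0 (by exact_mod_cast h)).congr_of_eventuallyEq
        ((hlt' t h).filter_mono nhdsWithin_le_nhds) (hlt t h)
    · rw [h]; exact hcT.continuousWithinAt
    · exact ((hy t ⟨h, h1'⟩).1.continuousAt.congr (hgt' t h).symm).continuousWithinAt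
  · intro t h0 h1 hb
    have h1' : t < T + δ := by exact_mod_cast h1
    rcases lt_trichotomy t T with h | h | h
    · rw [hlt t h]
      exact (hz.deriv t h0 (by exact_mod_cast h) hb).congr_of_eventuallyEq (hlt' t h)
    · subst h
      have hcF : ContinuousAt (fun r => F r (z' r)) t := by
        have := hF t w hmem hb
        have h2 : ContinuousAt (fun r => (r, z' r)) t := continuousAt_id.prodMk hcT
        have hzt : z' t = w := by rw [hge t le_rfl, hyT]
        exact ContinuousAt.comp (f := fun r => (r, z' r)) (g := Function.uncurry F)
          (by rw [hzt]; exact this) h2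
      refine hasDerivAt_of_eventually_nhdsNE hcT (g := fun r => F r (z' r)) ?_
        (hcF.tendsto.mono_left nhdsWithin_le_nhds)
      have hbn : ∀ᶠ r in 𝓝 t, r ∉ bad := hbad.isClosed.isOpen_compl.mem_nhds hb
      filter_upwards [self_mem_nhdsWithin, nhdsWithin_le_nhds hbn,
        nhdsWithin_le_nhds (Ioo_mem_nhds hT (by linarith : t < t + δ))] with r hr hrb hr2
      rcases lt_or_gt_of_ne hr with h | h
      · rw [hlt r h]
        exact (hz.deriv r hr2.1 (by exact_mod_cast h) hrb).congr_of_eventuallyEq (hlt' r h)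
      · rw [hge r h.le]
        exact (hy r ⟨h, hr2.2⟩).1.congr_of_eventuallyEq (hgt' r h)
    · rw [hge t h.le]
      exact (hy t ⟨h, h1'⟩).1.congr_of_eventuallyEq (hgt' t h)

/-- Existence of a maximal forward solution: if it stops at a finite time `T`, it has no limit
in `Ω` there. -/
theorem exists_maximal_solution (hbad : bad.Finite)
    (hF : ∀ t z, (t, z) ∈ Ω → t ∉ bad → ContinuousAt (Function.uncurry F) (t, z))
    (hloc : ∀ t₀ z₀, 0 ≤ t₀ → (t₀, z₀) ∈ Ω → ∃ δ > 0, ∃ y : ℝ → E, y t₀ = z₀ ∧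
      ContinuousOn y (Ico t₀ (t₀ + δ)) ∧
      ∀ t ∈ Ioo t₀ (t₀ + δ), HasDerivAt y (F t (y t)) t ∧ (t, y t) ∈ Ω)
    (h₀ : ((0 : ℝ), z₀) ∈ Ω) :
    ∃ (T : EReal) (z : ℝ → E), IsSolutionUpTo F bad Ω z₀ T z ∧
      ∀ (T' : ℝ) (w : E), T = T' → Tendsto z (𝓝[<] T') (𝓝 w) → (T', w) ∉ Ω := by
  let X := {a : EReal × (ℝ → E) // IsSolutionUpTo F bad Ω z₀ a.1 a.2}
  let r : X → X → Prop := fun a b => a.1.1 ≤ b.1.1 ∧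
    ∀ t : ℝ, 0 ≤ t → (t : EReal) < a.1.1 → b.1.2 t = a.1.2 t
  have hne : Nonempty X := by
    obtain ⟨δ, hδ, y, hy0, hyc, hy⟩ := hloc 0 z₀ le_rfl h₀
    rw [zero_add] at hyc hy
    refine ⟨⟨((δ : EReal), y), EReal.coe_pos.2 hδ, hy0, ?_, ?_, ?_⟩⟩
    · intro t h0 h1
      have h1' : t < δ := EReal.coe_lt_coe_iff.1 h1
      rcases h0.eq_or_lt with h | h
      · rw [← h]; simpa [hy0] using h₀
      · exact (hy t ⟨h, h1'⟩).2
    · intro t h0 h1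
      have h1' : t < δ := EReal.coe_lt_coe_iff.1 h1
      rcases h0.eq_or_lt with h | h
      · rw [← h]
        exact (hyc 0 ⟨le_rfl, hδ⟩).mono_of_mem_nhdsWithin (Ico_mem_nhdsGE hδ)
      · exact (hy t ⟨h, h1'⟩).1.continuousAt.continuousWithinAt
    · intro t h0 h1 _
      exact (hy t ⟨h0, EReal.coe_lt_coe_iff.1 h1⟩).1
  have hchain : ∀ c : Set X, IsChain r c → c.Nonempty → ∃ ub, ∀ a ∈ c, r a ub := by
    intro c hc ⟨a₀, ha₀⟩
    classical
    let T : EReal := sSup ((fun a : X => a.1.1) '' c)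
    have hex : ∀ t : ℝ, (t : EReal) < T → ∃ a ∈ c, (t : EReal) < a.1.1 := by
      intro t ht
      obtain ⟨_, ⟨a, ha, rfl⟩, h⟩ := lt_sSup_iff.1 ht
      exact ⟨a, ha, h⟩
    let z : ℝ → E := fun t => if h : (t : EReal) < T then (hex t h).choose.1.2 t else 0
    have hle : ∀ a ∈ c, a.1.1 ≤ T := fun a ha => le_sSup ⟨a, ha, rfl⟩
    have hz : ∀ a ∈ c, ∀ t : ℝ, 0 ≤ t → (t : EReal) < a.1.1 → z t = a.1.2 t := by
      intro a ha t h0 ht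
      have hT : (t : EReal) < T := ht.trans_le (hle a ha)
      have hch := (hex t hT).choose_spec
      simp only [z, hT, dif_pos]
      rcases eq_or_ne ((hex t hT).choose) a with h | h
      · rw [h]
      · rcases hc hch.1 ha h with h | h
        · exact (h.2 t h0 hch.2).symm
        · exact h.2 t h0 ht
    have hsol : IsSolutionUpTo F bad Ω z₀ T z := by
      refine ⟨a₀.2.pos.trans_le (hle a₀ ha₀), ?_, ?_, ?_, ?_⟩
      · rw [hz a₀ ha₀ 0 le_rfl (by exact_mod_cast a₀.2.pos), a₀.2.init]
      · intro t h0 ht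
        obtain ⟨a, ha, h⟩ := hex t ht
        rw [hz a ha t h0 h]; exact a.2.mem t h0 h
      · intro t h0 ht
        obtain ⟨a, ha, h⟩ := hex t ht
        refine (a.2.cont t h0 h).congr_of_eventuallyEq ?_ (hz a ha t h0 h)
        filter_upwards [self_mem_nhdsWithin, nhdsWithin_le_nhds (EReal.eventually_coe_lt h)]
          with x hx hx2 using hz a ha x hx hx2
      · intro t h0 ht hb
        obtain ⟨a, ha, h⟩ := hex t ht
        rw [hz a ha t h0.le h]
        refine (a.2.deriv t h0 h hb).congr_of_eventuallyEq ?_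
        filter_upwards [Ioi_mem_nhds h0, EReal.eventually_coe_lt h]
          with x hx hx2 using hz a ha x (le_of_lt hx) hx2
    exact ⟨⟨(T, z), hsol⟩, fun a ha => ⟨hle a ha, fun t h0 ht => hz a ha t h0 ht⟩⟩
  obtain ⟨m, hm⟩ := exists_maximal_of_nonempty_chains_bounded (r := r) hchain
    (fun {a b c} hab hbc => ⟨hab.1.trans hbc.1, fun t h0 ht => by
      rw [hbc.2 t h0 (ht.trans_le hab.1), hab.2 t h0 ht]⟩)
  refine ⟨m.1.1, m.1.2, m.2, ?_⟩
  intro T' w hT' hw hmem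
  have hm2 := m.2
  rw [hT'] at hm2
  obtain ⟨T'', z'', hlt, hsol, heq⟩ := hm2.extend hbad hF hloc hw hmem
  have h1 := hm ⟨(T'', z''), hsol⟩ ⟨by rw [hT']; exact EReal.coe_le_coe_iff.2 hlt.le, fun t _ ht => by
    rw [hT'] at ht; exact heq t (by exact_mod_cast ht)⟩
  have h2 : (T'' : EReal) ≤ T' := hT' ▸ h1.1
  exact absurd (EReal.coe_le_coe_iff.1 h2) (not_le.2 hlt)

end maximal

/-- Local forward solvability of `y' = G (p t, y)` for a `C¹` field `G` and a parameter `p` that is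
continuous up to the initial time. -/
lemma exists_local_solution_of_param {A E : Type*} [NormedAddCommGroup A] [NormedSpace ℝ A]
    [NormedAddCommGroup E] [NormedSpace ℝ E] [CompleteSpace E] {G : A × E → E} {p : ℝ → A}
    {t₀ δ : ℝ} {z₀ : E} (hδ : 0 < δ) (hp : ContinuousOn p (Icc t₀ (t₀ + δ)))
    (hG : ContDiffAt ℝ 1 G (p t₀, z₀)) :
    ∃ δ' > 0, δ' ≤ δ ∧ ∃ y : ℝ → E, y t₀ = z₀ ∧ ContinuousOn y (Ico t₀ (t₀ + δ')) ∧
      ∀ t ∈ Ioo t₀ (t₀ + δ'), HasDerivAt y (G (p t, y t)) t := by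
  obtain ⟨K, S, hS, hK⟩ := hG.exists_lipschitzOnWith
  obtain ⟨a, ha, haS⟩ := Metric.nhds_basis_closedBall.mem_iff.1 hS
  have hball : ∀ q x, q ∈ Metric.closedBall (p t₀) a → x ∈ Metric.closedBall z₀ a → (q, x) ∈ S :=
    fun q x hq hx => haS (by
      rw [← closedBall_prod_same]; exact ⟨hq, hx⟩)
  have hpt : ∀ᶠ t in 𝓝[≥] t₀, p t ∈ Metric.closedBall (p t₀) a := by
    have h1 : ContinuousWithinAt p (Ici t₀) t₀ :=
      (hp t₀ ⟨le_rfl, by linarith⟩).mono_of_mem_nhdsWithin (Icc_mem_nhdsGE (by linarith))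
    exact h1.eventually_mem (Metric.closedBall_mem_nhds _ ha)
  obtain ⟨d, hd, hdsub⟩ := mem_nhdsGE_iff_exists_Icc_subset.1 hpt
  set L : ℝ := K * a + ‖G (p t₀, z₀)‖ with hL
  have hL0 : 0 ≤ L := by positivity
  have hbound : ∀ q x, q ∈ Metric.closedBall (p t₀) a → x ∈ Metric.closedBall z₀ a →
      ‖G (q, x)‖ ≤ L := by
    intro q x hq hx
    have h1 := hK.norm_sub_le (hball q x hq hx) (mem_of_mem_nhds hS)
    have h2 : ‖(q, x) - (p t₀, z₀)‖ ≤ a := by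
      rw [← mem_closedBall_iff_norm, ← closedBall_prod_same]; exact ⟨hq, hx⟩
    have h3 := norm_le_norm_sub_add (G (q, x)) (G (p t₀, z₀))
    have h4 : (K : ℝ) * ‖(q, x) - (p t₀, z₀)‖ ≤ K * a := by gcongr
    linarith
  set δ' : ℝ := min (min δ (d - t₀)) (a / (L + 1)) with hδ'
  have hd0 : 0 < d - t₀ := by have : t₀ < d := hd; linarith
  have hpos : 0 < δ' := by
    have : 0 < a / (L + 1) := by positivity
    exact lt_min (lt_min hδ hd0) this
  have hle : δ' ≤ δ := (min_le_left _ _).trans (min_le_left _ _)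
  have hmem : ∀ t ∈ Icc t₀ (t₀ + δ'), p t ∈ Metric.closedBall (p t₀) a := fun t ht => by
    have : δ' ≤ d - t₀ := (min_le_left _ _).trans (min_le_right _ _)
    exact hdsub ⟨ht.1, by linarith [ht.2]⟩
  have hpl : IsPicardLindelof (fun t x => G (p t, x)) (tmin := t₀) (tmax := t₀ + δ')
      ⟨t₀, by simp [hpos.le]⟩ z₀ ⟨a, ha.le⟩ 0 ⟨L, hL0⟩ K := by
    refine ⟨?_, ?_, ?_, ?_⟩
    · intro t ht x hx y hy
      have := hK (hball _ _ (hmem t ht) hx) (hball _ _ (hmem t ht) hy)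
      simpa [Prod.edist_eq] using this
    · intro x hx t ht
      have h1 : ContinuousWithinAt G S (p t, x) := hK.continuousOn _ (hball _ _ (hmem t ht) hx)
      have h2 : ContinuousWithinAt (fun t => (p t, x)) (Icc t₀ (t₀ + δ')) t :=
        ((hp.mono (Icc_subset_Icc_right (by linarith))) t ht).prodMk continuousWithinAt_const
      exact ContinuousWithinAt.comp (g := G) (f := fun t => (p t, x)) h1 h2
        (fun r hr => hball _ _ (hmem r hr) hx)
    · intro t ht x hx
      exact hbound _ _ (hmem t ht) hx
    · have h1 : δ' ≤ a / (L + 1) := min_le_right _ _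
      have h2 : L * δ' ≤ a := by
        calc L * δ' ≤ L * (a / (L + 1)) := by gcongr
          _ ≤ (L + 1) * (a / (L + 1)) := by gcongr; linarith
          _ = a := by field_simp
      simp only [add_sub_cancel_left, sub_self, max_eq_left hpos.le]
      change L * δ' ≤ a - 0
      linarith
  obtain ⟨y, hy0, hy⟩ := hpl.exists_eq_forall_mem_Icc_hasDerivWithinAt₀
  refine ⟨δ', hpos, hle, y, hy0, fun t ht => ?_, fun t ht => ?_⟩
  · exact (hy t ⟨ht.1, ht.2.le⟩).continuousWithinAt.mono Ico_subset_Icc_self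
  · exact (hy t ⟨ht.1.le, ht.2.le⟩).hasDerivAt (Icc_mem_nhds ht.1 ht.2)

/-! ### The equations with the density as independent variable -/

/-- The equation of state as the argument uses it. Read as a function of the specific volume, `P`
is convex on `(0, β⁻¹]`, concave on `[β⁻¹, α⁻¹]` and convex on `[α⁻¹, ∞)`; in terms of the density,
`2 P' + ρ P''` is `ρ⁻³` times the second derivative with respect to the specific volume. -/
structure PressureShape (P : ℝ → ℝ) (α β : ℝ) : Prop where
  α_pos : 0 < α
  le : α ≤ β
  cont : ContinuousOn P (Ici 0)
  smooth : ∀ ρ, 0 < ρ → ρ ∉ ({α, β} : Set ℝ) → ContDiffAt ℝ 2 P ρ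
  deriv_pos : ∀ ρ, 0 < ρ → ρ < α ∨ β < ρ → 0 < deriv P ρ
  deriv2_pos : ∀ ρ, 0 < ρ → ρ < α ∨ β < ρ → 0 < 2 * deriv P ρ + ρ * deriv (deriv P) ρ
  middle : (∀ ρ ∈ Ioo α β, 0 < deriv P ρ ∧ 2 * deriv P ρ + ρ * deriv (deriv P) ρ < 0) ∨
    ∀ ρ ∈ Ioo α β, deriv P ρ = 0
  left_limit : ∀ ρ, 0 < ρ → ∃ c, Tendsto (deriv P) (𝓝[<] ρ) (𝓝 c) ∧
    (0 < c ∨ ∀ᶠ r in 𝓝[<] ρ, deriv P r = 0)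
  right_limit : ∀ ρ, 0 < ρ → ∃ c, Tendsto (deriv P) (𝓝[>] ρ) (𝓝 c) ∧
    (0 < c ∨ ∀ᶠ r in 𝓝[>] ρ, deriv P r = 0)
  convex_dense : ConvexOn ℝ (Ioc 0 β⁻¹) (pressureOfVolume P)
  concave_middle : ConcaveOn ℝ (Icc β⁻¹ α⁻¹) (pressureOfVolume P)
  convex_dilute : ConvexOn ℝ (Ici α⁻¹) (pressureOfVolume P)

/-- With `u = -ε v` (so `v` is the speed), the quantity `1 - u s`. -/
noncomputable def relSpeed (ε s v : ℝ) : ℝ := 1 + ε * v * s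

/-- Minus the common denominator of the self-similar equations, `(1 - u s)² - s² c`, as a function
of `c = p'(ρ)`. It is positive where the flow is supersonic relative to the ray `x = t / s`. -/
noncomputable def sonicGap (c ε s v : ℝ) : ℝ := relSpeed ε s v ^ 2 - s ^ 2 * c

/-- A solution of the self-similar equations along which the density `ρ = ρ₁ + ε t` is the
independent variable (up to sign and translation), while `s` and the speed `v = -ε u > 0` are the
unknowns. For `ε = 1` the gas moves inwards and is compressed, for `ε = -1` it moves outwards and
is rarefied. The equations are not required where the density is in `bad`. -/
structure IsCurve (P : ℝ → ℝ) (bad : Set ℝ) (ε ρ₁ T : ℝ) (s v : ℝ → ℝ) : Prop where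
  T_pos : 0 < T
  ρ_pos : ∀ t ∈ Ico 0 T, 0 < ρ₁ + ε * t
  v_pos : ∀ t ∈ Ico 0 T, 0 < v t
  q_pos : ∀ t ∈ Ico 0 T, 0 < relSpeed ε (s t) (v t)
  cont_s : ContinuousOn s (Ico 0 T)
  cont_v : ContinuousOn v (Ico 0 T)
  deriv_s : ∀ t ∈ Ioo 0 T, ρ₁ + ε * t ∉ bad →
    HasDerivAt s (sonicGap (deriv P (ρ₁ + ε * t)) ε (s t) (v t) /
      (2 * v t * (ρ₁ + ε * t) * relSpeed ε (s t) (v t))) t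
  deriv_v : ∀ t ∈ Ioo 0 T, ρ₁ + ε * t ∉ bad →
    HasDerivAt v (-(deriv P (ρ₁ + ε * t) * s t / ((ρ₁ + ε * t) * relSpeed ε (s t) (v t)))) t

/-- The right-hand side of the equations for `(s, v)`; the first argument is `(p'(ρ), ρ)`. -/
noncomputable def curveField (ε : ℝ) (a : (ℝ × ℝ) × (ℝ × ℝ)) : ℝ × ℝ :=
  (sonicGap a.1.1 ε a.2.1 a.2.2 / (2 * a.2.2 * a.1.2 * relSpeed ε a.2.1 a.2.2),
    -(a.1.1 * a.2.1 / (a.1.2 * relSpeed ε a.2.1 a.2.2)))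

lemma contDiffAt_curveField (ε : ℝ) (a : (ℝ × ℝ) × (ℝ × ℝ)) (hρ : 0 < a.1.2) (hv : 0 < a.2.2)
    (hq : 0 < relSpeed ε a.2.1 a.2.2) : ContDiffAt ℝ 1 (curveField ε) a := by
  unfold curveField sonicGap relSpeed at *
  refine ContDiffAt.prodMk (ContDiffAt.div ?_ ?_ (by positivity))
    (ContDiffAt.neg (ContDiffAt.div ?_ ?_ (by positivity))) <;> fun_prop

section shape

variable {P : ℝ → ℝ} {α β : ℝ}

/-- The one-sided limit of `p'` along a curve. -/
lemma PressureShape.tendsto_deriv_along (h : PressureShape P α β) {ε : ℝ} (hε : ε = 1 ∨ ε = -1)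
    {ρ₁ t₀ : ℝ} (hρ : 0 < ρ₁ + ε * t₀) :
    ∃ c, Tendsto (fun t => deriv P (ρ₁ + ε * t)) (𝓝[>] t₀) (𝓝 c) := by
  have hc : Tendsto (fun t => ρ₁ + ε * t) (𝓝[>] t₀) (𝓝 (ρ₁ + ε * t₀)) :=
    (Continuous.tendsto (by fun_prop) t₀).mono_left nhdsWithin_le_nhds
  rcases hε with rfl | rfl
  · obtain ⟨c, hc1, -⟩ := h.right_limit _ hρ
    refine ⟨c, hc1.comp (tendsto_nhdsWithin_iff.2 ⟨hc, ?_⟩)⟩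
    filter_upwards [self_mem_nhdsWithin] with t ht
    simp only [mem_Ioi] at *; linarith
  · obtain ⟨c, hc1, -⟩ := h.left_limit _ hρ
    refine ⟨c, hc1.comp (tendsto_nhdsWithin_iff.2 ⟨hc, ?_⟩)⟩
    filter_upwards [self_mem_nhdsWithin] with t ht
    simp only [mem_Ioi, mem_Iio] at *; linarith

lemma PressureShape.contDiffAt_deriv (h : PressureShape P α β) {ρ : ℝ} (h0 : 0 < ρ)
    (hb : ρ ∉ ({α, β} : Set ℝ)) : ContDiffAt ℝ 1 (deriv P) ρ := by
  have := ((h.smooth ρ h0 hb).fderiv_right (m := 1) (by norm_num)).clm_apply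
    (contDiffAt_const (c := (1 : ℝ)))
  exact this

lemma PressureShape.continuousAt_deriv (h : PressureShape P α β) {ρ : ℝ} (h0 : 0 < ρ)
    (hb : ρ ∉ ({α, β} : Set ℝ)) : ContinuousAt (deriv P) ρ :=
  (h.contDiffAt_deriv h0 hb).continuousAt

lemma PressureShape.hasDerivAt (h : PressureShape P α β) {ρ : ℝ} (h0 : 0 < ρ)
    (hb : ρ ∉ ({α, β} : Set ℝ)) : HasDerivAt P (deriv P ρ) ρ :=
  ((h.smooth ρ h0 hb).differentiableAt (by norm_num)).hasDerivAt

lemma PressureShape.deriv_nonneg (h : PressureShape P α β) {ρ : ℝ} (h0 : 0 < ρ)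
    (hb : ρ ∉ ({α, β} : Set ℝ)) : 0 ≤ deriv P ρ := by
  simp only [mem_insert_iff, mem_singleton_iff, not_or] at hb
  rcases lt_or_gt_of_ne hb.1 with h1 | h1
  · exact (h.deriv_pos ρ h0 (Or.inl h1)).le
  rcases lt_or_gt_of_ne hb.2 with h2 | h2
  · rcases h.middle with hm | hm
    · exact (hm ρ ⟨h1, h2⟩).1.le
    · exact (hm ρ ⟨h1, h2⟩).ge
  · exact (h.deriv_pos ρ h0 (Or.inr h2)).le

/-- The set of times at which a curve meets the densities `α` and `β` is finite. -/
lemma finite_preimage_bad (α β : ℝ) {ε : ℝ} (hε : ε = 1 ∨ ε = -1) (ρ₁ : ℝ) :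
    ((fun t : ℝ => ρ₁ + ε * t) ⁻¹' ({α, β} : Set ℝ)).Finite := by
  refine Set.Finite.preimage (fun x _ y _ hxy => ?_) (by simp)
  have hxy' : ρ₁ + ε * x = ρ₁ + ε * y := hxy
  rcases hε with rfl | rfl <;> linarith

/-- A maximal curve through given data. As long as the density stays in the open set `D`, the only
way to stop at a finite time with limiting values of `s` and `v` is that `v` or `1 - u s` vanishes
in the limit. -/
theorem PressureShape.exists_maximal_curve (h : PressureShape P α β) {ε : ℝ}
    (hε : ε = 1 ∨ ε = -1) {D : Set ℝ} (hD : IsOpen D) (hDpos : D ⊆ Ioi 0) {ρ₁ s₁ v₁ : ℝ}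
    (hρ₁ : ρ₁ ∈ D) (hv₁ : 0 < v₁) (hq₁ : 0 < relSpeed ε s₁ v₁) :
    ∃ s v : ℝ → ℝ, s 0 = s₁ ∧ v 0 = v₁ ∧
      ((∃ T, IsCurve P {α, β} ε ρ₁ T s v ∧ (∀ t ∈ Ico 0 T, ρ₁ + ε * t ∈ D) ∧
          ∀ s' v', Tendsto s (𝓝[<] T) (𝓝 s') → Tendsto v (𝓝[<] T) (𝓝 v') →
            ρ₁ + ε * T ∈ D → 0 < v' → relSpeed ε s' v' ≤ 0) ∨
        ∀ T > 0, IsCurve P {α, β} ε ρ₁ T s v ∧ ∀ t ∈ Ico 0 T, ρ₁ + ε * t ∈ D) := by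
  set F : ℝ → ℝ × ℝ → ℝ × ℝ := fun t z => curveField ε ((deriv P (ρ₁ + ε * t), ρ₁ + ε * t), z)
    with hFdef
  set Ω : Set (ℝ × (ℝ × ℝ)) :=
    {a | ρ₁ + ε * a.1 ∈ D ∧ 0 < a.2.2 ∧ 0 < relSpeed ε a.2.1 a.2.2} with hΩ
  have hΩo : IsOpen Ω := by
    refine (hD.preimage (f := fun a : ℝ × (ℝ × ℝ) => ρ₁ + ε * a.1) (by fun_prop)).inter ((isOpen_lt (f := fun _ => (0 : ℝ))
      (g := fun a : ℝ × (ℝ × ℝ) => a.2.2) (by fun_prop) (by fun_prop)).inter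
      (isOpen_lt (f := fun _ => (0 : ℝ)) (g := fun a : ℝ × (ℝ × ℝ) => relSpeed ε a.2.1 a.2.2)
        (by fun_prop) ?_))
    unfold relSpeed; fun_prop
  have hfin := finite_preimage_bad α β hε ρ₁
  obtain ⟨T, z, hz, hmax⟩ := exists_maximal_solution (F := F) (Ω := Ω) (z₀ := (s₁, v₁)) hfin
    (by
      rintro t z ⟨h1, h2, h3⟩ hb
      have hpos : 0 < ρ₁ + ε * t := hDpos h1
      have hc := (contDiffAt_curveField ε ((deriv P (ρ₁ + ε * t), ρ₁ + ε * t), z) hpos h2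
        h3).continuousAt
      have hd : ContinuousAt (fun a : ℝ × (ℝ × ℝ) => deriv P (ρ₁ + ε * a.1)) (t, z) :=
        ContinuousAt.comp (g := deriv P) (f := fun a : ℝ × (ℝ × ℝ) => ρ₁ + ε * a.1)
          (h.continuousAt_deriv hpos hb) (by fun_prop)
      have hd2 : ContinuousAt (fun a : ℝ × (ℝ × ℝ) =>
          (((deriv P (ρ₁ + ε * a.1), ρ₁ + ε * a.1), a.2) : (ℝ × ℝ) × (ℝ × ℝ))) (t, z) :=
        (hd.prodMk (by fun_prop)).prodMk (by fun_prop)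
      exact ContinuousAt.comp (g := curveField ε) (f := fun a : ℝ × (ℝ × ℝ) =>
          (((deriv P (ρ₁ + ε * a.1), ρ₁ + ε * a.1), a.2) : (ℝ × ℝ) × (ℝ × ℝ))) hc hd2)
    (by
      rintro t₀ z₀ - ⟨h1, h2, h3⟩
      simp only at h1 h2 h3
      have hpos : 0 < ρ₁ + ε * t₀ := hDpos h1
      obtain ⟨c, hc⟩ := h.tendsto_deriv_along hε hpos
      -- the field with `p'` replaced at the initial time by its one-sided limit
      set p : ℝ → ℝ × ℝ := fun t =>
        (Function.update (fun t => deriv P (ρ₁ + ε * t)) t₀ c t, ρ₁ + ε * t) with hp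
      have hgood : ∀ᶠ t in 𝓝[>] t₀, ρ₁ + ε * t ∈ D ∧ ρ₁ + ε * t ∉ ({α, β} : Set ℝ) := by
        have hcont : Continuous fun t : ℝ => ρ₁ + ε * t := by fun_prop
        have e1 : ∀ᶠ t in 𝓝[>] t₀, ρ₁ + ε * t ∈ D :=
          nhdsWithin_le_nhds (hcont.continuousAt.eventually_mem (hD.mem_nhds h1))
        have e2 : ∀ᶠ t in 𝓝[>] t₀, ρ₁ + ε * t ∉ ({α, β} : Set ℝ) := by
          have := (hfin.sdiff (t := {t₀})).isClosed.isOpen_compl.mem_nhds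
            (show t₀ ∈ (_ \ {t₀})ᶜ by simp)
          filter_upwards [nhdsWithin_le_nhds this, self_mem_nhdsWithin] with t ht ht2 hb
          exact ht ⟨hb, ne_of_gt ht2⟩
        exact e1.and e2
      obtain ⟨d, hd, hdsub⟩ := (mem_nhdsGT_iff_exists_Ioc_subset).1 hgood
      simp only [mem_Ioi] at hd
      have hpc : ContinuousOn p (Icc t₀ (t₀ + (d - t₀))) := by
        intro t ht
        refine ContinuousWithinAt.prodMk ?_ (by fun_prop)
        rcases ht.1.eq_or_lt with h' | h'
        · rw [← h', continuousWithinAt_update_same]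
          refine hc.mono_left (nhdsWithin_mono _ ?_)
          rintro x ⟨hx1, hx2⟩
          exact lt_of_le_of_ne hx1.1 (Ne.symm hx2)
        · have hg := hdsub ⟨h', by linarith [ht.2]⟩
          rw [continuousWithinAt_update_of_ne (ne_of_gt h')]
          exact (ContinuousAt.comp (g := deriv P) (f := fun t : ℝ => ρ₁ + ε * t)
            (h.continuousAt_deriv (hDpos hg.1) hg.2) (by fun_prop)).continuousWithinAt
      obtain ⟨δ, hδ, hδle, y, hy0, hyc, hy⟩ := exists_local_solution_of_param (G := curveField ε)
        (p := p) (t₀ := t₀) (z₀ := z₀) (δ := d - t₀) (by linarith) hpc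
        (contDiffAt_curveField ε _ (by simpa [hp] using hpos) h2 h3)
      have hyΩ : ∀ᶠ t in 𝓝[>] t₀, (t, y t) ∈ Ω := by
        have hw : ContinuousWithinAt (fun t => (t, y t)) (Ioi t₀) t₀ :=
          continuousWithinAt_id.prodMk (((hyc t₀ ⟨le_rfl, by linarith⟩).mono_of_mem_nhdsWithin
            (Ico_mem_nhdsGE (by linarith))).mono Ioi_subset_Ici_self)
        refine hw.eventually_mem (hΩo.mem_nhds ?_)
        simp only [hy0]; exact ⟨h1, h2, h3⟩
      obtain ⟨d', hd', hdsub'⟩ := (mem_nhdsGT_iff_exists_Ioc_subset).1 hyΩ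
      simp only [mem_Ioi] at hd'
      refine ⟨min δ (d' - t₀), lt_min hδ (by linarith), y, hy0, hyc.mono
        (Ico_subset_Ico_right (by linarith [min_le_left δ (d' - t₀)])), fun t ht => ⟨?_, ?_⟩⟩
      · have := hy t ⟨ht.1, by linarith [ht.2, min_le_left δ (d' - t₀)]⟩
        simpa [hp, Function.update_of_ne (ne_of_gt ht.1)] using this
      · exact hdsub' ⟨ht.1, by linarith [ht.2, min_le_right δ (d' - t₀)]⟩)
    (by simpa [hΩ] using ⟨hρ₁, hv₁, hq₁⟩)
  have hcurve : ∀ T' : ℝ, 0 < T' → (T' : EReal) ≤ T →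
      IsCurve P {α, β} ε ρ₁ T' (fun t => (z t).1) (fun t => (z t).2) ∧
        ∀ t ∈ Ico 0 T', ρ₁ + ε * t ∈ D := by
    intro T' hT' hle
    have hlt : ∀ t : ℝ, t < T' → (t : EReal) < T := fun t ht =>
      (EReal.coe_lt_coe_iff.2 ht).trans_le hle
    have hzc : ContinuousOn z (Ico 0 T') := fun t ht =>
      (hz.cont t ht.1 (hlt t ht.2)).mono Ico_subset_Ici_self
    refine ⟨⟨hT', fun t ht => hDpos (hz.mem t ht.1 (hlt t ht.2)).1,
      fun t ht => (hz.mem t ht.1 (hlt t ht.2)).2.1, fun t ht => (hz.mem t ht.1 (hlt t ht.2)).2.2,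
      hzc.fst, hzc.snd, fun t ht hb => ?_, fun t ht hb => ?_⟩,
      fun t ht => (hz.mem t ht.1 (hlt t ht.2)).1⟩
    · exact (hz.deriv t ht.1 (hlt t ht.2) hb).fst
    · exact (hz.deriv t ht.1 (hlt t ht.2) hb).snd
  refine ⟨fun t => (z t).1, fun t => (z t).2, by simp [hz.init], by simp [hz.init], ?_⟩
  rcases eq_or_ne T ⊤ with hT | hT
  · exact Or.inr fun T' hT' => hcurve T' hT' (by rw [hT]; exact le_top)
  · lift T to ℝ using ⟨hT, ne_bot_of_gt hz.pos⟩
    refine Or.inl ⟨T, (hcurve T (EReal.coe_pos.1 hz.pos) le_rfl).1,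
      (hcurve T (EReal.coe_pos.1 hz.pos) le_rfl).2, fun s' v' hs' hv' hD' hpos => ?_⟩
    by_contra hcon
    exact hmax T (s', v') rfl (hs'.prodMk_nhds hv') ⟨hD', hpos, not_le.1 hcon⟩

end shape

/-! ### Monotone functions and their inverses -/

/-- A transitive relation that holds between the end points of every interval without points of
the finite set `F` inside holds between the end points of every interval. -/
lemma rel_of_finite_exceptions {r : ℝ → ℝ → Prop} (htrans : ∀ x y z, r x y → r y z → r x z)
    {F : Set ℝ} (hF : F.Finite) {D : Set ℝ} (hD : D.OrdConnected)
    (h : ∀ x ∈ D, ∀ y ∈ D, x < y → (∀ z ∈ Ioo x y, z ∉ F) → r x y) :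
    ∀ x ∈ D, ∀ y ∈ D, x < y → r x y := by
  have key : ∀ n : ℕ, ∀ x ∈ D, ∀ y ∈ D, x < y → (F ∩ Ioo x y).ncard ≤ n → r x y := by
    intro n
    induction n with
    | zero =>
      intro x hx y hy hxy hn
      refine h x hx y hy hxy fun z hz hzF => ?_
      have : F ∩ Ioo x y = ∅ := by
        rwa [Nat.le_zero, Set.ncard_eq_zero (hF.inter_of_left _)] at hn
      exact (this ▸ (⟨hzF, hz⟩ : z ∈ F ∩ Ioo x y) : z ∈ (∅ : Set ℝ))
    | succ n ih =>
      intro x hx y hy hxy hn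
      by_cases hne : ∃ z ∈ Ioo x y, z ∈ F
      · obtain ⟨z, hz, hzF⟩ := hne
        have hzD : z ∈ D := hD.out hx hy ⟨hz.1.le, hz.2.le⟩
        have hfin : (F ∩ Ioo x y).Finite := hF.inter_of_left _
        have hlt : ∀ A : Set ℝ, A ⊆ F ∩ Ioo x y → z ∉ A → A.ncard ≤ n := fun A hA hz' => by
          have := Set.ncard_lt_ncard (hA.ssubset_of_mem_notMem ⟨hzF, hz⟩ hz') hfin
          omega
        exact htrans _ z _
          (ih x hx z hzD hz.1 (hlt _ (fun a ha => ⟨ha.1, ha.2.1, ha.2.2.trans hz.2⟩)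
            fun ha => lt_irrefl _ ha.2.2))
          (ih z hzD y hy hz.2 (hlt _ (fun a ha => ⟨ha.1, hz.1.trans ha.2.1, ha.2.2⟩)
            fun ha => lt_irrefl _ ha.2.1))
      · exact h x hx y hy hxy fun z hz hzF => hne ⟨z, hz, hzF⟩
  exact fun x hx y hy hxy => key _ x hx y hy hxy le_rfl

lemma strictMonoOn_of_hasDerivAt_pos_off_finite {f f' : ℝ → ℝ} {T : ℝ} {F : Set ℝ}
    (hF : F.Finite) (hc : ContinuousOn f (Ico 0 T))
    (hd : ∀ t ∈ Ioo 0 T, t ∉ F → HasDerivAt f (f' t) t ∧ 0 < f' t) : StrictMonoOn f (Ico 0 T) := by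
  refine fun x hx y hy hxy => rel_of_finite_exceptions (r := fun x y => f x < f y)
    (fun _ _ _ => lt_trans) hF ordConnected_Ico ?_ x hx y hy hxy
  intro x hx y hy hxy hz
  refine strictMonoOn_of_deriv_pos (convex_Icc x y)
    (hc.mono fun z hz => ⟨hx.1.trans hz.1, hz.2.trans_lt hy.2⟩) ?_ ⟨le_rfl, hxy.le⟩
    ⟨hxy.le, le_rfl⟩ hxy
  intro z hz'
  rw [interior_Icc] at hz'
  have := hd z ⟨hx.1.trans_lt hz'.1, hz'.2.trans hy.2⟩ (hz z hz')
  rw [this.1.deriv]; exact this.2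

lemma antitoneOn_of_hasDerivAt_nonpos_off_finite {f f' : ℝ → ℝ} {T : ℝ} {F : Set ℝ}
    (hF : F.Finite) (hc : ContinuousOn f (Ico 0 T))
    (hd : ∀ t ∈ Ioo 0 T, t ∉ F → HasDerivAt f (f' t) t ∧ f' t ≤ 0) : AntitoneOn f (Ico 0 T) := by
  intro x hx y hy hxy
  rcases hxy.eq_or_lt with h | h
  · rw [h]
  refine rel_of_finite_exceptions (r := fun x y => f y ≤ f x)
    (fun _ _ _ h1 h2 => h2.trans h1) hF ordConnected_Ico ?_ x hx y hy h
  intro x hx y hy hxy hz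
  refine antitoneOn_of_deriv_nonpos (convex_Icc x y)
    (hc.mono fun z hz => ⟨hx.1.trans hz.1, hz.2.trans_lt hy.2⟩) ?_ ?_ ⟨le_rfl, hxy.le⟩
    ⟨hxy.le, le_rfl⟩ hxy.le
  · intro z hz'
    rw [interior_Icc] at hz'
    exact (hd z ⟨hx.1.trans_lt hz'.1, hz'.2.trans hy.2⟩
      (hz z hz')).1.differentiableAt.differentiableWithinAt
  · intro z hz'
    rw [interior_Icc] at hz'
    have := hd z ⟨hx.1.trans_lt hz'.1, hz'.2.trans hy.2⟩ (hz z hz')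
    rw [this.1.deriv]; exact this.2

/-- The inverse of a strictly increasing continuous function on `[0, T)`. -/
lemma exists_inverse {f : ℝ → ℝ} {T : ℝ} (hf : StrictMonoOn f (Ico 0 T)) {I : Set ℝ}
    (hI : f '' Ico 0 T = I) :
    ∃ g : ℝ → ℝ, (∀ x ∈ I, g x ∈ Ico 0 T ∧ f (g x) = x) ∧ (∀ t ∈ Ico 0 T, g (f t) = t) ∧
      StrictMonoOn g I ∧ ContinuousOn g I := by
  have hex : ∀ x ∈ I, ∃ t ∈ Ico 0 T, f t = x := fun x hx => by rwa [← hI] at hx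
  classical
  let g : ℝ → ℝ := fun x => if h : x ∈ I then (hex x h).choose else 0
  have hg : ∀ x ∈ I, g x ∈ Ico 0 T ∧ f (g x) = x := fun x hx => by
    simp only [g, hx, dif_pos]; exact (hex x hx).choose_spec
  have hlt : ∀ x ∈ I, ∀ t ∈ Ico 0 T, (f t < x ↔ t < g x) := fun x hx t ht => by
    rw [← hf.lt_iff_lt ht (hg x hx).1, (hg x hx).2]
  have hgt : ∀ x ∈ I, ∀ t ∈ Ico 0 T, (x < f t ↔ g x < t) := fun x hx t ht => by
    rw [← hf.lt_iff_lt (hg x hx).1 ht, (hg x hx).2]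
  refine ⟨g, hg, fun t ht => ?_, fun x hx y hy hxy => ?_, fun x hx => ?_⟩
  · exact hf.injOn (hg _ (hI ▸ mem_image_of_mem f ht)).1 ht (hg _ (hI ▸ mem_image_of_mem f ht)).2
  · rw [← hlt y hy _ (hg x hx).1, (hg x hx).2]; exact hxy
  · refine tendsto_order.2 ⟨fun a ha => ?_, fun b hb => ?_⟩
    · rcases lt_or_ge a 0 with h0 | h0
      · filter_upwards [self_mem_nhdsWithin] with y hy using h0.trans_le (hg y hy).1.1
      · have haI : a ∈ Ico 0 T := ⟨h0, ha.trans (hg x hx).1.2⟩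
        filter_upwards [self_mem_nhdsWithin,
          nhdsWithin_le_nhds (Ioi_mem_nhds ((hlt x hx a haI).2 ha))] with y hy hy2
        exact (hlt y hy a haI).1 hy2
    · obtain ⟨b', hb1, hb2⟩ := exists_between (lt_min hb (hg x hx).1.2)
      have hbI : b' ∈ Ico 0 T := ⟨(hg x hx).1.1.trans hb1.le, hb2.trans_le (min_le_right _ _)⟩
      filter_upwards [self_mem_nhdsWithin,
        nhdsWithin_le_nhds (Iio_mem_nhds ((hgt x hx b' hbI).2 hb1))] with y hy hy2
      exact ((hgt y hy b' hbI).1 hy2).trans (hb2.trans_le (min_le_left _ _))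

lemma image_Ico_of_tendsto {f : ℝ → ℝ} {T s' : ℝ} (hT : 0 < T) (hf : StrictMonoOn f (Ico 0 T))
    (hc : ContinuousOn f (Ico 0 T)) (hl : Tendsto f (𝓝[<] T) (𝓝 s')) :
    f '' Ico 0 T = Ico (f 0) s' := by
  have hev : ∀ t < T, ∀ᶠ r in 𝓝[<] T, r ∈ Ioo t T := fun t ht => Ioo_mem_nhdsLT ht
  have hlt : ∀ t ∈ Ico 0 T, f t < s' := fun t ht => by
    obtain ⟨t', h1, h2⟩ := exists_between ht.2
    refine (hf ht ⟨ht.1.trans h1.le, h2⟩ h1).trans_le (ge_of_tendsto hl ?_)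
    filter_upwards [hev t' h2] with r hr
    exact (hf ⟨ht.1.trans h1.le, h2⟩ ⟨ht.1.trans (h1.le.trans hr.1.le), hr.2⟩ hr.1).le
  refine Subset.antisymm ?_ ?_
  · rintro _ ⟨t, ht, rfl⟩
    exact ⟨hf.monotoneOn ⟨le_rfl, hT⟩ ht ht.1, hlt t ht⟩
  · rintro x ⟨hx1, hx2⟩
    obtain ⟨t, ht, ht'⟩ := ((hl.eventually (lt_mem_nhds hx2)).and (hev 0 hT)).exists
    obtain ⟨r, hr, hrx⟩ := intermediate_value_Icc ht'.1.le
      (hc.mono (Icc_subset_Ico_right ht'.2)) ⟨hx1, ht.le⟩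
    exact ⟨r, ⟨hr.1, hr.2.trans_lt ht'.2⟩, hrx⟩

lemma image_Ico_of_tendsto_atTop {f : ℝ → ℝ} {T : ℝ} (hT : 0 < T)
    (hf : StrictMonoOn f (Ico 0 T)) (hc : ContinuousOn f (Ico 0 T))
    (hl : Tendsto f (𝓝[<] T) atTop) : f '' Ico 0 T = Ici (f 0) := by
  refine Subset.antisymm ?_ ?_
  · rintro _ ⟨t, ht, rfl⟩
    exact hf.monotoneOn ⟨le_rfl, hT⟩ ht ht.1
  · intro x hx1
    obtain ⟨t, ht, ht'⟩ := ((hl.eventually_gt_atTop x).and (Ioo_mem_nhdsLT hT)).exists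
    obtain ⟨r, hr, hrx⟩ := intermediate_value_Icc ht'.1.le
      (hc.mono (Icc_subset_Ico_right ht'.2)) ⟨hx1, ht.le⟩
    exact ⟨r, ⟨hr.1, hr.2.trans_lt ht'.2⟩, hrx⟩

lemma exists_tendsto_of_monotoneOn {f : ℝ → ℝ} {T : ℝ} (hT : 0 < T)
    (hf : MonotoneOn f (Ico 0 T)) :
    (∃ l, Tendsto f (𝓝[<] T) (𝓝 l) ∧ ∀ t ∈ Ico 0 T, f t ≤ l) ∨ Tendsto f (𝓝[<] T) atTop := by
  by_cases hb : BddAbove (f '' Ico 0 T)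
  · refine Or.inl ⟨sSup (f '' Ico 0 T), ?_, fun t ht => le_csSup hb ⟨t, ht, rfl⟩⟩
    refine tendsto_order.2 ⟨fun a ha => ?_, fun b hb' => ?_⟩
    · obtain ⟨_, ⟨t, ht, rfl⟩, hat⟩ := exists_lt_of_lt_csSup
        ((nonempty_Ico.2 hT).image f) ha
      filter_upwards [Ioo_mem_nhdsLT ht.2] with r hr
      exact hat.trans_le (hf ht ⟨ht.1.trans hr.1.le, hr.2⟩ hr.1.le)
    · filter_upwards [Ioo_mem_nhdsLT hT] with r hr
      exact (le_csSup hb ⟨r, ⟨hr.1.le, hr.2⟩, rfl⟩).trans_lt hb'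
  · right
    refine tendsto_atTop.2 fun a => ?_
    simp only [BddAbove, upperBounds, Set.Nonempty, mem_ofPred_eq, not_exists] at hb
    have := hb a
    push Not at this
    obtain ⟨_, ⟨t, ht, rfl⟩, hat⟩ := this
    filter_upwards [Ioo_mem_nhdsLT ht.2] with r hr
    exact hat.le.trans (hf ht ⟨ht.1.trans hr.1.le, hr.2⟩ hr.1.le)

lemma exists_tendsto_of_antitoneOn {f : ℝ → ℝ} {T : ℝ} (hT : 0 < T)
    (hf : AntitoneOn f (Ico 0 T)) (h0 : ∀ t ∈ Ico 0 T, 0 < f t) :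
    ∃ l, Tendsto f (𝓝[<] T) (𝓝 l) ∧ 0 ≤ l ∧ ∀ t ∈ Ico 0 T, l ≤ f t := by
  rcases exists_tendsto_of_monotoneOn hT hf.neg with ⟨l, hl, hle⟩ | hl
  · refine ⟨-l, by simpa using hl.neg, ?_, fun t ht => by have : -f t ≤ l := hle t ht; linarith⟩
    have : l ≤ 0 := le_of_tendsto hl (by
      filter_upwards [Ioo_mem_nhdsLT hT] with r hr
      have := h0 r ⟨hr.1.le, hr.2⟩
      change -f r ≤ 0; linarith)
    linarith
  · exfalso
    obtain ⟨t, ht, ht'⟩ := ((hl.eventually_gt_atTop 0).and (Ioo_mem_nhdsLT hT)).exists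
    have := h0 t ⟨ht'.1.le, ht'.2⟩
    have ht2 : 0 < -f t := ht
    linarith

/-- The inverse function tends to the end `T` of its range. -/
lemma tendsto_inverse {f g : ℝ → ℝ} {T : ℝ} (hT : 0 < T) {I : Set ℝ} {l : Filter ℝ}
    (hf : StrictMonoOn f (Ico 0 T)) (hg : ∀ x ∈ I, g x ∈ Ico 0 T ∧ f (g x) = x)
    (hl : ∀ᶠ x in l, x ∈ I) (hl2 : ∀ t ∈ Ico 0 T, ∀ᶠ x in l, f t < x) :
    Tendsto g l (𝓝[<] T) := by
  refine tendsto_nhdsWithin_iff.2 ⟨tendsto_order.2 ⟨fun a ha => ?_, fun b hb => ?_⟩,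
    hl.mono fun x hx => (hg x hx).1.2⟩
  · have hmem : max a 0 ∈ Ico 0 T := ⟨le_max_right _ _, max_lt ha hT⟩
    filter_upwards [hl, hl2 _ hmem] with x hx hx2
    have := (hf.lt_iff_lt hmem (hg x hx).1).1 (by rw [(hg x hx).2]; exact hx2)
    exact (le_max_left _ _).trans_lt this
  · filter_upwards [hl] with x hx using (hg x hx).1.2.trans hb

/-! ### Profiles and their concatenation -/

/-- Away from shocks and kinks a profile either solves the self-similar equations (and the pressure
obeys the chain rule) or is vacuum with constant velocity. -/
def RegularAt (P U R : ℝ → ℝ) (s : ℝ) : Prop :=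
  (SolvesODEAt P U R s ∧ HasDerivAt (fun r => P (R r)) (deriv P (R s) *
    (2 * R s * U s * (1 - U s * s) / (s ^ 2 * deriv P (R s) - (1 - U s * s) ^ 2))) s) ∨
  ∀ᶠ r in 𝓝 s, R r = 0 ∧ U r = U s

/-- The profile jumps at `s` by an admissible shock, and its value at `s` is the state behind the
shock. The shock compresses the gas if `ε = 1` and rarefies it if `ε = -1`. -/
def JumpsAt (P : ℝ → ℝ) (ε : ℝ) (U R : ℝ → ℝ) (s : ℝ) : Prop :=
  ∃ u₁ ρ₁ : ℝ, IsShockAt P U R s u₁ ρ₁ (U s) (R s) ∧ 0 < ε * (R s - ρ₁)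

/-- A bounded profile on the open set `I` of values of `s`, with shocks at `S` and kinks at `K`. -/
structure IsProfileOn (P : ℝ → ℝ) (ε : ℝ) (U R : ℝ → ℝ) (I : Set ℝ) (S K : Finset ℝ) : Prop where
  smooth : ∀ s ∈ I, s ∉ S → s ∉ K → RegularAt P U R s
  kink : ∀ s ∈ K, s ∈ I ∧ ContinuousAt U s ∧ ContinuousAt R s
  shock : ∀ s ∈ S, s ∈ I ∧ JumpsAt P ε U R s
  nonneg : ∀ s ∈ I, 0 ≤ R s
  bounded : ∃ C, ∀ s ∈ I, |U s| ≤ C ∧ R s ≤ C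

/-- The three possible ends of a profile on `[s₁, ∞)`: rest, vacuum or decay, the latter two only
for gas that moves outwards (`ε = -1`). -/
def EndsWell (ε : ℝ) (U R : ℝ → ℝ) (s₁ : ℝ) : Prop :=
  ((∀ s ≥ s₁, 0 < R s) ∧ ∃ s₂ > s₁, ∃ ρ₂ > 0, ∀ s > s₂, U s = 0 ∧ R s = ρ₂) ∨
  (ε = -1 ∧ ∃ s₂ ≥ s₁, (∀ s ∈ Ico s₁ s₂, 0 < U s ∧ 0 < R s) ∧ ∀ s ≥ s₂, U s = 1 / s₂ ∧ R s = 0) ∨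
  (ε = -1 ∧ (∀ s ≥ s₁, 0 < U s ∧ 0 < R s) ∧ Tendsto U atTop (𝓝 0) ∧ Tendsto R atTop (𝓝 0))

/-- From the state `(u₁, ρ₁)` at `s₁` there is a profile on `[s₁, ∞)` with exactly `n` shocks. -/
def IsSolvableFrom (P : ℝ → ℝ) (ε s₁ u₁ ρ₁ : ℝ) (n : ℕ) : Prop :=
  ∃ (U R : ℝ → ℝ) (S K : Finset ℝ), U s₁ = u₁ ∧ R s₁ = ρ₁ ∧
    ContinuousWithinAt U (Ici s₁) s₁ ∧ ContinuousWithinAt R (Ici s₁) s₁ ∧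
    IsProfileOn P ε U R (Ioi s₁) S K ∧ S.card = n ∧ EndsWell ε U R s₁

lemma RegularAt.congr {P U R U' R' : ℝ → ℝ} {s : ℝ} (h : RegularAt P U R s)
    (hU : U' =ᶠ[𝓝 s] U) (hR : R' =ᶠ[𝓝 s] R) : RegularAt P U' R' s := by
  rcases h with ⟨h1, h2⟩ | h
  · refine Or.inl ⟨⟨?_, ?_, ?_, ?_⟩, ?_⟩
    · rw [hR.eq_of_nhds]; exact h1.pos
    · rw [hR.eq_of_nhds, hU.eq_of_nhds]; exact h1.ne
    · rw [hR.eq_of_nhds, hU.eq_of_nhds]; exact h1.deriv_u.congr_of_eventuallyEq hU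
    · rw [hR.eq_of_nhds, hU.eq_of_nhds]; exact h1.deriv_ρ.congr_of_eventuallyEq hR
    · rw [hR.eq_of_nhds, hU.eq_of_nhds]
      exact h2.congr_of_eventuallyEq (hR.mono fun r hr => by simp only [hr])
  · right
    filter_upwards [h, hU, hR] with r h1 h2 h3
    rw [h2, h3, hU.eq_of_nhds]; exact h1

lemma JumpsAt.congr {P U R U' R' : ℝ → ℝ} {ε s : ℝ} (h : JumpsAt P ε U R s)
    (hU : U' =ᶠ[𝓝 s] U) (hR : R' =ᶠ[𝓝 s] R) : JumpsAt P ε U' R' s := by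
  obtain ⟨u₁, ρ₁, h1, h2⟩ := h
  refine ⟨u₁, ρ₁, ⟨?_, ?_, ?_, ?_, ?_⟩, ?_⟩
  · exact h1.front_u.congr' (hU.filter_mono nhdsWithin_le_nhds).symm
  · exact h1.front_ρ.congr' (hR.filter_mono nhdsWithin_le_nhds).symm
  · rw [hU.eq_of_nhds]; exact h1.back_u.congr' (hU.filter_mono nhdsWithin_le_nhds).symm
  · rw [hR.eq_of_nhds]; exact h1.back_ρ.congr' (hR.filter_mono nhdsWithin_le_nhds).symm
  · rw [hU.eq_of_nhds, hR.eq_of_nhds]; exact h1.shock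
  · rw [hR.eq_of_nhds]; exact h2

/-- A smooth piece of a profile on `[s₀, s')`, starting from the state `(u₀, ρ₀)`. -/
structure IsSmoothPiece (P : ℝ → ℝ) (ε s₀ u₀ ρ₀ : ℝ) (I : Set ℝ) (U R : ℝ → ℝ) (K : Finset ℝ) :
    Prop where
  init_u : U s₀ = u₀
  init_ρ : R s₀ = ρ₀
  cont_u : ContinuousWithinAt U (Ici s₀) s₀
  cont_ρ : ContinuousWithinAt R (Ici s₀) s₀
  profile : IsProfileOn P ε U R (I \ {s₀}) ∅ K
  pos : ∀ s ∈ I, 0 < R s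
  pos_u : ε = -1 → ∀ s ∈ I, 0 < U s

/-- A smooth piece on `[s₀, s')` can be followed by any profile on `[s', ∞)` that continues it
continuously or through an admissible shock. -/
lemma IsSmoothPiece.followedBy {P U₁ R₁ : ℝ → ℝ} {ε s₀ u₀ ρ₀ s' ul ρl ur ρr : ℝ}
    {K₁ : Finset ℝ} {n : ℕ} (hss : s₀ < s')
    (h₁ : IsSmoothPiece P ε s₀ u₀ ρ₀ (Ico s₀ s') U₁ R₁ K₁)
    (hU : Tendsto U₁ (𝓝[<] s') (𝓝 ul)) (hR : Tendsto R₁ (𝓝[<] s') (𝓝 ρl))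
    (h₂ : IsSolvableFrom P ε s' ur ρr n) :
    (ul = ur → ρl = ρr → IsSolvableFrom P ε s₀ u₀ ρ₀ n) ∧
    (IsAdmissibleForwardShock P (1 / s') ul ρl ur ρr → 0 < ε * (ρr - ρl) →
      IsSolvableFrom P ε s₀ u₀ ρ₀ (n + 1)) := by
  obtain ⟨U₂, R₂, S, K₂, hu2, hρ2, hcu2, hcρ2, hp2, hcard, hend⟩ := h₂
  set U : ℝ → ℝ := fun s => if s < s' then U₁ s else U₂ s with hUdef
  set R : ℝ → ℝ := fun s => if s < s' then R₁ s else R₂ s with hRdef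
  have hUlt : ∀ s < s', U s = U₁ s := fun s hs => by simp [hUdef, hs]
  have hRlt : ∀ s < s', R s = R₁ s := fun s hs => by simp [hRdef, hs]
  have hUge : ∀ s, s' ≤ s → U s = U₂ s := fun s hs => by simp [hUdef, not_lt.2 hs]
  have hRge : ∀ s, s' ≤ s → R s = R₂ s := fun s hs => by simp [hRdef, not_lt.2 hs]
  have hUlt' : ∀ s < s', U =ᶠ[𝓝 s] U₁ := fun s hs => by
    filter_upwards [Iio_mem_nhds hs] with r hr using hUlt r hr
  have hRlt' : ∀ s < s', R =ᶠ[𝓝 s] R₁ := fun s hs => by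
    filter_upwards [Iio_mem_nhds hs] with r hr using hRlt r hr
  have hUgt' : ∀ s, s' < s → U =ᶠ[𝓝 s] U₂ := fun s hs => by
    filter_upwards [Ioi_mem_nhds hs] with r hr using hUge r (le_of_lt hr)
  have hRgt' : ∀ s, s' < s → R =ᶠ[𝓝 s] R₂ := fun s hs => by
    filter_upwards [Ioi_mem_nhds hs] with r hr using hRge r (le_of_lt hr)
  have hUl : Tendsto U (𝓝[<] s') (𝓝 ul) :=
    hU.congr' (eventually_mem_nhdsWithin.mono fun r hr => (hUlt r hr).symm)
  have hRl : Tendsto R (𝓝[<] s') (𝓝 ρl) :=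
    hR.congr' (eventually_mem_nhdsWithin.mono fun r hr => (hRlt r hr).symm)
  have hUr : Tendsto U (𝓝[>] s') (𝓝 ur) := by
    have : Tendsto U₂ (𝓝[>] s') (𝓝 ur) := hu2 ▸ (hcu2.mono Ioi_subset_Ici_self)
    exact this.congr' (eventually_mem_nhdsWithin.mono fun r hr => (hUge r (le_of_lt hr)).symm)
  have hRr : Tendsto R (𝓝[>] s') (𝓝 ρr) := by
    have : Tendsto R₂ (𝓝[>] s') (𝓝 ρr) := hρ2 ▸ (hcρ2.mono Ioi_subset_Ici_self)
    exact this.congr' (eventually_mem_nhdsWithin.mono fun r hr => (hRge r (le_of_lt hr)).symm)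
  have hUs : U s' = ur := by rw [hUge s' le_rfl, hu2]
  have hRs : R s' = ρr := by rw [hRge s' le_rfl, hρ2]
  have hU0 : U s₀ = u₀ := by rw [hUlt s₀ hss, h₁.init_u]
  have hR0 : R s₀ = ρ₀ := by rw [hRlt s₀ hss, h₁.init_ρ]
  have hcu : ContinuousWithinAt U (Ici s₀) s₀ := h₁.cont_u.congr_of_eventuallyEq
    ((hUlt' s₀ hss).filter_mono nhdsWithin_le_nhds) (hUlt s₀ hss)
  have hcρ : ContinuousWithinAt R (Ici s₀) s₀ := h₁.cont_ρ.congr_of_eventuallyEq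
    ((hRlt' s₀ hss).filter_mono nhdsWithin_le_nhds) (hRlt s₀ hss)
  have hends : EndsWell ε U R s₀ := by
    rcases hend with ⟨h1, s₂, hs2, ρ₂, hρ2, h2⟩ | ⟨he, s₂, hs2, h1, h2⟩ | ⟨he, h1, h2, h3⟩
    · refine Or.inl ⟨fun s hs => ?_, s₂, hss.trans hs2, ρ₂, hρ2, fun s hs => ?_⟩
      · rcases lt_or_ge s s' with h | h
        · rw [hRlt s h]; exact h₁.pos s ⟨hs, h⟩
        · rw [hRge s h]; exact h1 s h
      · rw [hRge s (hs2.le.trans hs.le), hUge s (hs2.le.trans hs.le)]; exact h2 s hs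
    · refine Or.inr (Or.inl ⟨he, s₂, hss.le.trans hs2, fun s hs => ?_, fun s hs => ?_⟩)
      · rcases lt_or_ge s s' with h | h
        · rw [hRlt s h, hUlt s h]; exact ⟨h₁.pos_u he s ⟨hs.1, h⟩, h₁.pos s ⟨hs.1, h⟩⟩
        · rw [hRge s h, hUge s h]; exact h1 s ⟨h, hs.2⟩
      · rw [hRge s (hs2.trans hs), hUge s (hs2.trans hs)]; exact h2 s hs
    · refine Or.inr (Or.inr ⟨he, fun s hs => ?_, ?_, ?_⟩)
      · rcases lt_or_ge s s' with h | h
        · rw [hRlt s h, hUlt s h]; exact ⟨h₁.pos_u he s ⟨hs, h⟩, h₁.pos s ⟨hs, h⟩⟩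
        · rw [hRge s h, hUge s h]; exact h1 s h
      · exact h2.congr' ((eventually_ge_atTop s').mono fun s hs => (hUge s hs).symm)
      · exact h3.congr' ((eventually_ge_atTop s').mono fun s hs => (hRge s hs).symm)
  have hnonneg' : 0 ≤ ρr := by
    rw [← hRs, hRge s' le_rfl]
    rcases hend with ⟨h1, -⟩ | ⟨he, s₂, hs2, h1, h2⟩ | ⟨he, h1, h2, h3⟩
    · exact (h1 s' le_rfl).le
    · rcases hs2.eq_or_lt with h | h
      · exact (h2 s' h.ge).2.ge
      · exact (h1 s' ⟨le_rfl, h⟩).2.le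
    · exact (h1 s' le_rfl).2.le
  have hnonneg : ∀ s ∈ Ioi s₀, 0 ≤ R s := fun s hs => by
    rcases lt_trichotomy s s' with h | h | h
    · rw [hRlt s h]; exact (h₁.pos s ⟨le_of_lt hs, h⟩).le
    · rw [h, hRs]; exact hnonneg'
    · rw [hRge s h.le]; exact hp2.nonneg s h
  have hbdd : ∃ C, ∀ s ∈ Ioi s₀, |U s| ≤ C ∧ R s ≤ C := by
    obtain ⟨C₁, hC₁⟩ := h₁.profile.bounded
    obtain ⟨C₂, hC₂⟩ := hp2.bounded
    refine ⟨max (max C₁ C₂) (max |ur| ρr), fun s hs => ?_⟩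
    rcases lt_trichotomy s s' with h | h | h
    · rw [hRlt s h, hUlt s h]
      have := hC₁ s ⟨⟨le_of_lt hs, h⟩, ne_of_gt hs⟩
      exact ⟨this.1.trans ((le_max_left _ _).trans (le_max_left _ _)),
        this.2.trans ((le_max_left _ _).trans (le_max_left _ _))⟩
    · rw [h, hRs, hUs]
      exact ⟨(le_max_left _ _).trans (le_max_right _ _), (le_max_right _ _).trans (le_max_right _ _)⟩
    · rw [hRge s h.le, hUge s h.le]
      have := hC₂ s h
      exact ⟨this.1.trans ((le_max_right _ _).trans (le_max_left _ _)),
        this.2.trans ((le_max_right _ _).trans (le_max_left _ _))⟩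
  have hsm1 : ∀ s, s₀ < s → s < s' → s ∉ K₁ → RegularAt P U R s := fun s h0 h1 hK =>
    (h₁.profile.smooth s ⟨⟨h0.le, h1⟩, ne_of_gt h0⟩ (by simp) hK).congr (hUlt' s h1) (hRlt' s h1)
  have hsm2 : ∀ s, s' < s → s ∉ S → s ∉ K₂ → RegularAt P U R s := fun s h1 hS hK =>
    (hp2.smooth s h1 hS hK).congr (hUgt' s h1) (hRgt' s h1)
  have hk1 : ∀ s ∈ K₁, s ∈ Ioi s₀ ∧ ContinuousAt U s ∧ ContinuousAt R s := fun s hs => by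
    obtain ⟨⟨⟨h1, h2⟩, h3⟩, h4, h5⟩ := h₁.profile.kink s hs
    exact ⟨lt_of_le_of_ne h1 (Ne.symm h3), h4.congr (hUlt' s h2).symm, h5.congr (hRlt' s h2).symm⟩
  have hk2 : ∀ s ∈ K₂, s ∈ Ioi s₀ ∧ ContinuousAt U s ∧ ContinuousAt R s := fun s hs => by
    obtain ⟨h1, h4, h5⟩ := hp2.kink s hs
    exact ⟨hss.trans h1, h4.congr (hUgt' s h1).symm, h5.congr (hRgt' s h1).symm⟩
  have hj2 : ∀ s ∈ S, s ∈ Ioi s₀ ∧ JumpsAt P ε U R s := fun s hs => by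
    obtain ⟨h1, h4⟩ := hp2.shock s hs
    exact ⟨hss.trans h1, h4.congr (hUgt' s h1) (hRgt' s h1)⟩
  classical
  constructor
  · rintro rfl rfl
    refine ⟨U, R, S, insert s' (K₁ ∪ K₂), hU0, hR0, hcu, hcρ, ⟨?_, ?_, hj2, hnonneg, hbdd⟩, hcard,
      hends⟩
    · intro s hs hS hK
      simp only [Finset.mem_insert, Finset.mem_union, not_or] at hK
      rcases lt_or_gt_of_ne hK.1 with h | h
      · exact hsm1 s hs h hK.2.1
      · exact hsm2 s h hS hK.2.2
    · intro s hs
      simp only [Finset.mem_insert, Finset.mem_union] at hs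
      rcases hs with rfl | hs | hs
      · refine ⟨hss, continuousAt_iff_continuous_left'_right'.2 ⟨?_, ?_⟩,
          continuousAt_iff_continuous_left'_right'.2 ⟨?_, ?_⟩⟩
        · rw [ContinuousWithinAt, hUs]; exact hUl
        · rw [ContinuousWithinAt, hUs]; exact hUr
        · rw [ContinuousWithinAt, hRs]; exact hRl
        · rw [ContinuousWithinAt, hRs]; exact hRr
      · exact hk1 s hs
      · exact hk2 s hs
  · intro hshock hsign
    have hnot : s' ∉ S := fun hs => lt_irrefl s' (hp2.shock s' hs).1
    refine ⟨U, R, insert s' S, K₁ ∪ K₂, hU0, hR0, hcu, hcρ, ⟨?_, ?_, ?_, hnonneg, hbdd⟩,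
      by rw [Finset.card_insert_of_notMem hnot, hcard], hends⟩
    · intro s hs hS hK
      simp only [Finset.mem_insert, not_or] at hS
      simp only [Finset.mem_union, not_or] at hK
      rcases lt_or_gt_of_ne hS.1 with h | h
      · exact hsm1 s hs h hK.1
      · exact hsm2 s h hS.2 hK.2
    · intro s hs
      simp only [Finset.mem_union] at hs
      rcases hs with hs | hs
      · exact hk1 s hs
      · exact hk2 s hs
    · intro s hs
      simp only [Finset.mem_insert] at hs
      rcases hs with rfl | hs
      · refine ⟨hss, ul, ρl, ⟨hUl, hRl, by rw [hUs]; exact hUr, by rw [hRs]; exact hRr, ?_⟩, ?_⟩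
        · rw [hUs, hRs]; exact hshock
        · rw [hRs]; exact hsign
      · exact hj2 s hs

/-- Gas at rest stays at rest. -/
lemma isSolvableFrom_rest (P : ℝ → ℝ) (ε : ℝ) {s₁ ρ₁ : ℝ} (hs : 0 ≤ s₁) (hρ : 0 < ρ₁) :
    IsSolvableFrom P ε s₁ 0 ρ₁ 0 := by
  classical
  -- the only kink is the sonic ray, where the denominator of the equations vanishes
  set k : ℝ := √((deriv P ρ₁)⁻¹) with hk
  refine ⟨fun _ => 0, fun _ => ρ₁, ∅, if s₁ < k then {k} else ∅, rfl, rfl,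
    continuousWithinAt_const, continuousWithinAt_const, ⟨?_, ?_, by simp, fun _ _ => hρ.le,
      ⟨ρ₁, fun _ _ => by simp [hρ.le]⟩⟩, rfl,
    Or.inl ⟨fun _ _ => hρ, s₁ + 1, by linarith, ρ₁, hρ, fun _ _ => ⟨rfl, rfl⟩⟩⟩
  · intro s hs1 _ hK
    simp only [mem_Ioi] at hs1
    have hne : s ^ 2 * deriv P ρ₁ - (1 - (0 : ℝ) * s) ^ 2 ≠ 0 := by
      intro h0
      have h1 : s ^ 2 * deriv P ρ₁ = 1 := by linarith
      have h2 : s = k := by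
        have : (deriv P ρ₁)⁻¹ = s ^ 2 := (eq_inv_of_mul_eq_one_left h1).symm
        rw [hk, this, Real.sqrt_sq (hs.trans hs1.le)]
      rw [← h2, if_pos hs1] at hK
      simp at hK
    refine Or.inl ⟨⟨hρ, hne, ?_, ?_⟩, ?_⟩
    · simpa using hasDerivAt_const s (0 : ℝ)
    · simpa using hasDerivAt_const s ρ₁
    · simpa using hasDerivAt_const s (P ρ₁)
  · intro s hs1
    split_ifs at hs1 with h
    · simp only [Finset.mem_singleton] at hs1
      subst hs1
      exact ⟨h, continuousAt_const, continuousAt_const⟩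
    · simp at hs1

/-- Vacuum, with the convention that its velocity is that of its boundary. -/
lemma isSolvableFrom_vacuum (P : ℝ → ℝ) (s₁ : ℝ) :
    IsSolvableFrom P (-1) s₁ (1 / s₁) 0 0 := by
  refine ⟨fun _ => 1 / s₁, fun _ => 0, ∅, ∅, rfl, rfl,
    continuousWithinAt_const, continuousWithinAt_const,
    ⟨fun _ _ _ _ => Or.inr (Eventually.of_forall fun _ => ⟨rfl, rfl⟩), by simp, by simp,
      fun _ _ => le_rfl, ⟨|1 / s₁|, fun _ _ => ⟨le_rfl, abs_nonneg _⟩⟩⟩, rfl,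
    Or.inr (Or.inl ⟨rfl, s₁, le_rfl, fun s hs => ?_, fun _ _ => ⟨rfl, rfl⟩⟩)⟩
  exact absurd hs.2 (not_lt.2 hs.1)

/-! ### From curves to profiles -/

section curve

variable {P : ℝ → ℝ} {α β ε ρ₁ T : ℝ} {s v : ℝ → ℝ}

/-- Along a curve the flow is supersonic relative to the rays `x = t / s`. -/
def IsSupersonic (P : ℝ → ℝ) (bad : Set ℝ) (ε ρ₁ T : ℝ) (s v : ℝ → ℝ) : Prop :=
  ∀ t ∈ Ioo 0 T, ρ₁ + ε * t ∉ bad → 0 < sonicGap (deriv P (ρ₁ + ε * t)) ε (s t) (v t)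

lemma IsCurve.strictMonoOn (hc : IsCurve P {α, β} ε ρ₁ T s v) (hε : ε = 1 ∨ ε = -1)
    (hgap : IsSupersonic P {α, β} ε ρ₁ T s v) : StrictMonoOn s (Ico 0 T) := by
  refine strictMonoOn_of_hasDerivAt_pos_off_finite (finite_preimage_bad α β hε ρ₁) hc.cont_s
    fun t ht hb => ⟨hc.deriv_s t ht hb, ?_⟩
  have ht' : t ∈ Ico 0 T := ⟨ht.1.le, ht.2⟩
  have h1 := hgap t ht hb
  have h2 := hc.v_pos t ht'
  have h3 := hc.ρ_pos t ht'
  have h4 := hc.q_pos t ht'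
  positivity

lemma IsCurve.antitoneOn (hc : IsCurve P {α, β} ε ρ₁ T s v) (h : PressureShape P α β)
    (hε : ε = 1 ∨ ε = -1) (hs : ∀ t ∈ Ico 0 T, 0 ≤ s t) : AntitoneOn v (Ico 0 T) := by
  refine antitoneOn_of_hasDerivAt_nonpos_off_finite (finite_preimage_bad α β hε ρ₁) hc.cont_v
    fun t ht hb => ⟨hc.deriv_v t ht hb, ?_⟩
  have ht' : t ∈ Ico 0 T := ⟨ht.1.le, ht.2⟩
  have h3 := hc.ρ_pos t ht'
  have h1 := h.deriv_nonneg h3 hb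
  have h2 := hs t ht'
  have h4 := hc.q_pos t ht'
  have : 0 ≤ deriv P (ρ₁ + ε * t) * s t / ((ρ₁ + ε * t) * relSpeed ε (s t) (v t)) := by positivity
  linarith

lemma IsCurve.nonneg_s (hc : IsCurve P {α, β} ε ρ₁ T s v) (hε : ε = 1 ∨ ε = -1)
    (hgap : IsSupersonic P {α, β} ε ρ₁ T s v) (h0 : 0 ≤ s 0) : ∀ t ∈ Ico 0 T, 0 ≤ s t :=
  fun _ ht => h0.trans ((hc.strictMonoOn hε hgap).monotoneOn ⟨le_rfl, hc.T_pos⟩ ht ht.1)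

/-- A supersonic curve, read as a function of `s`, is a smooth piece of a profile. -/
lemma IsCurve.exists_smoothPiece (hc : IsCurve P {α, β} ε ρ₁ T s v) (h : PressureShape P α β)
    (hε : ε = 1 ∨ ε = -1) (hgap : IsSupersonic P {α, β} ε ρ₁ T s v) (h0 : 0 ≤ s 0) {I : Set ℝ}
    (hI : s '' Ico 0 T = I) (hI' : ∀ σ ∈ I, σ ≠ s 0 → I ∈ 𝓝 σ) (hI0 : I ∈ 𝓝[≥] (s 0)) :
    ∃ (U R : ℝ → ℝ) (K : Finset ℝ), IsSmoothPiece P ε (s 0) (-ε * v 0) ρ₁ I U R K ∧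
      ∀ l : Filter ℝ, (∀ᶠ σ in l, σ ∈ I) → (∀ t ∈ Ico 0 T, ∀ᶠ σ in l, s t < σ) →
        ∀ v', Tendsto v (𝓝[<] T) (𝓝 v') →
          Tendsto U l (𝓝 (-ε * v')) ∧ Tendsto R l (𝓝 (ρ₁ + ε * T)) := by
  have hmono := hc.strictMonoOn hε hgap
  have hs := hc.nonneg_s hε hgap h0
  have hanti := hc.antitoneOn h hε hs
  obtain ⟨g, hg, hgf, hgm, hgc⟩ := exists_inverse hmono hI
  have h0I : s 0 ∈ I := hI ▸ mem_image_of_mem s ⟨le_rfl, hc.T_pos⟩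
  have hg0 : g (s 0) = 0 := hgf 0 ⟨le_rfl, hc.T_pos⟩
  have hgv : ContinuousOn (fun σ => v (g σ)) I := hc.cont_v.comp hgc fun σ hσ => (hg σ hσ).1
  have hfin := finite_preimage_bad α β hε ρ₁
  have hKfin : (s '' ((fun t : ℝ => ρ₁ + ε * t) ⁻¹' ({α, β} : Set ℝ) ∩ Ioo 0 T)).Finite :=
    (hfin.inter_of_left _).image s
  have hgpos : ∀ σ ∈ I, σ ≠ s 0 → 0 < g σ := fun σ hσ hne => by
    refine lt_of_le_of_ne (hg σ hσ).1.1 fun h => hne ?_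
    rw [← (hg σ hσ).2, ← h]
  have hεabs : |ε| = 1 := by rcases hε with rfl | rfl <;> simp
  refine ⟨fun σ => -ε * v (g σ), fun σ => ρ₁ + ε * g σ, hKfin.toFinset,
    ⟨by simp [hg0], by simp [hg0], ?_, ?_, ⟨?_, ?_, by simp, ?_, ?_⟩, ?_, ?_⟩, ?_⟩
  · exact ((continuousOn_const.mul hgv) (s 0) h0I).mono_of_mem_nhdsWithin hI0
  · exact ((continuousOn_const.add (continuousOn_const.mul hgc)) (s 0) h0I).mono_of_mem_nhdsWithin
      hI0
  · rintro σ ⟨hσ, hne⟩ - hK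
    have hne' : σ ≠ s 0 := hne
    have ht : g σ ∈ Ioo 0 T := ⟨hgpos σ hσ hne', (hg σ hσ).1.2⟩
    have hb : ρ₁ + ε * g σ ∉ ({α, β} : Set ℝ) := fun hb => by
      rw [Set.Finite.mem_toFinset] at hK
      exact hK ⟨g σ, ⟨hb, ht⟩, (hg σ hσ).2⟩
    have hsσ : s (g σ) = σ := (hg σ hσ).2
    have hρ := hc.ρ_pos _ (hg σ hσ).1
    have hv := hc.v_pos _ (hg σ hσ).1
    have hq := hc.q_pos _ (hg σ hσ).1
    have hB := hgap _ ht hb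
    have hds := hc.deriv_s _ ht hb
    have hdv := hc.deriv_v _ ht hb
    rw [hsσ] at hq hB hds hdv
    have hdg := HasDerivAt.of_local_left_inverse (hgc.continuousAt (hI' σ hσ hne')) hds
      (by positivity) (by filter_upwards [hI' σ hσ hne'] with x hx using (hg x hx).2)
    set c := deriv P (ρ₁ + ε * g σ) with hcdef
    set ρ := ρ₁ + ε * g σ with hρdef
    have hDB : σ ^ 2 * c - (1 - -ε * v (g σ) * σ) ^ 2 = -sonicGap c ε σ (v (g σ)) := by
      unfold sonicGap relSpeed; ring
    have hqq : 1 - -ε * v (g σ) * σ = relSpeed ε σ (v (g σ)) := by unfold relSpeed; ring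
    have hdρ : HasDerivAt (fun σ => ρ₁ + ε * g σ)
        (2 * ρ * (-ε * v (g σ)) * (1 - -ε * v (g σ) * σ) /
          (σ ^ 2 * c - (1 - -ε * v (g σ) * σ) ^ 2)) σ := by
      refine ((hdg.const_mul ε).const_add ρ₁).congr_deriv ?_
      rw [hDB, hqq]; field_simp
    refine Or.inl ⟨⟨hρ, ?_, ?_, hdρ⟩, ?_⟩
    · change σ ^ 2 * c - _ ≠ 0
      rw [hDB]; exact neg_ne_zero.2 hB.ne'
    · refine ((HasDerivAt.comp σ hdv hdg).const_mul (-ε)).congr_deriv ?_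
      change _ = 2 * c * (-ε * v (g σ)) * σ / (σ ^ 2 * c - _)
      rw [hDB]; field_simp
    · exact HasDerivAt.comp σ (h.hasDerivAt hρ hb) hdρ
  · intro σ hσ
    rw [Set.Finite.mem_toFinset] at hσ
    obtain ⟨t, ⟨-, ht⟩, rfl⟩ := hσ
    have hmem : s t ∈ I := hI ▸ mem_image_of_mem s ⟨ht.1.le, ht.2⟩
    have hne : s t ≠ s 0 := ne_of_gt (hmono ⟨le_rfl, hc.T_pos⟩ ⟨ht.1.le, ht.2⟩ ht.1)
    exact ⟨⟨hmem, hne⟩, (continuousOn_const.mul hgv).continuousAt (hI' _ hmem hne),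
      (continuousOn_const.add (continuousOn_const.mul hgc)).continuousAt (hI' _ hmem hne)⟩
  · exact fun σ hσ => (hc.ρ_pos _ (hg σ hσ.1).1).le
  · refine ⟨max (v 0) (ρ₁ + T), fun σ hσ => ⟨?_, ?_⟩⟩
    · have h1 := hc.v_pos _ (hg σ hσ.1).1
      rw [abs_mul, abs_neg, hεabs, one_mul, abs_of_pos h1]
      exact (hanti ⟨le_rfl, hc.T_pos⟩ (hg σ hσ.1).1 (hg σ hσ.1).1.1).trans (le_max_left _ _)
    · have h1 := (hg σ hσ.1).1
      refine le_trans ?_ (le_max_right _ _)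
      rcases hε with rfl | rfl
      · linarith [h1.2]
      · linarith [h1.1, hc.T_pos]
  · exact fun σ hσ => hc.ρ_pos _ (hg σ hσ).1
  · rintro rfl σ hσ
    simpa using hc.v_pos _ (hg σ hσ).1
  · intro l hl hl2 v' hv'
    have hgT := tendsto_inverse hc.T_pos hmono hg hl hl2
    exact ⟨(hv'.comp hgT).const_mul (-ε),
      ((tendsto_nhds_of_tendsto_nhdsWithin hgT).const_mul ε).const_add ρ₁⟩

/-- A supersonic curve with a finite limit of `s` can be followed by a profile. -/
lemma IsCurve.followedBy (hc : IsCurve P {α, β} ε ρ₁ T s v) (h : PressureShape P α β)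
    (hε : ε = 1 ∨ ε = -1) (hgap : IsSupersonic P {α, β} ε ρ₁ T s v) (h0 : 0 ≤ s 0) {s' v' : ℝ}
    (hs : Tendsto s (𝓝[<] T) (𝓝 s')) (hv : Tendsto v (𝓝[<] T) (𝓝 v')) {ur ρr : ℝ} {n : ℕ}
    (h₂ : IsSolvableFrom P ε s' ur ρr n) :
    (-ε * v' = ur → ρ₁ + ε * T = ρr → IsSolvableFrom P ε (s 0) (-ε * v 0) ρ₁ n) ∧
    (IsAdmissibleForwardShock P (1 / s') (-ε * v') (ρ₁ + ε * T) ur ρr →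
      0 < ε * (ρr - (ρ₁ + ε * T)) → IsSolvableFrom P ε (s 0) (-ε * v 0) ρ₁ (n + 1)) := by
  have hmono := hc.strictMonoOn hε hgap
  have himg := image_Ico_of_tendsto hc.T_pos hmono hc.cont_s hs
  have hlt : ∀ t ∈ Ico 0 T, s t < s' := fun t ht => by
    have : s t ∈ Ico (s 0) s' := himg ▸ mem_image_of_mem s ht
    exact this.2
  have hss : s 0 < s' := hlt 0 ⟨le_rfl, hc.T_pos⟩
  obtain ⟨U, R, K, hp, hl⟩ := hc.exists_smoothPiece h hε hgap h0 himg
    (fun σ hσ hne => Ico_mem_nhds (lt_of_le_of_ne hσ.1 (Ne.symm hne)) hσ.2)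
    (Ico_mem_nhdsGE hss)
  obtain ⟨hU, hR⟩ := hl (𝓝[<] s') (Ico_mem_nhdsLT hss)
    (fun t ht => by filter_upwards [Ioo_mem_nhdsLT (hlt t ht)] with σ hσ using hσ.1) v' hv
  exact hp.followedBy hss hU hR h₂

end curve

/-! ### Rayleigh lines and shocks -/

/-- The vertical distance, times `s²`, between the graph of the pressure as a function of the
specific volume and the Rayleigh line: the line through the state of density `ρ` whose slope is
minus the square of the mass flux `q ρ / s` across the ray `x = t / s`. It vanishes at the volumes
that a shock of speed `1 / s` can connect with the state. The gas of volume `(q ρ)⁻¹` on the line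
is at rest. -/
noncomputable def rayleigh (P : ℝ → ℝ) (s q ρ θ : ℝ) : ℝ :=
  s ^ 2 * (pressureOfVolume P θ - P ρ) + (q * ρ) ^ 2 * (θ - ρ⁻¹)

/-- If the graph of the pressure lies on the right side of the Rayleigh line between its
intersections with it, the corresponding shock satisfies Liu's condition. -/
lemma isAdmissibleForwardShock_of_rayleigh {P : ℝ → ℝ} {s q ρ₁ u₁ θ : ℝ} (hs : 0 < s)
    (hρ : 0 < ρ₁) (hq : q = 1 - u₁ * s) (hq0 : 0 < q) (hθ : 0 < θ) (hne : θ ≠ ρ₁⁻¹)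
    (h0 : rayleigh P s q ρ₁ θ = 0)
    (hL : ∀ ϑ, min θ ρ₁⁻¹ < ϑ → ϑ < max θ ρ₁⁻¹ → 0 ≤ rayleigh P s q ρ₁ ϑ * (ϑ - ρ₁⁻¹)) :
    IsAdmissibleForwardShock P (1 / s) u₁ ρ₁ ((1 - q * ρ₁ * θ) / s) θ⁻¹ := by
  have hu : u₁ = (1 - q) / s := by rw [hq]; field_simp; ring
  refine ⟨hρ, inv_pos.2 hθ, fun h => hne (by rw [h, inv_inv]), ⟨?_, ?_⟩, ?_, ?_, ?_⟩
  · rw [hu]; field_simp; ring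
  · unfold rayleigh pressureOfVolume at h0
    have h1 : P θ⁻¹ = P ρ₁ - (q * ρ₁) ^ 2 * (θ - ρ₁⁻¹) / s ^ 2 := by
      field_simp at h0 ⊢; linarith
    rw [h1, hu]; field_simp; ring
  · rw [hu]; gcongr; linarith
  · gcongr
    have : 0 < q * ρ₁ * θ := by positivity
    linarith
  · intro u ρ σ' hmin hmax ⟨hr1, hr2⟩
    have hρpos : 0 < ρ := (lt_min hρ (inv_pos.2 hθ)).trans hmin
    have hb1 : min θ ρ₁⁻¹ < ρ⁻¹ := by
      rcases le_total ρ₁ θ⁻¹ with h | h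
      · rw [max_eq_right h] at hmax
        exact (min_le_left _ _).trans_lt ((lt_inv_comm₀ hρpos hθ).1 hmax)
      · rw [max_eq_left h] at hmax
        exact (min_le_right _ _).trans_lt ((inv_lt_inv₀ hρ hρpos).2 hmax)
    have hb2 : ρ⁻¹ < max θ ρ₁⁻¹ := by
      rcases le_total ρ₁ θ⁻¹ with h | h
      · rw [min_eq_left h] at hmin
        exact ((inv_lt_inv₀ hρpos hρ).2 hmin).trans_le (le_max_right _ _)
      · rw [min_eq_right h] at hmin
        exact ((inv_lt_comm₀ hθ hρpos).1 hmin).trans_le (le_max_left _ _)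
    have hL' := hL ρ⁻¹ hb1 hb2
    unfold rayleigh pressureOfVolume at hL'
    rw [inv_inv] at hL'
    set m := ρ₁ * (σ' - u₁) with hm
    have hu1 : u₁ = σ' - m / ρ₁ := by rw [hm]; field_simp; ring
    have hu2 : u = σ' - m / ρ := by
      field_simp
      rw [hm]; linarith
    have hP : P ρ - P ρ₁ = - (m ^ 2 * (ρ⁻¹ - ρ₁⁻¹)) := by
      have : P ρ - P ρ₁ = ρ₁ * u₁ ^ 2 - ρ * u ^ 2 - σ' * (ρ₁ * u₁ - ρ * u) := by linarith
      rw [this, hu1, hu2]; field_simp; ring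
    rw [hP] at hL'
    have hne' : ρ⁻¹ - ρ₁⁻¹ ≠ 0 := by
      intro h
      have h1 : ρ = ρ₁ := inv_injective (sub_eq_zero.1 h)
      rcases le_total ρ₁ θ⁻¹ with h2 | h2
      · rw [min_eq_left h2, h1] at hmin; exact lt_irrefl _ hmin
      · rw [max_eq_left h2, h1] at hmax; exact lt_irrefl _ hmax
    have hsq : 0 < (ρ⁻¹ - ρ₁⁻¹) ^ 2 := by positivity
    have h3 : 0 ≤ (ρ⁻¹ - ρ₁⁻¹) ^ 2 * ((q * ρ₁) ^ 2 - (s * m) ^ 2) := by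
      convert hL' using 1; ring
    have h4 : (s * m) ^ 2 ≤ (q * ρ₁) ^ 2 := by
      have := nonneg_of_mul_nonneg_right h3 hsq
      linarith
    have h5 : s * m ≤ q * ρ₁ := le_of_sq_le_sq h4 (by positivity)
    have h6 : ρ₁ * (s * σ') ≤ ρ₁ * 1 := by
      have : s * m = ρ₁ * (s * σ') - ρ₁ * (u₁ * s) := by rw [hm]; ring
      rw [this, hq] at h5; linarith
    rw [le_div_iff₀ hs]
    have := le_of_mul_le_mul_left h6 hρ
    linarith

/-- The first time at which a continuous function, positive on a moving interval just
after the initial time, vanishes somewhere on it. -/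
lemma exists_first_touch {T : ℝ} {lo hi : ℝ → ℝ} {k : ℝ → ℝ → ℝ} (hlo : ContinuousOn lo (Ico 0 T))
    (hhi : ContinuousOn hi (Ico 0 T)) (hpos : ∀ t ∈ Ico 0 T, 0 < lo t)
    (hle : ∀ t ∈ Ico 0 T, lo t ≤ hi t)
    (hk : ContinuousOn (Function.uncurry k) (Ico 0 T ×ˢ Ioi 0))
    (h0 : ∀ᶠ t in 𝓝[>] 0, ∀ θ ∈ Icc (lo t) (hi t), 0 < k t θ) :
    (∀ t ∈ Ioo 0 T, ∀ θ ∈ Icc (lo t) (hi t), 0 < k t θ) ∨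
    ∃ t₁ ∈ Ioo 0 T, (∀ t ∈ Ioo 0 t₁, ∀ θ ∈ Icc (lo t) (hi t), 0 < k t θ) ∧
      (∀ θ ∈ Icc (lo t₁) (hi t₁), 0 ≤ k t₁ θ) ∧ ∃ θ ∈ Icc (lo t₁) (hi t₁), k t₁ θ = 0 := by
  by_cases hall : ∀ t ∈ Ioo 0 T, ∀ θ ∈ Icc (lo t) (hi t), 0 < k t θ
  · exact Or.inl hall
  right
  push Not at hall
  obtain ⟨t₂, ht₂, θ₂, hθ₂, hk₂⟩ := hall
  obtain ⟨d, hd, hdsub⟩ := mem_nhdsGT_iff_exists_Ioc_subset.1 h0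
  simp only [mem_Ioi] at hd
  have hd₂ : d < t₂ := by
    by_contra hcon
    exact absurd (hdsub ⟨ht₂.1, not_lt.1 hcon⟩ θ₂ hθ₂) (not_lt.2 hk₂)
  -- rescale the moving interval to `[0, 1]`
  set w : ℝ × ℝ → ℝ := fun x => lo x.1 + x.2 * (hi x.1 - lo x.1) with hw
  have hparam : ∀ t ∈ Ico 0 T, ∀ θ ∈ Icc (lo t) (hi t), ∃ l ∈ Icc (0 : ℝ) 1, w (t, l) = θ := by
    intro t ht θ hθ
    rcases (hle t ht).eq_or_lt with h | h
    · exact ⟨0, ⟨le_rfl, zero_le_one⟩, by simp only [hw]; linarith [hθ.1, hθ.2]⟩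
    · have hd : 0 < hi t - lo t := by linarith
      refine ⟨(θ - lo t) / (hi t - lo t), ⟨div_nonneg (by linarith [hθ.1]) hd.le,
        (div_le_one hd).2 (by linarith [hθ.2])⟩, ?_⟩
      simp only [hw]; field_simp; ring
  have hwmem : ∀ t ∈ Ico 0 T, ∀ l ∈ Icc (0 : ℝ) 1, w (t, l) ∈ Icc (lo t) (hi t) := by
    intro t ht l hl
    have := hle t ht
    simp only [hw]
    constructor
    · nlinarith [hl.1]
    · nlinarith [hl.2]
  have hwc : ContinuousOn w (Ico 0 T ×ˢ Icc 0 1) := by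
    have h1 : ContinuousOn (fun x : ℝ × ℝ => lo x.1) (Ico 0 T ×ˢ Icc 0 1) :=
      hlo.comp continuousOn_fst fun x hx => hx.1
    have h2 : ContinuousOn (fun x : ℝ × ℝ => hi x.1) (Ico 0 T ×ˢ Icc 0 1) :=
      hhi.comp continuousOn_fst fun x hx => hx.1
    exact h1.add (continuousOn_snd.mul (h2.sub h1))
  have hφc : ContinuousOn (fun x : ℝ × ℝ => k x.1 (w x)) (Ico 0 T ×ˢ Icc 0 1) :=
    hk.comp (continuousOn_fst.prodMk hwc) fun x hx =>
      ⟨hx.1, (hpos x.1 hx.1).trans_le (hwmem x.1 hx.1 x.2 hx.2).1⟩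
  have hsub : Icc d t₂ ×ˢ Icc (0 : ℝ) 1 ⊆ Ico 0 T ×ˢ Icc 0 1 :=
    prod_mono (fun t ht => ⟨hd.le.trans ht.1, ht.2.trans_lt ht₂.2⟩) Subset.rfl
  set A : Set (ℝ × ℝ) := (Icc d t₂ ×ˢ Icc (0 : ℝ) 1) ∩ (fun x : ℝ × ℝ => k x.1 (w x)) ⁻¹' Iic 0
    with hA
  have hAc : IsCompact A := (isCompact_Icc.prod isCompact_Icc).of_isClosed_subset
    ((hφc.mono hsub).preimage_isClosed_of_isClosed (isClosed_Icc.prod isClosed_Icc) isClosed_Iic)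
    inter_subset_left
  have hAne : A.Nonempty := by
    obtain ⟨l, hl, hl'⟩ := hparam t₂ ⟨ht₂.1.le, ht₂.2⟩ θ₂ hθ₂
    refine ⟨(t₂, l), ⟨⟨hd₂.le, le_rfl⟩, hl⟩, ?_⟩
    simp only [mem_preimage, mem_Iic, hl']; exact hk₂
  obtain ⟨t₁, ⟨⟨⟨a, l₁⟩, ⟨⟨ha, hl₁⟩, hka⟩, rfl⟩, hmin⟩⟩ :=
    (hAc.image continuous_fst).exists_isLeast (hAne.image _)
  simp only at ha hl₁ hka hmin
  have haT : a ∈ Ico 0 T := ⟨hd.le.trans ha.1, ha.2.trans_lt ht₂.2⟩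
  have hka' : k a (w (a, l₁)) ≤ 0 := hka
  have ha0 : 0 < a := hd.trans_le ha.1
  have hbefore : ∀ t ∈ Ioo 0 a, ∀ l ∈ Icc (0 : ℝ) 1, 0 < k t (w (t, l)) := by
    intro t ht l hl
    by_contra hcon
    have hdt : d < t := by
      by_contra hcon2
      exact hcon (hdsub ⟨ht.1, not_lt.1 hcon2⟩ _ (hwmem t ⟨ht.1.le, ht.2.trans haT.2⟩ l hl))
    have : a ≤ t := hmin ⟨(t, l), ⟨⟨⟨hdt.le, ht.2.le.trans ha.2⟩, hl⟩, not_lt.1 hcon⟩, rfl⟩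
    linarith [ht.2]
  have hat : ∀ l ∈ Icc (0 : ℝ) 1, 0 ≤ k a (w (a, l)) := by
    intro l hl
    have hcw : ContinuousWithinAt (fun t => k t (w (t, l))) (Ico 0 T) a :=
      ContinuousWithinAt.comp (g := fun x : ℝ × ℝ => k x.1 (w x)) (f := fun t : ℝ => (t, l))
        (hφc (a, l) ⟨haT, hl⟩)
        (continuousWithinAt_id.prodMk continuousWithinAt_const) fun t ht => ⟨ht, hl⟩
    have hcl : Tendsto (fun t => k t (w (t, l))) (𝓝[<] a) (𝓝 (k a (w (a, l)))) := by
      refine hcw.tendsto.mono_left ?_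
      rw [nhdsWithin_le_iff]
      filter_upwards [Ioo_mem_nhdsLT ha0] with t ht using ⟨ht.1.le, ht.2.trans haT.2⟩
    refine ge_of_tendsto hcl ?_
    filter_upwards [Ioo_mem_nhdsLT ha0] with t ht
    exact (hbefore t ht l hl).le
  refine ⟨a, ⟨ha0, haT.2⟩, fun t ht θ hθ => ?_, fun θ hθ => ?_, w (a, l₁), hwmem a haT l₁ hl₁,
    le_antisymm hka' (hat l₁ hl₁)⟩
  · obtain ⟨l, hl, rfl⟩ := hparam t ⟨ht.1.le, ht.2.trans haT.2⟩ θ hθ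
    exact hbefore t ht l hl
  · obtain ⟨l, hl, rfl⟩ := hparam a haT θ hθ
    exact hat l hl

section curve

variable {P : ℝ → ℝ} {α β ε ρ₁ T : ℝ} {s v : ℝ → ℝ}

lemma IsCurve.mono (hc : IsCurve P {α, β} ε ρ₁ T s v) {T' : ℝ} (h0 : 0 < T') (h : T' ≤ T) :
    IsCurve P {α, β} ε ρ₁ T' s v :=
  have hsub : Ico 0 T' ⊆ Ico 0 T := Ico_subset_Ico_right h
  have hsub' : Ioo 0 T' ⊆ Ioo 0 T := Ioo_subset_Ioo_right h
  ⟨h0, fun t ht => hc.ρ_pos t (hsub ht), fun t ht => hc.v_pos t (hsub ht),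
    fun t ht => hc.q_pos t (hsub ht), hc.cont_s.mono hsub, hc.cont_v.mono hsub,
    fun t ht => hc.deriv_s t (hsub' ht), fun t ht => hc.deriv_v t (hsub' ht)⟩

/-- The supersonic gap divided by `ρ v` has a derivative of constant sign where the pressure is
convex or concave as a function of the specific volume. -/
lemma IsCurve.hasDerivAt_gap (hc : IsCurve P {α, β} ε ρ₁ T s v) (h : PressureShape P α β)
    (hε : ε = 1 ∨ ε = -1) {t : ℝ} (ht : t ∈ Ioo 0 T) (hb : ρ₁ + ε * t ∉ ({α, β} : Set ℝ)) :
    HasDerivAt (fun t => sonicGap (deriv P (ρ₁ + ε * t)) ε (s t) (v t) / ((ρ₁ + ε * t) * v t))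
      (-ε * (2 * deriv P (ρ₁ + ε * t) + (ρ₁ + ε * t) * deriv (deriv P) (ρ₁ + ε * t)) * s t ^ 2 /
        ((ρ₁ + ε * t) ^ 2 * v t)) t := by
  have ht' : t ∈ Ico 0 T := ⟨ht.1.le, ht.2⟩
  have hρ := hc.ρ_pos t ht'
  have hv := hc.v_pos t ht'
  have hq := hc.q_pos t ht'
  have hds := hc.deriv_s t ht hb
  have hdv := hc.deriv_v t ht hb
  have hdρ : HasDerivAt (fun t => ρ₁ + ε * t) ε t := by
    simpa using ((hasDerivAt_id t).const_mul ε).const_add ρ₁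
  have hdc : HasDerivAt (fun t => deriv P (ρ₁ + ε * t)) (deriv (deriv P) (ρ₁ + ε * t) * ε) t :=
    HasDerivAt.comp (h₂ := deriv P) t (((h.contDiffAt_deriv hρ hb).differentiableAt (by norm_num)).hasDerivAt) hdρ
  have hdq : HasDerivAt (fun t => relSpeed ε (s t) (v t)) _ t :=
    (((hdv.const_mul ε).mul hds).const_add 1)
  have hdB := ((hdq.pow 2).sub ((hds.pow 2).mul hdc)).div (hdρ.mul hdv) (mul_pos hρ hv).ne'
  refine hdB.congr_deriv ?_
  have hq2 : relSpeed ε (s t) (v t) = 1 + ε * v t * s t := rfl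
  have hB2 : sonicGap (deriv P (ρ₁ + ε * t)) ε (s t) (v t) =
    relSpeed ε (s t) (v t) ^ 2 - s t ^ 2 * deriv P (ρ₁ + ε * t) := rfl
  simp only [Pi.pow_apply, Pi.mul_apply, Pi.sub_apply]
  unfold sonicGap at *
  generalize deriv (deriv P) (ρ₁ + ε * t) = d at *
  generalize deriv P (ρ₁ + ε * t) = c at *
  clear hdB hdq hdc hdρ hdv hds hB2
  generalize ρ₁ + ε * t = ρ at *
  generalize s t = σ at *
  generalize v t = w at *
  generalize hqq : relSpeed ε σ w = q at *
  field_simp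
  rcases hε with rfl | rfl <;> norm_num <;> ring

/-- On the part of a curve where the pressure has the favourable convexity, the flow stays
supersonic if it is supersonic or sonic initially. -/
lemma IsCurve.gap_pos_of_convexity (hc : IsCurve P {α, β} ε ρ₁ T s v) (h : PressureShape P α β)
    (hε : ε = 1 ∨ ε = -1) {T' c₁ : ℝ} (hT' : T' ≤ T)
    (hlim : Tendsto (fun t => deriv P (ρ₁ + ε * t)) (𝓝[>] 0) (𝓝 c₁))
    (hq : s 0 ^ 2 * c₁ ≤ relSpeed ε (s 0) (v 0) ^ 2)
    (hconv : ∀ t ∈ Ioo 0 T', ρ₁ + ε * t ∉ ({α, β} : Set ℝ) ∧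
      0 < -ε * (2 * deriv P (ρ₁ + ε * t) + (ρ₁ + ε * t) * deriv (deriv P) (ρ₁ + ε * t))) :
    ∀ t ∈ Ioo 0 T', 0 < sonicGap (deriv P (ρ₁ + ε * t)) ε (s t) (v t) := by
  intro t₁ ht₁
  have hsub : Ioo 0 T' ⊆ Ioo 0 T := Ioo_subset_Ioo_right hT'
  have hsub' : Ioo 0 T' ⊆ Ico 0 T := hsub.trans Ioo_subset_Ico_self
  set J : ℝ → ℝ := fun t => sonicGap (deriv P (ρ₁ + ε * t)) ε (s t) (v t) / ((ρ₁ + ε * t) * v t)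
    with hJ
  have hdJ := fun t (ht : t ∈ Ioo 0 T') => hc.hasDerivAt_gap h hε (hsub ht) (hconv t ht).1
  have hmono : MonotoneOn J (Ioo 0 T') := by
    refine monotoneOn_of_deriv_nonneg (convex_Ioo 0 T')
      (fun t ht => (hdJ t ht).continuousAt.continuousWithinAt)
      (fun t ht => (hdJ t (interior_subset ht)).differentiableAt.differentiableWithinAt) ?_
    intro t ht
    have ht := interior_subset ht
    rw [(hdJ t ht).deriv]
    have h1 := (hconv t ht).2
    have h2 := hc.v_pos t (hsub' ht)
    positivity
  have h0mem : (0 : ℝ) ∈ Ico 0 T := ⟨le_rfl, hc.T_pos⟩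
  have hle0 : 𝓝[>] (0 : ℝ) ≤ 𝓝[Ico 0 T] 0 := by
    rw [nhdsWithin_le_iff]
    filter_upwards [Ioo_mem_nhdsGT hc.T_pos] with t ht using ⟨ht.1.le, ht.2⟩
  have hs0 : Tendsto s (𝓝[>] 0) (𝓝 (s 0)) := (hc.cont_s 0 h0mem).tendsto.mono_left hle0
  have hv0 : Tendsto v (𝓝[>] 0) (𝓝 (v 0)) := (hc.cont_v 0 h0mem).tendsto.mono_left hle0
  have hρ0 : Tendsto (fun t => ρ₁ + ε * t) (𝓝[>] 0) (𝓝 (ρ₁ + ε * 0)) :=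
    (Continuous.tendsto (by fun_prop) 0).mono_left nhdsWithin_le_nhds
  have hJ0 : Tendsto J (𝓝[>] 0) (𝓝 ((relSpeed ε (s 0) (v 0) ^ 2 - s 0 ^ 2 * c₁) /
      ((ρ₁ + ε * 0) * v 0))) := by
    refine Tendsto.div ?_ (hρ0.mul hv0) (mul_pos (hc.ρ_pos 0 h0mem) (hc.v_pos 0 h0mem)).ne'
    exact ((((hv0.const_mul ε).mul hs0).const_add 1).pow 2).sub ((hs0.pow 2).mul hlim)
  have hJge : ∀ t ∈ Ioo 0 T', 0 ≤ J t := by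
    intro t ht
    have h1 : 0 ≤ (relSpeed ε (s 0) (v 0) ^ 2 - s 0 ^ 2 * c₁) / ((ρ₁ + ε * 0) * v 0) :=
      div_nonneg (by linarith) (mul_pos (hc.ρ_pos 0 h0mem) (hc.v_pos 0 h0mem)).le
    refine h1.trans (le_of_tendsto hJ0 ?_)
    filter_upwards [Ioo_mem_nhdsGT ht.1] with r hr
    exact hmono ⟨hr.1, hr.2.trans ht.2⟩ ht hr.2.le
  have hJpos : 0 < J t₁ := by
    by_contra hcon
    have hz : ∀ t ∈ Ioo 0 t₁, J t = 0 := fun t ht => by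
      have h1 := hJge t ⟨ht.1, ht.2.trans ht₁.2⟩
      have h2 := hmono ⟨ht.1, ht.2.trans ht₁.2⟩ ht₁ ht.2.le
      linarith [not_lt.1 hcon]
    have hm : t₁ / 2 ∈ Ioo 0 t₁ := ⟨by linarith [ht₁.1], by linarith [ht₁.1]⟩
    have hm' : t₁ / 2 ∈ Ioo 0 T' := ⟨hm.1, hm.2.trans ht₁.2⟩
    have h3 : HasDerivAt J 0 (t₁ / 2) := (hasDerivAt_const (t₁ / 2) (0 : ℝ)).congr_of_eventuallyEq
      (by filter_upwards [Ioo_mem_nhds hm.1 hm.2] with r hr using hz r hr)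
    have h4 := h3.unique (hdJ _ hm')
    have hρ := hc.ρ_pos _ (hsub' hm')
    have hv := hc.v_pos _ (hsub' hm')
    have h5 : s (t₁ / 2) = 0 := by
      have h6 := (hconv _ hm').2
      by_contra hne
      have : 0 < s (t₁ / 2) ^ 2 := by positivity
      have h7 : 0 < -ε * (2 * deriv P (ρ₁ + ε * (t₁ / 2)) +
        (ρ₁ + ε * (t₁ / 2)) * deriv (deriv P) (ρ₁ + ε * (t₁ / 2))) * s (t₁ / 2) ^ 2 /
        ((ρ₁ + ε * (t₁ / 2)) ^ 2 * v (t₁ / 2)) := by positivity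
      linarith
    have h8 := hz _ hm
    simp only [hJ, sonicGap, relSpeed, h5] at h8
    have : (0:ℝ) < (1 + ε * v (t₁ / 2) * 0) ^ 2 - 0 ^ 2 * deriv P (ρ₁ + ε * (t₁ / 2)) := by
      norm_num
    have h9 := div_pos this (mul_pos hρ hv)
    linarith
  have hmul : sonicGap (deriv P (ρ₁ + ε * t₁)) ε (s t₁) (v t₁) = J t₁ * ((ρ₁ + ε * t₁) * v t₁) := by
    have hρ := hc.ρ_pos _ (hsub' ht₁)
    have hv := hc.v_pos _ (hsub' ht₁)
    simp only [hJ]; field_simp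
  rw [hmul]
  exact mul_pos hJpos (mul_pos (hc.ρ_pos _ (hsub' ht₁)) (hc.v_pos _ (hsub' ht₁)))

end curve

/-! ### Expansion of dilute gas -/

/-- A function that is bounded above cannot grow at least as fast as `-κ log (T - t)`. -/
lemma false_of_log_growth {f f' : ℝ → ℝ} {t₀ T κ C : ℝ} (hT : t₀ < T) (hκ : 0 < κ)
    (hd : ∀ t ∈ Ioo t₀ T, HasDerivAt f (f' t) t ∧ κ / (T - t) ≤ f' t)
    (hb : ∀ t ∈ Ioo t₀ T, f t ≤ C) : False := by
  set g : ℝ → ℝ := fun t => f t + κ * Real.log (T - t) with hg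
  have hdg : ∀ t ∈ Ioo t₀ T, HasDerivAt g (f' t + κ * (-1 / (T - t))) t := fun t ht => by
    have h1 : HasDerivAt (fun t => T - t) (-1) t := by simpa using (hasDerivAt_id t).const_sub T
    exact (hd t ht).1.add ((h1.log (by linarith [ht.2])).const_mul κ)
  have hmono : MonotoneOn g (Ioo t₀ T) := by
    refine monotoneOn_of_deriv_nonneg (convex_Ioo _ _)
      (fun t ht => (hdg t ht).continuousAt.continuousWithinAt)
      (fun t ht => (hdg t (interior_subset ht)).differentiableAt.differentiableWithinAt) ?_
    intro t ht
    have ht := interior_subset ht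
    rw [(hdg t ht).deriv]
    have h1 := (hd t ht).2
    have h2 : κ * (-1 / (T - t)) = -(κ / (T - t)) := by ring
    linarith
  obtain ⟨t₁, ht₁⟩ := exists_between hT
  have hlim : Tendsto (fun t => κ * Real.log (T - t)) (𝓝[<] T) atBot := by
    refine Tendsto.const_mul_atBot hκ (Real.tendsto_log_nhdsGT_zero.comp ?_)
    refine tendsto_nhdsWithin_iff.2 ⟨?_, ?_⟩
    · have : Tendsto (fun t => T - t) (𝓝 T) (𝓝 (T - T)) := Continuous.tendsto (by fun_prop) T
      rw [sub_self] at this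
      exact this.mono_left nhdsWithin_le_nhds
    · filter_upwards [self_mem_nhdsWithin] with t ht
      simp only [mem_Iio, mem_Ioi] at *; linarith
  obtain ⟨t, ht1, ht2⟩ := ((hlim.eventually_lt_atBot (g t₁ - C)).and
    (Ioo_mem_nhdsLT ht₁.2)).exists
  have h1 := hmono ht₁ ⟨ht₁.1.trans ht2.1, ht2.2⟩ ht2.1.le
  have h2 := hb t ⟨ht₁.1.trans ht2.1, ht2.2⟩
  have h3 : g t = f t + κ * Real.log (T - t) := rfl
  linarith

section curve

variable {P : ℝ → ℝ} {α β ε ρ₁ T : ℝ} {s v : ℝ → ℝ}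

lemma tendsto_density (ε ρ₁ T : ℝ) :
    Tendsto (fun t => ρ₁ + ε * t) (𝓝[<] T) (𝓝 (ρ₁ + ε * T)) :=
  (Continuous.tendsto (by fun_prop) T).mono_left nhdsWithin_le_nhds

lemma tendsto_relSpeed {l : Filter ℝ} {ε s' v' : ℝ} (hs : Tendsto s l (𝓝 s'))
    (hv : Tendsto v l (𝓝 v')) :
    Tendsto (fun t => relSpeed ε (s t) (v t)) l (𝓝 (relSpeed ε s' v')) :=
  ((hv.const_mul ε).mul hs).const_add 1

lemma IsCurve.eventually_mem (hc : IsCurve P {α, β} ε ρ₁ T s v) : ∀ᶠ t in 𝓝[<] T, t ∈ Ioo 0 T :=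
  Ioo_mem_nhdsLT hc.T_pos

/-- An expanding supersonic curve that stops at a positive density stops at a finite value of `s`. -/
lemma IsCurve.tendsto_s_finite_of_expansion (hc : IsCurve P {α, β} (-1) ρ₁ T s v)
    (h : PressureShape P α β) (hgap : IsSupersonic P {α, β} (-1) ρ₁ T s v) (h0 : 0 ≤ s 0)
    (hT : T < ρ₁) : ∃ s', Tendsto s (𝓝[<] T) (𝓝 s') ∧ ∀ t ∈ Ico 0 T, s t ≤ s' := by
  have hε : (-1 : ℝ) = 1 ∨ (-1 : ℝ) = -1 := Or.inr rfl
  have hs := hc.nonneg_s hε hgap h0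
  have hanti := hc.antitoneOn h hε hs
  rcases exists_tendsto_of_monotoneOn hc.T_pos (hc.strictMonoOn hε hgap).monotoneOn with hl | hl
  · exact hl
  exfalso
  have hbad : ∀ᶠ t in 𝓝[<] T, ρ₁ + -1 * t ∉ ({α, β} : Set ℝ) := by
    have := ((finite_preimage_bad α β hε ρ₁).sdiff (t := {T})).isClosed.isOpen_compl.mem_nhds
      (show T ∈ (_ \ {T})ᶜ by simp)
    filter_upwards [nhdsWithin_le_nhds this, self_mem_nhdsWithin] with t ht ht2 hb
    exact ht ⟨hb, ne_of_lt ht2⟩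
  have hρ : Tendsto (fun t => ρ₁ + -1 * t) (𝓝[<] T) (𝓝[>] (ρ₁ + -1 * T)) := by
    refine tendsto_nhdsWithin_iff.2 ⟨tendsto_density _ _ _, ?_⟩
    filter_upwards [self_mem_nhdsWithin] with t ht
    simp only [mem_Iio, mem_Ioi] at *; linarith
  obtain ⟨c, hc1, hc2⟩ := h.right_limit (ρ₁ + -1 * T) (by linarith)
  have hq1 : ∀ t ∈ Ico 0 T, relSpeed (-1) (s t) (v t) ≤ 1 := fun t ht => by
    have := mul_nonneg (hc.v_pos t ht).le (hs t ht)
    unfold relSpeed; linarith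
  rcases hc2 with hc2 | hc2
  · -- the supersonic condition bounds `s`
    have h1 : Tendsto (fun t => s t ^ 2 * deriv P (ρ₁ + -1 * t)) (𝓝[<] T) atTop :=
      ((tendsto_pow_atTop two_ne_zero).comp hl).atTop_mul_pos hc2 (hc1.comp hρ)
    obtain ⟨t, h2, h3, h4⟩ :=
      ((h1.eventually_gt_atTop 1).and (hbad.and hc.eventually_mem)).exists
    have h5 := hgap t h4 h3
    have h6 := hq1 t ⟨h4.1.le, h4.2⟩
    have h7 := hc.q_pos t ⟨h4.1.le, h4.2⟩
    unfold sonicGap at h5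
    nlinarith
  · -- the velocity is constant, and `u s < 1`
    obtain ⟨a, ha, hsub⟩ := mem_nhdsLT_iff_exists_Ioo_subset.1
      ((hρ.eventually hc2).and (hbad.and hc.eventually_mem))
    obtain ⟨t₁, ht₁⟩ := exists_between (show a < T from ha)
    have ht₁' := (hsub ht₁).2.2
    have hconst : ∀ t ∈ Ioo t₁ T, v t = v t₁ := by
      intro t ht
      have hsub2 : Icc t₁ t ⊆ Ioo a T := fun r hr => ⟨ht₁.1.trans_le hr.1, hr.2.trans_lt ht.2⟩
      refine constant_of_has_deriv_right_zero (a := t₁) (b := t)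
        (fun r hr => (hc.cont_v r (Ioo_subset_Ico_self (hsub (hsub2 hr)).2.2)).mono_of_mem_nhdsWithin
          ?_) (fun r hr => ?_) t ⟨ht.1.le, le_rfl⟩
      · exact mem_nhdsWithin_of_mem_nhds
          (Ico_mem_nhds (hsub (hsub2 hr)).2.2.1 (hsub (hsub2 hr)).2.2.2)
      · have h3 := hsub (hsub2 ⟨hr.1, hr.2.le⟩)
        have h4 := hc.deriv_v r h3.2.2 h3.2.1
        have h5 : deriv P (ρ₁ + -1 * r) = 0 := h3.1
        rw [h5] at h4
        simpa using h4.hasDerivWithinAt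
    have hv1 := hc.v_pos t₁ ⟨ht₁'.1.le, ht₁'.2⟩
    obtain ⟨t, h2, h3⟩ := ((hl.eventually_gt_atTop (1 / v t₁)).and
      (Ioo_mem_nhdsLT ht₁.2)).exists
    have h4 := hc.q_pos t ⟨ht₁'.1.le.trans h3.1.le, h3.2⟩
    rw [hconst t h3] at h4
    unfold relSpeed at h4
    rw [div_lt_iff₀ hv1] at h2
    linarith

end curve

/-- Gas of density at most `α` that moves outwards, at a supersonic or sonic state, expands
without shocks: it comes to rest, is followed by vacuum, or thins out forever. -/
theorem PressureShape.isSolvableFrom_dilute {P : ℝ → ℝ} {α β ρ₁ s₁ v₁ c₁ : ℝ}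
    (h : PressureShape P α β) (hA : Tendsto (deriv P) (𝓝[>] 0) (𝓝 0)) (hρ : 0 < ρ₁) (hρα : ρ₁ ≤ α)
    (hs₁ : 0 ≤ s₁) (hv₁ : 0 < v₁) (hq₁ : 0 < relSpeed (-1) s₁ v₁)
    (hlim : Tendsto (deriv P) (𝓝[<] ρ₁) (𝓝 c₁)) (hson : s₁ ^ 2 * c₁ ≤ relSpeed (-1) s₁ v₁ ^ 2) :
    IsSolvableFrom P (-1) s₁ v₁ ρ₁ 0 := by
  have hε : (-1 : ℝ) = 1 ∨ (-1 : ℝ) = -1 := Or.inr rfl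
  obtain ⟨s, v, hs0, hv0, hcurve⟩ := h.exists_maximal_curve hε (isOpen_Ioi (a := (0 : ℝ)))
    Subset.rfl hρ hv₁ hq₁
  have hTle : ∀ T, IsCurve P {α, β} (-1) ρ₁ T s v → T ≤ ρ₁ := fun T hc => by
    by_contra hcon
    have := hc.ρ_pos ρ₁ ⟨hρ.le, not_le.1 hcon⟩
    linarith
  rcases hcurve with ⟨T, hc, -, hmax⟩ | hglob
  swap
  · have := hTle _ (hglob (ρ₁ + 1) (by linarith)).1
    linarith
  have hT := hTle T hc
  have hdil : ∀ t ∈ Ioo 0 T, ρ₁ + -1 * t < α ∧ 0 < ρ₁ + -1 * t := fun t ht =>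
    ⟨by linarith [ht.1], hc.ρ_pos t ⟨ht.1.le, ht.2⟩⟩
  have hnb : ∀ ρ, ρ < α → ρ ∉ ({α, β} : Set ℝ) := fun ρ hρ hb => by
    simp only [mem_insert_iff, mem_singleton_iff] at hb
    rcases hb with hb | hb <;> linarith [h.le]
  have hgap : IsSupersonic P {α, β} (-1) ρ₁ T s v := by
    intro t ht _
    refine hc.gap_pos_of_convexity h hε le_rfl (c₁ := c₁) (hlim.comp ?_)
      (by rw [hs0, hv0]; exact hson) (fun t ht => ⟨hnb _ (hdil t ht).1, ?_⟩) t ht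
    · refine tendsto_nhdsWithin_iff.2 ⟨?_, ?_⟩
      · have : Tendsto (fun t => ρ₁ + -1 * t) (𝓝 0) (𝓝 (ρ₁ + -1 * 0)) :=
          Continuous.tendsto (by fun_prop) 0
        rw [mul_zero, add_zero] at this
        exact this.mono_left nhdsWithin_le_nhds
      · filter_upwards [self_mem_nhdsWithin] with t ht
        simp only [mem_Iio, mem_Ioi] at *; linarith
    · have := h.deriv2_pos _ (hdil t ht).2 (Or.inl (hdil t ht).1)
      linarith
  have hs0' : 0 ≤ s 0 := by rw [hs0]; exact hs₁
  have hspos := hc.nonneg_s hε hgap hs0'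
  have hmono := hc.strictMonoOn hε hgap
  have hanti := hc.antitoneOn h hε hspos
  obtain ⟨v', hv', hv'0, hv'le⟩ := exists_tendsto_of_antitoneOn hc.T_pos hanti hc.v_pos
  have hres : ∀ {n}, IsSolvableFrom P (-1) (s 0) (- -1 * v 0) ρ₁ n →
      IsSolvableFrom P (-1) s₁ v₁ ρ₁ n := fun {n} hn => by
    rw [hs0, hv0] at hn; simpa using hn
  have hq1 : ∀ t ∈ Ico 0 T, relSpeed (-1) (s t) (v t) ≤ 1 := fun t ht => by
    have := mul_nonneg (hc.v_pos t ht).le (hspos t ht)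
    unfold relSpeed; linarith
  have hfinite : ∀ s', Tendsto s (𝓝[<] T) (𝓝 s') → (∀ t ∈ Ico 0 T, s t ≤ s') → 0 < s' ∧
      0 ≤ relSpeed (-1) s' v' := fun s' hs' hle => by
    have hm := hc.T_pos
    have h1 : s 0 < s (T / 2) := hmono ⟨le_rfl, hm⟩ ⟨by linarith, by linarith⟩ (by linarith)
    refine ⟨by linarith [hle (T / 2) ⟨by linarith, by linarith⟩], ?_⟩
    refine ge_of_tendsto (tendsto_relSpeed hs' hv') ?_
    filter_upwards [hc.eventually_mem] with t ht
    exact (hc.q_pos t ⟨ht.1.le, ht.2⟩).le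
  rcases hT.lt_or_eq with hTlt | hTeq
  · -- the density stays positive: the gas comes to rest
    obtain ⟨s', hs', hle⟩ := hc.tendsto_s_finite_of_expansion h hgap hs0' hTlt
    obtain ⟨hs'pos, hq'⟩ := hfinite s' hs' hle
    have hρT : 0 < ρ₁ + -1 * T := by linarith
    have hρTα : ρ₁ + -1 * T < α := by linarith [hc.T_pos]
    rcases hv'0.eq_or_lt with hv0' | hv0'
    · refine hres ((hc.followedBy h hε hgap hs0' hs' hv'
        (isSolvableFrom_rest P (-1) hs'pos.le hρT)).1 (by rw [← hv0']; simp) rfl)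
    · exfalso
      have h1 := hmax s' v' hs' hv' hρT hv0'
      have h2 : relSpeed (-1) s' v' = 0 := le_antisymm h1 hq'
      have h3 : s' ^ 2 * deriv P (ρ₁ + -1 * T) ≤ relSpeed (-1) s' v' ^ 2 := by
        refine le_of_tendsto_of_tendsto ((hs'.pow 2).mul (((h.continuousAt_deriv hρT
          (hnb _ hρTα)).tendsto).comp (tendsto_density (-1) ρ₁ T)))
          ((tendsto_relSpeed hs' hv').pow 2) ?_
        filter_upwards [hc.eventually_mem] with t ht
        have := hgap t ht (hnb _ (hdil t ht).1)
        unfold sonicGap at this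
        simp only [Function.comp_apply]
        linarith
      rw [h2, zero_pow two_ne_zero] at h3
      have h4 := h.deriv_pos _ hρT (Or.inl hρTα)
      have : 0 < s' ^ 2 * deriv P (ρ₁ + -1 * T) := by positivity
      linarith
  · have hρT : ρ₁ + -1 * T = 0 := by linarith
    rcases exists_tendsto_of_monotoneOn hc.T_pos hmono.monotoneOn with ⟨s', hs', hle⟩ | hs'
    · -- the density vanishes at a finite `s`: vacuum
      obtain ⟨hs'pos, hq'⟩ := hfinite s' hs' hle
      rcases hq'.eq_or_lt with hq0 | hq0
      · refine hres ((hc.followedBy h hε hgap hs0' hs' hv' (isSolvableFrom_vacuum P s')).1 ?_ hρT)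
        unfold relSpeed at hq0
        field_simp; linarith
      · exfalso
        have hcl : Tendsto (fun t => deriv P (ρ₁ + -1 * t)) (𝓝[<] T) (𝓝 0) := by
          refine hA.comp (tendsto_nhdsWithin_iff.2 ⟨hρT ▸ tendsto_density (-1) ρ₁ T, ?_⟩)
          filter_upwards [hc.eventually_mem] with t ht using (hdil t ht).2
        have hB : Tendsto (fun t => sonicGap (deriv P (ρ₁ + -1 * t)) (-1) (s t) (v t)) (𝓝[<] T)
            (𝓝 (relSpeed (-1) s' v' ^ 2 - s' ^ 2 * 0)) :=
          ((tendsto_relSpeed hs' hv').pow 2).sub ((hs'.pow 2).mul hcl)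
        set q' := relSpeed (-1) s' v' with hq'def
        have hB2 : q' ^ 2 / 2 < q' ^ 2 - s' ^ 2 * 0 := by
          have : 0 < q' ^ 2 := by positivity
          linarith
        obtain ⟨a, ha, hsub⟩ := mem_nhdsLT_iff_exists_Ioo_subset.1
          ((hB.eventually (lt_mem_nhds hB2)).and hc.eventually_mem)
        refine false_of_log_growth (f := s) (t₀ := a) (T := T) (κ := q' ^ 2 / 2 / (2 * v 0))
          (C := s') ha (by rw [hv0]; positivity)
          (fun t ht => ⟨hc.deriv_s t (hsub ht).2 (hnb _ (hdil t (hsub ht).2).1), ?_⟩)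
          (fun t ht => hle t (Ioo_subset_Ico_self (hsub ht).2))
        have ht2 := (hsub ht).2
        have ht3 : t ∈ Ico 0 T := Ioo_subset_Ico_self ht2
        have h1 : q' ^ 2 / 2 < sonicGap (deriv P (ρ₁ + -1 * t)) (-1) (s t) (v t) := (hsub ht).1
        have h2 := hc.v_pos t ht3
        have h3 := hc.ρ_pos t ht3
        have h4 := hc.q_pos t ht3
        have h5 := hq1 t ht3
        have h6 : v t ≤ v 0 := hanti ⟨le_rfl, hc.T_pos⟩ ht3 ht3.1
        have h7 : T - t = ρ₁ + -1 * t := by linarith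
        have h8 : 0 < v 0 := h2.trans_le h6
        have h9 : 0 < q' ^ 2 / 2 := by positivity
        rw [h7, div_div]
        refine div_le_div₀ (h9.trans h1).le h1.le (by positivity) ?_
        calc 2 * v t * (ρ₁ + -1 * t) * relSpeed (-1) (s t) (v t)
            ≤ 2 * v 0 * (ρ₁ + -1 * t) * 1 := by gcongr
          _ = _ := by ring
    · -- the density tends to zero as `s` tends to infinity
      have himg := image_Ico_of_tendsto_atTop hc.T_pos hmono hc.cont_s hs'
      obtain ⟨U, R, K, hp, hl⟩ := hc.exists_smoothPiece h hε hgap hs0' himg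
        (fun σ hσ hne => Ici_mem_nhds (lt_of_le_of_ne hσ (Ne.symm hne))) self_mem_nhdsWithin
      obtain ⟨hU, hR⟩ := hl atTop (eventually_ge_atTop _) (fun t _ => eventually_gt_atTop _) v' hv'
      have hv'z : v' = 0 := by
        refine le_antisymm (le_of_tendsto_of_tendsto hv' (tendsto_inv_atTop_zero.comp hs') ?_) hv'0
        filter_upwards [hc.eventually_mem, hs'.eventually_gt_atTop 0] with t ht hst
        have := hc.q_pos t (Ioo_subset_Ico_self ht)
        unfold relSpeed at this
        simp only [Function.comp_apply]
        rw [le_inv_comm₀ (hc.v_pos t (Ioo_subset_Ico_self ht)) hst, ← one_div,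
          le_div_iff₀ (hc.v_pos t (Ioo_subset_Ico_self ht))]
        linarith
      rw [hv'z, mul_zero] at hU
      rw [hρT] at hR
      have hI : Ici (s 0) \ {s 0} = Ioi (s 0) := by ext x; simp [lt_iff_le_and_ne, eq_comm]
      refine hres ⟨U, R, ∅, K, hp.init_u, hp.init_ρ, hp.cont_u, hp.cont_ρ, hI ▸ hp.profile, rfl,
        Or.inr (Or.inr ⟨rfl, fun σ hσ => ⟨hp.pos_u rfl σ hσ, hp.pos σ hσ⟩, hU, hR⟩)⟩

/-! ### Rayleigh lines and convexity -/

section shape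

variable {P : ℝ → ℝ} {α β : ℝ}

lemma PressureShape.β_pos (h : PressureShape P α β) : 0 < β := h.α_pos.trans_le h.le

lemma PressureShape.notMem_of_lt (h : PressureShape P α β) {ρ : ℝ} (hρ : ρ < α) :
    ρ ∉ ({α, β} : Set ℝ) := fun hb => by
  simp only [mem_insert_iff, mem_singleton_iff] at hb
  rcases hb with hb | hb <;> linarith [h.le]

lemma PressureShape.notMem_of_gt (h : PressureShape P α β) {ρ : ℝ} (hρ : β < ρ) :
    ρ ∉ ({α, β} : Set ℝ) := fun hb => by
  simp only [mem_insert_iff, mem_singleton_iff] at hb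
  rcases hb with hb | hb <;> linarith [h.le]

lemma notMem_of_mem_Ioo {ρ : ℝ} (hρ : ρ ∈ Ioo α β) : ρ ∉ ({α, β} : Set ℝ) := fun hb => by
  simp only [mem_insert_iff, mem_singleton_iff] at hb
  rcases hb with hb | hb <;> linarith [hρ.1, hρ.2]

lemma PressureShape.continuousOn_volume (h : PressureShape P α β) :
    ContinuousOn (pressureOfVolume P) (Ioi 0) :=
  h.cont.comp (continuousOn_inv₀.mono fun _ hx => ne_of_gt hx) fun _ hx =>
    mem_Ici.2 (inv_nonneg.2 (le_of_lt hx))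

lemma PressureShape.hasDerivAt_volume (h : PressureShape P α β) {ρ : ℝ} (h0 : 0 < ρ)
    (hb : ρ ∉ ({α, β} : Set ℝ)) :
    HasDerivAt (pressureOfVolume P) (-(ρ ^ 2 * deriv P ρ)) ρ⁻¹ := by
  have h1 : HasDerivAt (fun τ : ℝ => τ⁻¹) (-((ρ⁻¹) ^ 2)⁻¹) ρ⁻¹ := hasDerivAt_inv (by positivity)
  have h2 : HasDerivAt P (deriv P ρ) (ρ⁻¹)⁻¹ := by rw [inv_inv]; exact h.hasDerivAt h0 hb
  refine (HasDerivAt.comp ρ⁻¹ h2 h1).congr_deriv ?_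
  field_simp

lemma PressureShape.tangent_le (h : PressureShape P α β) {D : Set ℝ}
    (hD : ConvexOn ℝ D (pressureOfVolume P)) {ρ θ : ℝ} (h0 : 0 < ρ)
    (hb : ρ ∉ ({α, β} : Set ℝ)) (hρ : ρ⁻¹ ∈ D) (hθ : θ ∈ D) :
    P ρ - ρ ^ 2 * deriv P ρ * (θ - ρ⁻¹) ≤ pressureOfVolume P θ := by
  have hd := h.hasDerivAt_volume h0 hb
  have hP : pressureOfVolume P ρ⁻¹ = P ρ := by simp [pressureOfVolume]
  rcases lt_trichotomy θ ρ⁻¹ with hlt | heq | hgt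
  · have := hD.slope_le_of_hasDerivAt hθ hρ hlt hd
    rw [slope_def_field, div_le_iff₀ (by linarith), hP] at this
    linarith
  · rw [heq, hP]; simp
  · have := hD.le_slope_of_hasDerivAt hρ hθ hgt hd
    rw [slope_def_field, le_div_iff₀ (by linarith), hP] at this
    linarith

lemma PressureShape.le_tangent (h : PressureShape P α β) {D : Set ℝ}
    (hD : ConcaveOn ℝ D (pressureOfVolume P)) {ρ θ : ℝ} (h0 : 0 < ρ)
    (hb : ρ ∉ ({α, β} : Set ℝ)) (hρ : ρ⁻¹ ∈ D) (hθ : θ ∈ D) :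
    pressureOfVolume P θ ≤ P ρ - ρ ^ 2 * deriv P ρ * (θ - ρ⁻¹) := by
  have hd := h.hasDerivAt_volume h0 hb
  have hP : pressureOfVolume P ρ⁻¹ = P ρ := by simp [pressureOfVolume]
  rcases lt_trichotomy θ ρ⁻¹ with hlt | heq | hgt
  · have := hD.le_slope_of_hasDerivAt hθ hρ hlt hd
    rw [slope_def_field, le_div_iff₀ (by linarith), hP] at this
    linarith
  · rw [heq, hP]; simp
  · have := hD.slope_le_of_hasDerivAt hρ hθ hgt hd
    rw [slope_def_field, div_le_iff₀ (by linarith), hP] at this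
    linarith

lemma PressureShape.le_rayleigh (h : PressureShape P α β) {D : Set ℝ}
    (hD : ConvexOn ℝ D (pressureOfVolume P)) {ρ θ s q : ℝ} (h0 : 0 < ρ)
    (hb : ρ ∉ ({α, β} : Set ℝ)) (hρ : ρ⁻¹ ∈ D) (hθ : θ ∈ D) :
    ρ ^ 2 * (θ - ρ⁻¹) * (q ^ 2 - s ^ 2 * deriv P ρ) ≤ rayleigh P s q ρ θ := by
  have := mul_le_mul_of_nonneg_left (h.tangent_le hD h0 hb hρ hθ) (sq_nonneg s)
  unfold rayleigh
  nlinarith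

lemma PressureShape.rayleigh_le (h : PressureShape P α β) {D : Set ℝ}
    (hD : ConcaveOn ℝ D (pressureOfVolume P)) {ρ θ s q : ℝ} (h0 : 0 < ρ)
    (hb : ρ ∉ ({α, β} : Set ℝ)) (hρ : ρ⁻¹ ∈ D) (hθ : θ ∈ D) :
    rayleigh P s q ρ θ ≤ ρ ^ 2 * (θ - ρ⁻¹) * (q ^ 2 - s ^ 2 * deriv P ρ) := by
  have := mul_le_mul_of_nonneg_left (h.le_tangent hD h0 hb hρ hθ) (sq_nonneg s)
  unfold rayleigh
  nlinarith

lemma rayleigh_self (P : ℝ → ℝ) (s q ρ : ℝ) : rayleigh P s q ρ ρ⁻¹ = 0 := by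
  simp [rayleigh, pressureOfVolume]

/-- The Rayleigh line through a state is also that of any other state on it. -/
lemma rayleigh_shift (P : ℝ → ℝ) {s q ρ q' θ ϑ : ℝ} (hθ : 0 < θ)
    (h0 : rayleigh P s q ρ θ = 0) (hq : q' = q * ρ * θ) :
    rayleigh P s q' θ⁻¹ ϑ = rayleigh P s q ρ ϑ := by
  have h1 : q' * θ⁻¹ = q * ρ := by rw [hq]; field_simp
  unfold rayleigh at *
  have h2 : pressureOfVolume P θ = P θ⁻¹ := rfl
  rw [h1, inv_inv]
  rw [h2] at h0
  linarith

lemma convexOn_rayleigh {P : ℝ → ℝ} {D : Set ℝ} (hD : ConvexOn ℝ D (pressureOfVolume P))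
    (s q ρ : ℝ) : ConvexOn ℝ D (rayleigh P s q ρ) := by
  refine ⟨hD.1, fun x hx y hy a b ha hb hab => ?_⟩
  have h1 := mul_le_mul_of_nonneg_left (hD.2 hx hy ha hb hab) (sq_nonneg s)
  simp only [smul_eq_mul] at *
  have hb' : b = 1 - a := by linarith
  subst hb'
  unfold rayleigh
  linarith

lemma concaveOn_rayleigh {P : ℝ → ℝ} {D : Set ℝ} (hD : ConcaveOn ℝ D (pressureOfVolume P))
    (s q ρ : ℝ) : ConcaveOn ℝ D (rayleigh P s q ρ) := by
  refine ⟨hD.1, fun x hx y hy a b ha hb hab => ?_⟩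
  have h1 := mul_le_mul_of_nonneg_left (hD.2 hx hy ha hb hab) (sq_nonneg s)
  simp only [smul_eq_mul] at *
  have hb' : b = 1 - a := by linarith
  subst hb'
  unfold rayleigh
  linarith

/-- A dilute state whose Rayleigh line runs below the graph on the side of larger volumes is
supersonic or sonic. -/
lemma PressureShape.sonic_le_of_dilute (h : PressureShape P α β) {ρ s q c θ : ℝ} (h0 : 0 < ρ)
    (hρ : ρ ≤ α) (hlim : Tendsto (deriv P) (𝓝[<] ρ) (𝓝 c)) (hθ : ρ⁻¹ < θ)
    (hr : ∀ ϑ ∈ Ioo ρ⁻¹ θ, 0 ≤ rayleigh P s q ρ ϑ) : s ^ 2 * c ≤ q ^ 2 := by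
  have hlim2 : Tendsto (fun r => s ^ 2 * (r ^ 2 * deriv P r)) (𝓝[<] ρ) (𝓝 (s ^ 2 * (ρ ^ 2 * c))) :=
    (((Continuous.tendsto (by fun_prop) ρ).mono_left nhdsWithin_le_nhds).mul hlim).const_mul _
  have key : s ^ 2 * (ρ ^ 2 * c) ≤ (q * ρ) ^ 2 := by
    refine le_of_tendsto hlim2 ?_
    have hθ0 : 0 < θ := (inv_pos.2 h0).trans hθ
    filter_upwards [Ioo_mem_nhdsLT (show θ⁻¹ < ρ from (inv_lt_comm₀ h0 hθ0).1 hθ)] with r hr'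
    have hr0 : 0 < r := (inv_pos.2 hθ0).trans hr'.1
    have h1 : ρ⁻¹ < r⁻¹ := (inv_lt_inv₀ h0 hr0).2 hr'.2
    have h2 : r⁻¹ < θ := (inv_lt_comm₀ hr0 hθ0).2 hr'.1
    have hα : α⁻¹ ≤ ρ⁻¹ := (inv_le_inv₀ h.α_pos h0).2 hρ
    have h3 := h.tangent_le h.convex_dilute hr0 (h.notMem_of_lt (hr'.2.trans_le hρ))
      (hα.trans h1.le) (show ρ⁻¹ ∈ Ici α⁻¹ from hα)
    have h4 := hr r⁻¹ ⟨h1, h2⟩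
    unfold rayleigh at h4
    simp only [pressureOfVolume, inv_inv] at h3 h4
    have h5 : s ^ 2 * (P r - P ρ) ≤ s ^ 2 * (r ^ 2 * deriv P r * (ρ⁻¹ - r⁻¹)) :=
      mul_le_mul_of_nonneg_left (by linarith) (sq_nonneg s)
    have h6 : 0 ≤ (r⁻¹ - ρ⁻¹) * ((q * ρ) ^ 2 - s ^ 2 * (r ^ 2 * deriv P r)) := by linarith
    have h7 := nonneg_of_mul_nonneg_right h6 (by linarith)
    linarith
  have hsq : 0 < ρ ^ 2 := by positivity
  nlinarith

/-- A state in the concave range whose Rayleigh line runs above the graph on the side of smaller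
volumes is supersonic or sonic. -/
lemma PressureShape.sonic_le_of_middle (h : PressureShape P α β) {ρ s q c θ : ℝ} (hα : α ≤ ρ)
    (hρ : ρ < β) (hlim : Tendsto (deriv P) (𝓝[>] ρ) (𝓝 c)) (hθ0 : 0 < θ) (hθ : θ < ρ⁻¹)
    (hr : ∀ ϑ ∈ Ioo θ ρ⁻¹, rayleigh P s q ρ ϑ ≤ 0) : s ^ 2 * c ≤ q ^ 2 := by
  have h0 : 0 < ρ := h.α_pos.trans_le hα
  have hlim2 : Tendsto (fun r => s ^ 2 * (r ^ 2 * deriv P r)) (𝓝[>] ρ) (𝓝 (s ^ 2 * (ρ ^ 2 * c))) :=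
    (((Continuous.tendsto (by fun_prop) ρ).mono_left nhdsWithin_le_nhds).mul hlim).const_mul _
  have key : s ^ 2 * (ρ ^ 2 * c) ≤ (q * ρ) ^ 2 := by
    refine le_of_tendsto hlim2 ?_
    filter_upwards [Ioo_mem_nhdsGT (show ρ < min β θ⁻¹ from
      lt_min hρ ((lt_inv_comm₀ h0 hθ0).2 hθ))] with r hr'
    have hr0 : 0 < r := h0.trans hr'.1
    have hrβ : r < β := hr'.2.trans_le (min_le_left _ _)
    have hrθ : r < θ⁻¹ := hr'.2.trans_le (min_le_right _ _)
    have h1 : r⁻¹ < ρ⁻¹ := (inv_lt_inv₀ hr0 h0).2 hr'.1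
    have h2 : θ < r⁻¹ := (lt_inv_comm₀ hr0 hθ0).1 hrθ
    have hα' : ρ⁻¹ ≤ α⁻¹ := (inv_le_inv₀ h0 h.α_pos).2 hα
    have hβ' : β⁻¹ ≤ r⁻¹ := (inv_le_inv₀ h.β_pos hr0).2 hrβ.le
    have h3 := h.le_tangent h.concave_middle hr0 (notMem_of_mem_Ioo ⟨hα.trans_lt hr'.1, hrβ⟩)
      ⟨hβ', h1.le.trans hα'⟩ (show ρ⁻¹ ∈ Icc β⁻¹ α⁻¹ from ⟨hβ'.trans h1.le, hα'⟩)
    have h4 := hr r⁻¹ ⟨h2, h1⟩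
    unfold rayleigh at h4
    simp only [pressureOfVolume, inv_inv] at h3 h4
    have h5 : s ^ 2 * (r ^ 2 * deriv P r * (ρ⁻¹ - r⁻¹)) ≤ s ^ 2 * (P r - P ρ) :=
      mul_le_mul_of_nonneg_left (by linarith) (sq_nonneg s)
    have h6 : 0 ≤ (ρ⁻¹ - r⁻¹) * ((q * ρ) ^ 2 - s ^ 2 * (r ^ 2 * deriv P r)) := by linarith
    have h7 := nonneg_of_mul_nonneg_right h6 (by linarith)
    linarith
  have hsq : 0 < ρ ^ 2 := by positivity
  nlinarith

lemma PressureShape.strictMonoOn_dilute (h : PressureShape P α β) :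
    StrictMonoOn P (Ioc 0 α) := by
  refine strictMonoOn_of_deriv_pos (convex_Ioc _ _)
    (h.cont.mono fun x hx => le_of_lt hx.1) fun x hx => ?_
  rw [interior_Ioc] at hx
  exact h.deriv_pos x hx.1 (Or.inl hx.2)

lemma PressureShape.monotoneOn (h : PressureShape P α β) : MonotoneOn P (Ioi 0) := by
  intro x hx y hy hxy
  rcases hxy.eq_or_lt with h' | h'
  · rw [h']
  refine rel_of_finite_exceptions (r := fun x y => P x ≤ P y) (F := {α, β})
    (fun _ _ _ => le_trans) (by simp) ordConnected_Ioi ?_ x hx y hy h'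
  intro x hx y hy hxy hz
  simp only [mem_Ioi] at hx
  refine monotoneOn_of_deriv_nonneg (convex_Icc x y)
    (h.cont.mono fun z hz => hx.le.trans hz.1) ?_ ?_ ⟨le_rfl, hxy.le⟩
    ⟨hxy.le, le_rfl⟩ hxy.le
  · intro z hz'
    rw [interior_Icc] at hz'
    exact (h.hasDerivAt (hx.trans hz'.1) (hz z hz')).differentiableAt.differentiableWithinAt
  · intro z hz'
    rw [interior_Icc] at hz'
    exact h.deriv_nonneg (hx.trans hz'.1) (hz z hz')

end shape

section curve

variable {P : ℝ → ℝ} {α β ε ρ₁ T : ℝ} {s v : ℝ → ℝ}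

/-- The Rayleigh function of the state at time `t` of a curve. -/
noncomputable def rayleighAlong (P : ℝ → ℝ) (ε ρ₁ : ℝ) (s v : ℝ → ℝ) (t θ : ℝ) : ℝ :=
  rayleigh P (s t) (relSpeed ε (s t) (v t)) (ρ₁ + ε * t) θ

/-- The specific volume at which the gas on the Rayleigh line is at rest. -/
noncomputable def restVolume (ε ρ₁ : ℝ) (s v : ℝ → ℝ) (t : ℝ) : ℝ :=
  (relSpeed ε (s t) (v t) * (ρ₁ + ε * t))⁻¹

lemma IsCurve.continuousOn_relSpeed (hc : IsCurve P {α, β} ε ρ₁ T s v) :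
    ContinuousOn (fun t => relSpeed ε (s t) (v t)) (Ico 0 T) :=
  continuousOn_const.add ((continuousOn_const.mul hc.cont_v).mul hc.cont_s)

lemma IsCurve.restVolume_pos (hc : IsCurve P {α, β} ε ρ₁ T s v) {t : ℝ} (ht : t ∈ Ico 0 T) :
    0 < restVolume ε ρ₁ s v t := inv_pos.2 (mul_pos (hc.q_pos t ht) (hc.ρ_pos t ht))

lemma IsCurve.continuousOn_restVolume (hc : IsCurve P {α, β} ε ρ₁ T s v) :
    ContinuousOn (restVolume ε ρ₁ s v) (Ico 0 T) :=
  ContinuousOn.inv₀ (hc.continuousOn_relSpeed.mul (by fun_prop))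
    fun t ht => (mul_pos (hc.q_pos t ht) (hc.ρ_pos t ht)).ne'

lemma IsCurve.continuousOn_pressure (hc : IsCurve P {α, β} ε ρ₁ T s v)
    (h : PressureShape P α β) : ContinuousOn (fun t => P (ρ₁ + ε * t)) (Ico 0 T) :=
  h.cont.comp (by fun_prop) fun t ht => (hc.ρ_pos t ht).le

lemma IsCurve.continuousOn_rayleighAlong (hc : IsCurve P {α, β} ε ρ₁ T s v)
    (h : PressureShape P α β) :
    ContinuousOn (Function.uncurry (rayleighAlong P ε ρ₁ s v)) (Ico 0 T ×ˢ Ioi 0) := by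
  have h1 : ∀ {f : ℝ → ℝ}, ContinuousOn f (Ico 0 T) →
      ContinuousOn (fun x : ℝ × ℝ => f x.1) (Ico 0 T ×ˢ Ioi 0) := fun hf =>
    hf.comp continuousOn_fst fun x hx => hx.1
  have h2 : ContinuousOn (fun x : ℝ × ℝ => pressureOfVolume P x.2) (Ico 0 T ×ˢ Ioi 0) :=
    h.continuousOn_volume.comp continuousOn_snd fun x hx => hx.2
  have hρ : ContinuousOn (fun t : ℝ => ρ₁ + ε * t) (Ico 0 T) := by fun_prop
  have hρi : ContinuousOn (fun t : ℝ => (ρ₁ + ε * t)⁻¹) (Ico 0 T) :=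
    hρ.inv₀ fun t ht => (hc.ρ_pos t ht).ne'
  exact ((h1 hc.cont_s).pow 2 |>.mul (h2.sub (h1 (hc.continuousOn_pressure h)))).add
    (((h1 hc.continuousOn_relSpeed).mul (h1 hρ)).pow 2 |>.mul (continuousOn_snd.sub (h1 hρi)))

lemma IsCurve.rayleigh_restVolume (hc : IsCurve P {α, β} ε ρ₁ T s v) {t : ℝ}
    (ht : t ∈ Ico 0 T) : rayleighAlong P ε ρ₁ s v t (restVolume ε ρ₁ s v t) =
      s t * (s t * (pressureOfVolume P (restVolume ε ρ₁ s v t) - P (ρ₁ + ε * t)) -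
        ε * ((ρ₁ + ε * t) * relSpeed ε (s t) (v t) * v t)) := by
  have hq := hc.q_pos t ht
  have hρ := hc.ρ_pos t ht
  have key : (relSpeed ε (s t) (v t) * (ρ₁ + ε * t)) ^ 2 *
      (restVolume ε ρ₁ s v t - (ρ₁ + ε * t)⁻¹) =
      (relSpeed ε (s t) (v t) * (ρ₁ + ε * t)) * (1 - relSpeed ε (s t) (v t)) := by
    unfold restVolume
    field_simp
  have h2 : 1 - relSpeed ε (s t) (v t) = -(ε * v t * s t) := by unfold relSpeed; ring
  unfold rayleighAlong rayleigh
  rw [key, h2]; ring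

/-- Just after the time `t = 0` at which `s = 0`, the curve is supersonic, and the Rayleigh line
lies on the right side of the graph at the rest state. -/
lemma IsCurve.eventually_initial (hc : IsCurve P {α, β} ε ρ₁ T s v) (h : PressureShape P α β)
    (hε : ε = 1 ∨ ε = -1) (h0 : s 0 = 0) :
    ∀ᶠ t in 𝓝[>] 0, 0 < s t ∧
      0 < -ε * rayleighAlong P ε ρ₁ s v t (restVolume ε ρ₁ s v t) := by
  have h0mem : (0 : ℝ) ∈ Ico 0 T := ⟨le_rfl, hc.T_pos⟩
  have hεε : ε * ε = 1 := by rcases hε with rfl | rfl <;> norm_num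
  have hle0 : 𝓝[>] (0 : ℝ) ≤ 𝓝[Ico 0 T] 0 := by
    rw [nhdsWithin_le_iff]
    filter_upwards [Ioo_mem_nhdsGT hc.T_pos] with t ht using ⟨ht.1.le, ht.2⟩
  have hs0 : Tendsto s (𝓝[>] 0) (𝓝 0) := by
    have := (hc.cont_s 0 h0mem).tendsto.mono_left hle0
    rwa [h0] at this
  have hv0 : Tendsto v (𝓝[>] 0) (𝓝 (v 0)) := (hc.cont_v 0 h0mem).tendsto.mono_left hle0
  have hρ0 : Tendsto (fun t => ρ₁ + ε * t) (𝓝[>] 0) (𝓝 (ρ₁ + ε * 0)) :=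
    (Continuous.tendsto (by fun_prop) 0).mono_left nhdsWithin_le_nhds
  have hq0 := tendsto_relSpeed (ε := ε) hs0 hv0
  have hP0 : Tendsto (fun t => P (ρ₁ + ε * t)) (𝓝[>] 0) (𝓝 (P (ρ₁ + ε * 0))) :=
    (hc.continuousOn_pressure h 0 h0mem).tendsto.mono_left hle0
  have hr0 := (hc.continuousOn_restVolume 0 h0mem).tendsto.mono_left hle0
  have hpr0 : Tendsto (fun t => pressureOfVolume P (restVolume ε ρ₁ s v t)) (𝓝[>] 0)
      (𝓝 (pressureOfVolume P (restVolume ε ρ₁ s v 0))) :=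
    ((h.continuousOn_volume.continuousAt (Ioi_mem_nhds (hc.restVolume_pos h0mem))).tendsto).comp hr0
  obtain ⟨c, hlim⟩ := h.tendsto_deriv_along hε (ρ₁ := ρ₁) (t₀ := 0) (hc.ρ_pos 0 h0mem)
  -- the curve is supersonic near `t = 0`, hence `s` increases there
  have hB : Tendsto (fun t => sonicGap (deriv P (ρ₁ + ε * t)) ε (s t) (v t)) (𝓝[>] 0)
      (𝓝 (relSpeed ε 0 (v 0) ^ 2 - 0 ^ 2 * c)) := (hq0.pow 2).sub ((hs0.pow 2).mul hlim)
  have hB1 : 0 < relSpeed ε 0 (v 0) ^ 2 - 0 ^ 2 * c := by simp [relSpeed]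
  obtain ⟨d, hd, hdsub⟩ := mem_nhdsGT_iff_exists_Ioc_subset.1
    ((hB.eventually (lt_mem_nhds hB1)).and (Ioo_mem_nhdsGT hc.T_pos))
  have hd0 : 0 < d := hd
  have hdT : d < T := (hdsub ⟨hd0, le_rfl⟩).2.2
  have hmono := (hc.mono hd0 hdT.le).strictMonoOn hε fun t ht _ => (hdsub ⟨ht.1, ht.2.le⟩).1
  have hspos : ∀ᶠ t in 𝓝[>] 0, 0 < s t := by
    filter_upwards [Ioo_mem_nhdsGT hd0] with t ht
    have := hmono ⟨le_rfl, hd0⟩ ⟨ht.1.le, ht.2⟩ ht.1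
    rwa [h0] at this
  have hin : Tendsto (fun t => -ε * (s t * (pressureOfVolume P (restVolume ε ρ₁ s v t) -
      P (ρ₁ + ε * t)) - ε * ((ρ₁ + ε * t) * relSpeed ε (s t) (v t) * v t))) (𝓝[>] 0)
      (𝓝 (-ε * (0 * (pressureOfVolume P (restVolume ε ρ₁ s v 0) - P (ρ₁ + ε * 0)) -
        ε * ((ρ₁ + ε * 0) * relSpeed ε 0 (v 0) * v 0)))) :=
    ((hs0.mul (hpr0.sub hP0)).sub (((hρ0.mul hq0).mul hv0).const_mul ε)).const_mul (-ε)
  have hin1 : 0 < -ε * (0 * (pressureOfVolume P (restVolume ε ρ₁ s v 0) - P (ρ₁ + ε * 0)) -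
        ε * ((ρ₁ + ε * 0) * relSpeed ε 0 (v 0) * v 0)) := by
    have h1 := hc.ρ_pos 0 h0mem
    have h2 := hc.v_pos 0 h0mem
    have h3 : relSpeed ε 0 (v 0) = 1 := by simp [relSpeed]
    have : -ε * (0 * (pressureOfVolume P (restVolume ε ρ₁ s v 0) - P (ρ₁ + ε * 0)) -
        ε * ((ρ₁ + ε * 0) * relSpeed ε 0 (v 0) * v 0)) =
        (ε * ε) * ((ρ₁ + ε * 0) * relSpeed ε 0 (v 0) * v 0) := by ring
    rw [this, hεε, h3]; positivity
  filter_upwards [hspos, hin.eventually (lt_mem_nhds hin1), Ioo_mem_nhdsGT hc.T_pos]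
    with t h1 h2 h3
  refine ⟨h1, ?_⟩
  rw [hc.rayleigh_restVolume ⟨h3.1.le, h3.2⟩]
  calc (0 : ℝ) < s t * _ := mul_pos h1 h2
    _ = _ := by ring

/-- As long as the Rayleigh line does not meet the graph at the rest state, `s` is positive. -/
lemma IsCurve.s_pos_of_untouched (hc : IsCurve P {α, β} ε ρ₁ T s v) {T' : ℝ} (hT' : T' ≤ T)
    (hinit : ∀ᶠ t in 𝓝[>] 0, 0 < s t)
    (hne : ∀ t ∈ Ioo 0 T', rayleighAlong P ε ρ₁ s v t (restVolume ε ρ₁ s v t) ≠ 0) :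
    ∀ t ∈ Ioo 0 T', 0 < s t := by
  have hs0 : ∀ t ∈ Ioo 0 T', s t ≠ 0 := fun t ht hs => hne t ht (by
    rw [hc.rayleigh_restVolume ⟨ht.1.le, ht.2.trans_le hT'⟩, hs, zero_mul])
  intro t ht
  by_contra hcon
  obtain ⟨r, hr, hr2⟩ := (hinit.and (Ioo_mem_nhdsGT ht.1)).exists
  obtain ⟨x, hx, hx0⟩ := intermediate_value_Icc' hr2.2.le (hc.cont_s.mono fun y hy =>
    ⟨hr2.1.le.trans hy.1, hy.2.trans_lt (ht.2.trans_le hT')⟩)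
    (⟨not_lt.1 hcon, hr.le⟩ : (0 : ℝ) ∈ Icc (s t) (s r))
  exact hs0 x ⟨hr2.1.trans_le hx.1, hx.2.trans_lt ht.2⟩ hx0

/-- A supersonic curve followed by a shock onto another intersection of the Rayleigh line with the
graph, and by a profile from there on. -/
lemma IsCurve.shock_followedBy (hc : IsCurve P {α, β} ε ρ₁ T s v) (h : PressureShape P α β)
    (hε : ε = 1 ∨ ε = -1) (hgap : IsSupersonic P {α, β} ε ρ₁ T s v) (h0 : 0 ≤ s 0) {s' v' θ : ℝ}
    (hs : Tendsto s (𝓝[<] T) (𝓝 s')) (hv : Tendsto v (𝓝[<] T) (𝓝 v')) (hs' : 0 < s')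
    (hρ : 0 < ρ₁ + ε * T) (hq : 0 < relSpeed ε s' v') (hθ : 0 < θ)
    (hθε : 0 < -ε * (θ - (ρ₁ + ε * T)⁻¹))
    (hr : rayleigh P s' (relSpeed ε s' v') (ρ₁ + ε * T) θ = 0)
    (hL : ∀ ϑ, min θ (ρ₁ + ε * T)⁻¹ < ϑ → ϑ < max θ (ρ₁ + ε * T)⁻¹ →
      0 ≤ -ε * rayleigh P s' (relSpeed ε s' v') (ρ₁ + ε * T) ϑ) {n : ℕ}
    (h₂ : IsSolvableFrom P ε s' ((1 - relSpeed ε s' v' * (ρ₁ + ε * T) * θ) / s') θ⁻¹ n) :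
    IsSolvableFrom P ε (s 0) (-ε * v 0) ρ₁ (n + 1) := by
  set τ := (ρ₁ + ε * T)⁻¹ with hτ
  have hτ0 : 0 < τ := inv_pos.2 hρ
  have hτi : ρ₁ + ε * T = τ⁻¹ := by rw [hτ, inv_inv]
  refine (hc.followedBy h hε hgap h0 hs hv h₂).2
    (isAdmissibleForwardShock_of_rayleigh hs' hρ (by unfold relSpeed; ring) hq hθ ?_ hr ?_) ?_
  · intro heq
    rw [← hτ] at heq
    rw [heq] at hθε; simp at hθε
  · rw [← hτ]
    intro ϑ h1 h2
    have h3 := hL ϑ h1 h2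
    rcases hε with rfl | rfl
    · have h4 : θ < τ := by linarith
      rw [max_eq_right h4.le] at h2
      exact mul_nonneg_of_nonpos_of_nonpos (by linarith) (by linarith)
    · have h4 : τ < θ := by linarith
      rw [min_eq_right h4.le] at h1
      exact mul_nonneg (by linarith) (by linarith)
  · rw [hτi]
    rcases hε with rfl | rfl
    · have h4 : θ < τ := by linarith
      have := (inv_lt_inv₀ hτ0 hθ).2 h4
      linarith
    · have h4 : τ < θ := by linarith
      have := (inv_lt_inv₀ hθ hτ0).2 h4
      linarith

end curve

/-! ### Expansion of dense gas -/

section curve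

variable {P : ℝ → ℝ} {α β ε ρ₁ T : ℝ} {s v : ℝ → ℝ}

lemma PressureShape.tendsto_rayleighAlong (h : PressureShape P α β) {s' v' : ℝ}
    (hs : Tendsto s (𝓝[<] T) (𝓝 s')) (hv : Tendsto v (𝓝[<] T) (𝓝 v')) (hρ : 0 < ρ₁ + ε * T)
    (θ : ℝ) : Tendsto (fun t => rayleighAlong P ε ρ₁ s v t θ) (𝓝[<] T)
      (𝓝 (rayleigh P s' (relSpeed ε s' v') (ρ₁ + ε * T) θ)) := by
  have h1 := tendsto_density ε ρ₁ T
  have h2 : Tendsto (fun t => P (ρ₁ + ε * t)) (𝓝[<] T) (𝓝 (P (ρ₁ + ε * T))) :=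
    ((h.cont.continuousAt (Ici_mem_nhds hρ)).tendsto).comp h1
  exact ((hs.pow 2).mul (h2.const_sub _)).add
    ((((tendsto_relSpeed hs hv).mul h1).pow 2).mul ((h1.inv₀ hρ.ne').const_sub _))

lemma IsCurve.gap_pos_of_dense (hc : IsCurve P {α, β} (-1) ρ₁ T s v) (h : PressureShape P α β)
    (h0 : s 0 = 0) {t : ℝ} (ht : t ∈ Ioo 0 T) (hβ : β < ρ₁ + -1 * t) :
    0 < sonicGap (deriv P (ρ₁ + -1 * t)) (-1) (s t) (v t) := by
  have hε : (-1 : ℝ) = 1 ∨ (-1 : ℝ) = -1 := Or.inr rfl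
  obtain ⟨c, hlim⟩ := h.tendsto_deriv_along hε (ρ₁ := ρ₁) (t₀ := 0) (hc.ρ_pos 0 ⟨le_rfl, hc.T_pos⟩)
  refine hc.gap_pos_of_convexity h hε (min_le_left T (ρ₁ - β)) hlim ?_ (fun r hr => ?_) t
    ⟨ht.1, lt_min ht.2 (by linarith)⟩
  · rw [h0, zero_pow two_ne_zero, zero_mul]; positivity
  · have hr1 : r < T := hr.2.trans_le (min_le_left _ _)
    have hr2 : β < ρ₁ + -1 * r := by linarith [hr.2.trans_le (min_le_right T (ρ₁ - β))]
    refine ⟨h.notMem_of_gt hr2, ?_⟩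
    have := h.deriv2_pos _ (hc.ρ_pos r ⟨hr.1.le, hr1⟩) (Or.inr hr2)
    linarith

lemma IsCurve.relSpeed_lt_one (hc : IsCurve P {α, β} (-1) ρ₁ T s v) {t : ℝ} (ht : t ∈ Ico 0 T)
    (hs : 0 < s t) : relSpeed (-1) (s t) (v t) < 1 := by
  have := mul_pos (hc.v_pos t ht) hs
  unfold relSpeed; linarith

lemma IsCurve.inv_lt_restVolume (hc : IsCurve P {α, β} (-1) ρ₁ T s v) {t : ℝ} (ht : t ∈ Ico 0 T)
    (hs : 0 < s t) : (ρ₁ + -1 * t)⁻¹ < restVolume (-1) ρ₁ s v t := by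
  have h1 := hc.ρ_pos t ht
  have h2 := hc.q_pos t ht
  have h3 := hc.relSpeed_lt_one ht hs
  refine (inv_lt_inv₀ h1 (mul_pos h2 h1)).2 ?_
  nlinarith

/-- As long as the Rayleigh line stays below the graph of the pressure on the part that is relevant
for shocks, the expansion is supersonic. -/
lemma IsCurve.isSupersonic_of_untouched (hc : IsCurve P {α, β} (-1) ρ₁ T s v)
    (h : PressureShape P α β) (h0 : s 0 = 0) (hD : ∀ t ∈ Ico 0 T, α < ρ₁ + -1 * t)
    (hs : ∀ t ∈ Ioo 0 T, 0 < s t)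
    (hk : ∀ t ∈ Ioo 0 T, ∀ θ ∈ Icc (min α⁻¹ (restVolume (-1) ρ₁ s v t)) (restVolume (-1) ρ₁ s v t),
      0 < rayleighAlong P (-1) ρ₁ s v t θ) : IsSupersonic P {α, β} (-1) ρ₁ T s v := by
  intro t ht hb
  rcases lt_or_ge β (ρ₁ + -1 * t) with hβ | hβ
  · exact hc.gap_pos_of_dense h h0 ht hβ
  have ht' : t ∈ Ico 0 T := Ioo_subset_Ico_self ht
  have hρ := hc.ρ_pos t ht'
  have hα := hD t ht'
  have h1 : (ρ₁ + -1 * t)⁻¹ < α⁻¹ := (inv_lt_inv₀ hρ h.α_pos).2 hα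
  have h2 := hc.inv_lt_restVolume ht' (hs t ht)
  have h3 : (ρ₁ + -1 * t)⁻¹ < min α⁻¹ (restVolume (-1) ρ₁ s v t) := lt_min h1 h2
  have h4 : β⁻¹ ≤ (ρ₁ + -1 * t)⁻¹ := (inv_le_inv₀ h.β_pos hρ).2 hβ
  have h5 := hk t ht _ ⟨le_rfl, min_le_right _ _⟩
  have h6 := h.rayleigh_le (s := s t) (q := relSpeed (-1) (s t) (v t)) h.concave_middle hρ hb
    ⟨h4, h1.le⟩ ⟨h4.trans h3.le, min_le_left α⁻¹ (restVolume (-1) ρ₁ s v t)⟩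
  exact pos_of_mul_pos_right (h5.trans_le h6) (by have := sub_pos.2 h3; positivity)

end curve

lemma ConcaveOn.nonneg_of_mem_Icc {D : Set ℝ} {f : ℝ → ℝ} (hf : ConcaveOn ℝ D f) {x y z : ℝ}
    (hx : x ∈ D) (hy : y ∈ D) (hz : z ∈ Icc x y) (h1 : 0 ≤ f x) (h2 : 0 ≤ f y) : 0 ≤ f z :=
  (le_min h1 h2).trans (hf.min_le_of_mem_Icc hx hy hz)

/-- Gas that moves outwards expands with at most one shock, and without a shock if its
density is at most `α`. The shock starts when the Rayleigh line, which cuts through the graph of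
the pressure at the current state, first touches the graph further on. -/
theorem PressureShape.isSolvableFrom_expansion {P : ℝ → ℝ} {α β ρ₁ v₁ : ℝ}
    (h : PressureShape P α β) (hA : Tendsto (deriv P) (𝓝[>] 0) (𝓝 0)) (hρ : 0 < ρ₁)
    (hv₁ : 0 < v₁) : IsSolvableFrom P (-1) 0 v₁ ρ₁ 0 ∨
      (α < ρ₁ ∧ IsSolvableFrom P (-1) 0 v₁ ρ₁ 1) := by
  have hε : (-1 : ℝ) = 1 ∨ (-1 : ℝ) = -1 := Or.inr rfl
  have hq₁ : 0 < relSpeed (-1) 0 v₁ := by simp [relSpeed]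
  rcases le_or_gt ρ₁ α with hρα | hρα
  · obtain ⟨c, hc, -⟩ := h.left_limit ρ₁ hρ
    refine Or.inl (h.isSolvableFrom_dilute hA hρ hρα le_rfl hv₁ hq₁ hc ?_)
    rw [zero_pow two_ne_zero, zero_mul]; positivity
  obtain ⟨s, v, hs0, hv0, hcurve⟩ := h.exists_maximal_curve hε (isOpen_Ioi (a := α))
    (Ioi_subset_Ioi h.α_pos.le) hρα hv₁ hq₁
  have hTle : ∀ T, 0 < T → (∀ t ∈ Ico 0 T, ρ₁ + -1 * t ∈ Ioi α) → T ≤ ρ₁ - α := fun T hT hc => by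
    by_contra hcon
    have := hc (ρ₁ - α) ⟨by linarith, not_le.1 hcon⟩
    simp at this
  rcases hcurve with ⟨T, hc, hD, hmax⟩ | hglob
  swap
  · have := hTle _ (by linarith) (hglob (ρ₁ + 1) (by linarith)).2
    linarith [h.α_pos]
  have hT := hTle T hc.T_pos hD
  have hres : ∀ {n}, IsSolvableFrom P (-1) (s 0) (- -1 * v 0) ρ₁ n →
      IsSolvableFrom P (-1) 0 v₁ ρ₁ n := fun {n} hn => by
    rw [hs0, hv0] at hn; simpa using hn
  have h0mem : (0 : ℝ) ∈ Ico 0 T := ⟨le_rfl, hc.T_pos⟩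
  have hle0 : 𝓝[>] (0 : ℝ) ≤ 𝓝[Ico 0 T] 0 := by
    rw [nhdsWithin_le_iff]
    filter_upwards [Ioo_mem_nhdsGT hc.T_pos] with t ht using ⟨ht.1.le, ht.2⟩
  have hinit := hc.eventually_initial h hε hs0
  have hinit' : ∀ᶠ t in 𝓝[>] 0, ∀ θ ∈ Icc (min α⁻¹ (restVolume (-1) ρ₁ s v t))
      (restVolume (-1) ρ₁ s v t), 0 < rayleighAlong P (-1) ρ₁ s v t θ := by
    have h1 : restVolume (-1) ρ₁ s v 0 < α⁻¹ := by
      unfold restVolume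
      rw [hs0, mul_zero, add_zero]
      simp only [relSpeed, mul_zero, add_zero, one_mul]
      exact (inv_lt_inv₀ hρ h.α_pos).2 hρα
    filter_upwards [hinit, ((hc.continuousOn_restVolume 0 h0mem).tendsto.mono_left hle0).eventually
      (gt_mem_nhds h1)] with t h2 h3 θ hθ
    rw [min_eq_right h3.le] at hθ
    rw [← le_antisymm hθ.1 hθ.2]
    linarith [h2.2]
  rcases exists_first_touch (continuousOn_const.inf hc.continuousOn_restVolume)
    hc.continuousOn_restVolume
    (fun t ht => lt_min (inv_pos.2 h.α_pos) (hc.restVolume_pos ht)) (fun t _ => min_le_right _ _)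
    (hc.continuousOn_rayleighAlong h) hinit' with hun | ⟨t₁, ht₁, hun, htouch, θ, hθ, hθ0⟩
  · -- no shock at densities above `α`
    left
    have hspos := hc.s_pos_of_untouched le_rfl (hinit.mono fun t ht => ht.1)
      fun t ht => (hun t ht _ ⟨min_le_right _ _, le_rfl⟩).ne'
    have hgap := hc.isSupersonic_of_untouched h hs0 hD hspos hun
    have hs0' : 0 ≤ s 0 := hs0.ge
    have hmono := hc.strictMonoOn hε hgap
    have hanti := hc.antitoneOn h hε (hc.nonneg_s hε hgap hs0')
    obtain ⟨v', hv', hv'0, hv'le⟩ := exists_tendsto_of_antitoneOn hc.T_pos hanti hc.v_pos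
    have hρT : 0 < ρ₁ + -1 * T := by linarith [h.α_pos]
    obtain ⟨s', hs', hle⟩ := hc.tendsto_s_finite_of_expansion h hgap hs0' (by linarith)
    have hs'pos : 0 < s' := by
      have hm := hc.T_pos
      exact (hspos (T / 2) ⟨by linarith, by linarith⟩).trans_le
        (hle (T / 2) ⟨by linarith, by linarith⟩)
    rcases hv'0.eq_or_lt with hv0' | hv0'
    · exact hres ((hc.followedBy h hε hgap hs0' hs' hv'
        (isSolvableFrom_rest P (-1) hs'pos.le hρT)).1 (by rw [← hv0']; simp) rfl)
    have hqlim := tendsto_relSpeed (ε := -1) hs' hv'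
    set q' := relSpeed (-1) s' v' with hq'
    have hq'0 : 0 ≤ q' := by
      refine ge_of_tendsto hqlim ?_
      filter_upwards [hc.eventually_mem] with t ht
      exact (hc.q_pos t (Ioo_subset_Ico_self ht)).le
    have hqρ := hqlim.mul (tendsto_density (-1) ρ₁ T)
    have hq'pos : 0 < q' := by
      refine hq'0.lt_of_ne' fun hz => ?_
      -- otherwise the Rayleigh line becomes horizontal, but the pressure decreases beyond `α⁻¹`
      set θ := α⁻¹ + 1 with hθ
      have hαi : 0 < α⁻¹ := inv_pos.2 h.α_pos
      have hθ0 : 0 < θ := by linarith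
      have h1 := h.tendsto_rayleighAlong hs' hv' hρT θ
      rw [← hq', hz] at h1
      rw [hz, zero_mul] at hqρ
      have h2 : 0 ≤ rayleigh P s' 0 (ρ₁ + -1 * T) θ := by
        refine ge_of_tendsto h1 ?_
        filter_upwards [hc.eventually_mem, hqρ.eventually (gt_mem_nhds (inv_pos.2 hθ0))]
          with t ht1 ht2
        have h3 : θ < restVolume (-1) ρ₁ s v t :=
          (lt_inv_comm₀ (mul_pos (hc.q_pos t (Ioo_subset_Ico_self ht1))
            (hc.ρ_pos t (Ioo_subset_Ico_self ht1))) hθ0).1 ht2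
        exact (hun t ht1 θ ⟨(min_le_left _ _).trans (by linarith), h3.le⟩).le
      have h4 : θ⁻¹ < α := (inv_lt_comm₀ hθ0 h.α_pos).2 (by linarith)
      have h5 : P θ⁻¹ < P α := h.strictMonoOn_dilute ⟨inv_pos.2 hθ0, h4.le⟩ ⟨h.α_pos, le_rfl⟩ h4
      have h6 : P α ≤ P (ρ₁ + -1 * T) := h.monotoneOn h.α_pos hρT (by linarith)
      unfold rayleigh pressureOfVolume at h2
      have h7 : s' ^ 2 * (P θ⁻¹ - P (ρ₁ + -1 * T)) < 0 :=
        mul_neg_of_pos_of_neg (by positivity) (by linarith)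
      linarith
    have hTα : ρ₁ + -1 * T = α := by
      by_contra hne
      have := hmax s' v' hs' hv' (lt_of_le_of_ne (by linarith) (Ne.symm hne)) hv0'
      linarith
    obtain ⟨c, hclim, -⟩ := h.left_limit α h.α_pos
    have hq'1 : q' < 1 := by
      have := mul_pos hv0' hs'pos
      rw [hq']; unfold relSpeed; linarith
    have hson : s' ^ 2 * c ≤ q' ^ 2 := by
      refine h.sonic_le_of_dilute (θ := (q' * α)⁻¹) h.α_pos le_rfl hclim ?_ ?_
      · have := h.α_pos
        exact (inv_lt_inv₀ h.α_pos (by positivity)).2 (by nlinarith)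
      · intro ϑ hϑ
        have hϑ0 : 0 < ϑ := (inv_pos.2 h.α_pos).trans hϑ.1
        have h1 := h.tendsto_rayleighAlong hs' hv' hρT ϑ
        rw [hTα] at h1 hqρ
        refine ge_of_tendsto h1 ?_
        have h2 : q' * α < ϑ⁻¹ := (lt_inv_comm₀ hϑ0 (mul_pos hq'pos h.α_pos)).1 hϑ.2
        filter_upwards [hc.eventually_mem, hqρ.eventually (gt_mem_nhds h2)] with t ht1 ht2
        have h3 : ϑ < restVolume (-1) ρ₁ s v t :=
          (lt_inv_comm₀ (mul_pos (hc.q_pos t (Ioo_subset_Ico_self ht1))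
            (hc.ρ_pos t (Ioo_subset_Ico_self ht1))) hϑ0).1 ht2
        exact (hun t ht1 ϑ ⟨(min_le_left _ _).trans hϑ.1.le, h3.le⟩).le
    exact hres ((hc.followedBy h hε hgap hs0' hs' hv' (h.isSolvableFrom_dilute hA h.α_pos le_rfl
      hs'pos.le hv0' hq'pos hclim hson)).1 (by ring) hTα)
  · -- the Rayleigh line touches the graph at `θ`
    right
    refine ⟨hρα, ?_⟩
    have ht₁' : t₁ ∈ Ico 0 T := Ioo_subset_Ico_self ht₁
    have hc₁ := hc.mono ht₁.1 ht₁.2.le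
    have hspos := hc.s_pos_of_untouched ht₁.2.le (hinit.mono fun t ht => ht.1)
      fun t ht => (hun t ht _ ⟨min_le_right _ _, le_rfl⟩).ne'
    have hgap := hc₁.isSupersonic_of_untouched h hs0 (fun t ht => hD t ⟨ht.1, ht.2.trans ht₁.2⟩)
      hspos hun
    have hs' : Tendsto s (𝓝[<] t₁) (𝓝 (s t₁)) :=
      ((hc.cont_s t₁ ht₁').continuousAt (Ico_mem_nhds ht₁.1 ht₁.2)).tendsto.mono_left
        nhdsWithin_le_nhds
    have hv' : Tendsto v (𝓝[<] t₁) (𝓝 (v t₁)) :=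
      ((hc.cont_v t₁ ht₁').continuousAt (Ico_mem_nhds ht₁.1 ht₁.2)).tendsto.mono_left
        nhdsWithin_le_nhds
    have hs₁ : 0 < s t₁ := by
      have hm := ht₁.1
      refine (hspos (t₁ / 2) ⟨by linarith, by linarith⟩).trans_le (ge_of_tendsto hs' ?_)
      filter_upwards [Ioo_mem_nhdsLT (show t₁ / 2 < t₁ by linarith)] with t ht
      exact ((hc₁.strictMonoOn hε hgap) ⟨by linarith, by linarith⟩ ⟨by linarith [ht.1], ht.2⟩
        ht.1).le
    have hρ' := hc.ρ_pos t₁ ht₁'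
    have hα' : α < ρ₁ + -1 * t₁ := hD t₁ ht₁'
    have hq := hc.q_pos t₁ ht₁'
    have hrv := hc.inv_lt_restVolume ht₁' hs₁
    have hgapβ : β < ρ₁ + -1 * t₁ → _ := hc.gap_pos_of_dense h hs0 ht₁
    have hrv_eq : restVolume (-1) ρ₁ s v t₁ =
      (relSpeed (-1) (s t₁) (v t₁) * (ρ₁ + -1 * t₁))⁻¹ := rfl
    unfold rayleighAlong at htouch hθ0
    set θr := restVolume (-1) ρ₁ s v t₁ with hθr
    set q := relSpeed (-1) (s t₁) (v t₁) with hqdef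
    set ρ := ρ₁ + -1 * t₁ with hρdef
    have hlo : ρ⁻¹ < min α⁻¹ θr := lt_min ((inv_lt_inv₀ hρ' h.α_pos).2 hα') hrv
    have hρθ : ρ⁻¹ < θ := hlo.trans_le hθ.1
    have hρi : 0 < ρ⁻¹ := inv_pos.2 hρ'
    have hθpos : 0 < θ := hρi.trans hρθ
    have hqρ0 : 0 < q * ρ := mul_pos hq hρ'
    have hu : q * ρ * θ ≤ 1 := by
      have := mul_le_mul_of_nonneg_left hθ.2 hqρ0.le
      rwa [hrv_eq, mul_inv_cancel₀ hqρ0.ne'] at this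
    have hL : ∀ ϑ, min θ ρ⁻¹ < ϑ → ϑ < max θ ρ⁻¹ →
        0 ≤ - -1 * rayleigh P (s t₁) q ρ ϑ := by
      intro ϑ h1 h2
      rw [min_eq_right hρθ.le] at h1
      rw [max_eq_left hρθ.le] at h2
      rw [neg_neg, one_mul]
      rcases le_or_gt (min α⁻¹ θr) ϑ with h3 | h3
      · exact htouch ϑ ⟨h3, h2.le.trans hθ.2⟩
      have h4 := htouch _ ⟨le_rfl, min_le_right α⁻¹ θr⟩
      have hconc := concaveOn_rayleigh h.concave_middle (s t₁) q ρ
      rcases le_or_gt ρ β with hβ | hβ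
      · have h5 : β⁻¹ ≤ ρ⁻¹ := (inv_le_inv₀ h.β_pos hρ').2 hβ
        exact hconc.nonneg_of_mem_Icc ⟨h5, (hlo.trans_le (min_le_left _ _)).le⟩
          ⟨h5.trans hlo.le, min_le_left _ _⟩ ⟨h1.le, h3.le⟩ (rayleigh_self _ _ _ _).ge h4
      · have h5 : ρ⁻¹ < β⁻¹ := (inv_lt_inv₀ hρ' h.β_pos).2 hβ
        have h6 : ∀ x ∈ Icc ρ⁻¹ β⁻¹, 0 ≤ rayleigh P (s t₁) q ρ x := fun x hx => by
          refine le_trans (mul_nonneg (mul_nonneg (sq_nonneg _) (by linarith [hx.1]))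
            (hgapβ hβ).le) (h.le_rayleigh h.convex_dense hρ' (h.notMem_of_gt hβ) ⟨hρi, h5.le⟩
              ⟨hρi.trans_le hx.1, hx.2⟩)
        rcases le_or_gt ϑ β⁻¹ with h7 | h7
        · exact h6 ϑ ⟨h1.le, h7⟩
        · exact hconc.nonneg_of_mem_Icc ⟨le_rfl, (inv_le_inv₀ h.β_pos h.α_pos).2 h.le⟩
            ⟨(h7.trans h3).le, min_le_left _ _⟩ ⟨h7.le, h3.le⟩ (h6 _ ⟨h5.le, le_rfl⟩) h4
    have hsh := fun {n} => hc₁.shock_followedBy (n := n) h hε hgap hs0.ge hs' hv' hs₁ hρ' hq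
      hθpos (by rw [neg_neg, one_mul]; linarith) hθ0 hL
    rcases hu.eq_or_lt with hu1 | hu1
    · refine hres (hsh ?_)
      rw [← hqdef, ← hρdef, hu1, sub_self, zero_div]
      exact isSolvableFrom_rest P (-1) hs₁.le (inv_pos.2 hθpos)
    · have hθlt : θ < θr := by
        rw [hrv_eq]
        exact (lt_inv_comm₀ hθpos hqρ0).2 (by rw [← one_div, lt_div_iff₀ hθpos]; exact hu1)
      have hαθ : α⁻¹ ≤ θ := by
        rcases min_le_iff.1 hθ.1 with h1 | h1
        · exact h1
        · linarith
      obtain ⟨c, hclim, -⟩ := h.left_limit θ⁻¹ (inv_pos.2 hθpos)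
      have hq₂ : relSpeed (-1) (s t₁) ((1 - q * ρ * θ) / s t₁) = q * ρ * θ := by
        unfold relSpeed; field_simp; ring
      have hθα : θ⁻¹ ≤ α := (inv_le_comm₀ hθpos h.α_pos).2 hαθ
      refine hres (hsh (h.isSolvableFrom_dilute hA (inv_pos.2 hθpos) hθα hs₁.le
        (div_pos (by linarith) hs₁) (by rw [hq₂]; positivity) hclim ?_))
      rw [hq₂]
      refine h.sonic_le_of_dilute (inv_pos.2 hθpos) hθα hclim (θ := θr) (by rwa [inv_inv]) ?_
      intro ϑ hϑ
      rw [inv_inv] at hϑ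
      rw [rayleigh_shift P hθpos hθ0 rfl]
      exact htouch ϑ ⟨hθ.1.trans hϑ.1.le, hϑ.2.le⟩

/-! ### Compression -/

/-- The pressure is unbounded if its derivative is bounded below at large densities. -/
lemma tendsto_pressure_atTop {P : ℝ → ℝ} {α β κ : ℝ} (h : PressureShape P α β) (hκ : 0 < κ)
    (hd : ∀ᶠ ρ in atTop, κ ≤ deriv P ρ) : Tendsto P atTop atTop := by
  obtain ⟨M, hM⟩ := eventually_atTop.1 (hd.and (eventually_gt_atTop β))
  have hβ := h.β_pos
  have hM0 : 0 < M := hβ.trans (hM M le_rfl).2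
  have hlin : Tendsto (fun x => P M + κ * (x - M)) atTop atTop :=
    tendsto_atTop_add_const_left _ _ (Tendsto.const_mul_atTop hκ
      (tendsto_atTop_add_const_right _ _ tendsto_id))
  refine tendsto_atTop_mono' _ ?_ hlin
  filter_upwards [eventually_ge_atTop M] with x hx
  have := (convex_Ici M).mul_sub_le_image_sub_of_le_deriv (f := P) (C := κ)
    (h.cont.mono fun y hy => hM0.le.trans hy) (fun y hy => ?_) (fun y hy => ?_) M
    (mem_Ici.2 le_rfl) x hx hx
  · linarith
  · have h1 := interior_subset hy
    exact (h.hasDerivAt (hM0.trans_le h1)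
      (h.notMem_of_gt (hM y h1).2)).differentiableAt.differentiableWithinAt
  · exact (hM y (interior_subset hy)).1

/-- A nonnegative function cannot decrease forever at a rate of at least `κ / t`. -/
lemma false_of_log_decay {f f' : ℝ → ℝ} {t₀ κ ρ₁ : ℝ} (hρ : 0 < ρ₁ + t₀) (hκ : 0 < κ)
    (hd : ∀ t > t₀, HasDerivAt f (f' t) t ∧ f' t ≤ -(κ / (ρ₁ + t)))
    (hb : ∀ t > t₀, 0 ≤ f t) : False := by
  set g : ℝ → ℝ := fun t => f t + κ * Real.log (ρ₁ + t) with hg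
  have hdg : ∀ t > t₀, HasDerivAt g (f' t + κ * (1 / (ρ₁ + t))) t := fun t ht => by
    have h1 : HasDerivAt (fun t => ρ₁ + t) 1 t := (hasDerivAt_id t).const_add ρ₁
    exact (hd t ht).1.add ((h1.log (by linarith)).const_mul κ)
  have hanti : AntitoneOn g (Ioi t₀) := by
    refine antitoneOn_of_deriv_nonpos (convex_Ioi _)
      (fun t ht => (hdg t ht).continuousAt.continuousWithinAt)
      (fun t ht => (hdg t (interior_subset ht)).differentiableAt.differentiableWithinAt) ?_
    intro t ht
    have ht := interior_subset ht
    rw [(hdg t ht).deriv]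
    have h1 := (hd t ht).2
    have h2 : κ * (1 / (ρ₁ + t)) = κ / (ρ₁ + t) := by ring
    linarith
  have hlim : Tendsto (fun t => κ * Real.log (ρ₁ + t)) atTop atTop :=
    Tendsto.const_mul_atTop hκ
      (Real.tendsto_log_atTop.comp (tendsto_atTop_add_const_left _ _ tendsto_id))
  obtain ⟨t, h1, h2⟩ := ((hlim.eventually_gt_atTop (g (t₀ + 1))).and
    (eventually_gt_atTop (t₀ + 1))).exists
  have h3 := hanti (show t₀ + 1 ∈ Ioi t₀ by simp) (show t ∈ Ioi t₀ by simp; linarith) h2.le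
  have h4 := hb t (by linarith)
  have h5 : g t = f t + κ * Real.log (ρ₁ + t) := rfl
  linarith

section curve

variable {P : ℝ → ℝ} {α β ε ρ₁ T : ℝ} {s v : ℝ → ℝ}

lemma one_le_relSpeed {s v : ℝ} (hs : 0 ≤ s) (hv : 0 ≤ v) : 1 ≤ relSpeed 1 s v := by
  have := mul_nonneg hv hs
  unfold relSpeed; linarith

lemma one_lt_relSpeed {s v : ℝ} (hs : 0 < s) (hv : 0 < v) : 1 < relSpeed 1 s v := by
  have := mul_pos hv hs
  unfold relSpeed; linarith

lemma inv_mul_lt_inv {q ρ : ℝ} (hq : 1 < q) (hρ : 0 < ρ) : (q * ρ)⁻¹ < ρ⁻¹ :=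
  (inv_lt_inv₀ (by positivity) hρ).2 (by nlinarith)

lemma IsCurve.s_pos_of_tendsto (hc : IsCurve P {α, β} ε ρ₁ T s v) (hε : ε = 1 ∨ ε = -1)
    (hgap : IsSupersonic P {α, β} ε ρ₁ T s v) (h0 : 0 ≤ s 0) {s' : ℝ}
    (hs : Tendsto s (𝓝[<] T) (𝓝 s')) : 0 < s' := by
  have hm := hc.T_pos
  have hmono := hc.strictMonoOn hε hgap
  have h1 : s 0 < s (T / 2) := hmono ⟨le_rfl, hm⟩ ⟨by linarith, by linarith⟩ (by linarith)
  refine (h0.trans_lt h1).trans_le (ge_of_tendsto hs ?_)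
  filter_upwards [Ioo_mem_nhdsLT (show T / 2 < T by linarith)] with t ht
  exact (hmono ⟨by linarith, by linarith⟩ ⟨by linarith [ht.1], ht.2⟩ ht.1).le

lemma tendsto_left_of_continuousOn {f : ℝ → ℝ} (hf : ContinuousOn f (Ico 0 T)) {t : ℝ}
    (ht : t ∈ Ioo 0 T) : Tendsto f (𝓝[<] t) (𝓝 (f t)) :=
  ((hf t (Ioo_subset_Ico_self ht)).continuousAt (Ico_mem_nhds ht.1 ht.2)).tendsto.mono_left
    nhdsWithin_le_nhds

lemma IsCurve.eventually_notMem (hc : IsCurve P {α, β} ε ρ₁ T s v) (hε : ε = 1 ∨ ε = -1) :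
    ∀ᶠ t in 𝓝[<] T, t ∈ Ioo 0 T ∧ ρ₁ + ε * t ∉ ({α, β} : Set ℝ) := by
  have := ((finite_preimage_bad α β hε ρ₁).sdiff (t := {T})).isClosed.isOpen_compl.mem_nhds
    (show T ∈ (_ \ {T})ᶜ by simp)
  filter_upwards [hc.eventually_mem, nhdsWithin_le_nhds this, self_mem_nhdsWithin]
    with t ht0 ht ht2
  exact ⟨ht0, fun hb => ht ⟨hb, ne_of_lt ht2⟩⟩

/-- A compressing supersonic curve along which the Rayleigh line stays above the graph at the rest
state stops at a finite value of `s`: otherwise the pressure at the rest state would remain bounded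
while its density grows without bound. -/
lemma IsCurve.tendsto_s_finite_of_compression (hc : IsCurve P {α, β} 1 ρ₁ T s v)
    (h : PressureShape P α β) (hP : Tendsto P atTop atTop)
    (hgap : IsSupersonic P {α, β} 1 ρ₁ T s v) (h0 : 0 ≤ s 0)
    (hun : ∀ t ∈ Ioo 0 T, rayleighAlong P 1 ρ₁ s v t (restVolume 1 ρ₁ s v t) < 0) :
    ∃ s', Tendsto s (𝓝[<] T) (𝓝 s') ∧ ∀ t ∈ Ico 0 T, s t ≤ s' := by
  have hε : (1 : ℝ) = 1 ∨ (1 : ℝ) = -1 := Or.inl rfl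
  have hs := hc.nonneg_s hε hgap h0
  have hanti := hc.antitoneOn h hε hs
  have hρ₁ : 0 < ρ₁ := by simpa using hc.ρ_pos 0 ⟨le_rfl, hc.T_pos⟩
  have hρT : 0 < ρ₁ + 1 * T := by linarith [hc.T_pos]
  rcases exists_tendsto_of_monotoneOn hc.T_pos (hc.strictMonoOn hε hgap).monotoneOn with hl | hl
  · exact hl
  exfalso
  obtain ⟨v', hv', hv'0, hv'le⟩ := exists_tendsto_of_antitoneOn hc.T_pos hanti hc.v_pos
  have hρ : Tendsto (fun t => ρ₁ + 1 * t) (𝓝[<] T) (𝓝[<] (ρ₁ + 1 * T)) := by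
    refine tendsto_nhdsWithin_iff.2 ⟨tendsto_density _ _ _, ?_⟩
    filter_upwards [self_mem_nhdsWithin] with t ht
    simp only [mem_Iio] at *; linarith
  obtain ⟨c, hc1, hc2⟩ := h.left_limit (ρ₁ + 1 * T) hρT
  have hinv : Tendsto (fun t => (s t)⁻¹ + v t) (𝓝[<] T) (𝓝 v') := by
    have := (tendsto_inv_atTop_zero.comp hl).add hv'
    rwa [zero_add] at this
  have hv'pos : 0 < v' := by
    rcases hc2 with hc2 | hc2
    · -- the supersonic condition bounds `v` from below
      refine hv'0.lt_of_ne' fun hz => ?_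
      rw [hz] at hinv
      have h1 := le_of_tendsto_of_tendsto (hc1.comp hρ) (hinv.pow 2) (by
        filter_upwards [hc.eventually_notMem hε, hl.eventually_gt_atTop 0] with t ht hst
        have h2 := hgap t ht.1 ht.2
        unfold sonicGap relSpeed at h2
        have h3 : ((s t)⁻¹ + v t) ^ 2 * s t ^ 2 = (1 + 1 * v t * s t) ^ 2 := by field_simp
        have h4 : deriv P (ρ₁ + 1 * t) * s t ^ 2 ≤ ((s t)⁻¹ + v t) ^ 2 * s t ^ 2 := by
          rw [h3]; linarith
        exact le_of_mul_le_mul_right h4 (by positivity))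
      linarith
    · -- the velocity is constant
      obtain ⟨a, ha, hsub⟩ := mem_nhdsLT_iff_exists_Ioo_subset.1
        ((hρ.eventually hc2).and (hc.eventually_notMem hε))
      obtain ⟨t₁, ht₁⟩ := exists_between (show a < T from ha)
      have ht₁' := (hsub ht₁).2.1
      have hconst : ∀ t ∈ Ioo t₁ T, v t = v t₁ := by
        intro t ht
        have hsub2 : Icc t₁ t ⊆ Ioo a T := fun r hr => ⟨ht₁.1.trans_le hr.1, hr.2.trans_lt ht.2⟩
        refine constant_of_has_deriv_right_zero (a := t₁) (b := t)
          (fun r hr => (hc.cont_v r (Ioo_subset_Ico_self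
            (hsub (hsub2 hr)).2.1)).mono_of_mem_nhdsWithin ?_)
          (fun r hr => ?_) t ⟨ht.1.le, le_rfl⟩
        · exact mem_nhdsWithin_of_mem_nhds
            (Ico_mem_nhds (hsub (hsub2 hr)).2.1.1 (hsub (hsub2 hr)).2.1.2)
        · have h3 := hsub (hsub2 ⟨hr.1, hr.2.le⟩)
          have h4 := hc.deriv_v r h3.2.1 h3.2.2
          have h5 : deriv P (ρ₁ + 1 * r) = 0 := h3.1
          rw [h5] at h4
          simpa using h4.hasDerivWithinAt
      have hv1 := hc.v_pos t₁ (Ioo_subset_Ico_self ht₁')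
      refine hv1.trans_le (ge_of_tendsto hv' ?_)
      filter_upwards [Ioo_mem_nhdsLT ht₁.2] with t ht
      exact (hconst t ht).ge
  have hq : Tendsto (fun t => relSpeed 1 (s t) (v t)) (𝓝[<] T) atTop := by
    have := (tendsto_const_nhds (x := (1 : ℝ))).add_atTop (hv'.pos_mul_atTop hv'pos hl)
    refine this.congr fun t => ?_
    unfold relSpeed; ring
  have hqρ := hq.atTop_mul_pos hρT (tendsto_density 1 ρ₁ T)
  have hbd := (((h.cont.continuousAt (Ici_mem_nhds hρT)).tendsto).comp
    (tendsto_density 1 ρ₁ T)).add (((tendsto_density 1 ρ₁ T).mul hv').mul hinv)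
  obtain ⟨t, h1, h2, h3, h4⟩ := (((hP.comp hqρ).eventually_gt_atTop
    (P (ρ₁ + 1 * T) + (ρ₁ + 1 * T) * v' * v' + 1)).and ((hbd.eventually (gt_mem_nhds
      (lt_add_one _))).and (hc.eventually_mem.and (hl.eventually_gt_atTop 0)))).exists
  have h5 := hun t h3
  rw [hc.rayleigh_restVolume (Ioo_subset_Ico_self h3)] at h5
  have h6 := (pos_iff_neg_of_mul_neg h5).1 h4
  simp only [pressureOfVolume, restVolume, inv_inv] at h6
  simp only [Function.comp_apply] at h1 h2
  have h7 : (ρ₁ + 1 * t) * relSpeed 1 (s t) (v t) * v t =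
    s t * ((ρ₁ + 1 * t) * v t * ((s t)⁻¹ + v t)) := by
    unfold relSpeed; field_simp
  rw [h7, one_mul (s t * _), ← mul_sub] at h6
  have h8 := (pos_iff_neg_of_mul_neg h6).1 h4
  linarith

/-- A compressing supersonic curve that ends in a state whose Rayleigh line meets the
graph at the rest state can be followed by a shock that brings the gas to rest. -/
lemma IsCurve.shock_to_rest (hc : IsCurve P {α, β} 1 ρ₁ T s v) (h : PressureShape P α β)
    (hgap : IsSupersonic P {α, β} 1 ρ₁ T s v) (h0 : 0 ≤ s 0) {s' v' : ℝ}
    (hs : Tendsto s (𝓝[<] T) (𝓝 s')) (hv : Tendsto v (𝓝[<] T) (𝓝 v')) (hv' : 0 < v')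
    (hr : rayleigh P s' (relSpeed 1 s' v') (ρ₁ + 1 * T) (relSpeed 1 s' v' * (ρ₁ + 1 * T))⁻¹ = 0)
    (hL : ∀ ϑ ∈ Ioo (relSpeed 1 s' v' * (ρ₁ + 1 * T))⁻¹ (ρ₁ + 1 * T)⁻¹,
      rayleigh P s' (relSpeed 1 s' v') (ρ₁ + 1 * T) ϑ ≤ 0) :
    IsSolvableFrom P 1 (s 0) (-v 0) ρ₁ 1 := by
  have hε : (1 : ℝ) = 1 ∨ (1 : ℝ) = -1 := Or.inl rfl
  have hρ₁ : 0 < ρ₁ := by simpa using hc.ρ_pos 0 ⟨le_rfl, hc.T_pos⟩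
  have hρT : 0 < ρ₁ + 1 * T := by linarith [hc.T_pos]
  have hs' := hc.s_pos_of_tendsto hε hgap h0 hs
  have hq := one_lt_relSpeed hs' hv'
  have hq0 : 0 < relSpeed 1 s' v' := by linarith
  have hlt := inv_mul_lt_inv hq hρT
  have hθ : 0 < (relSpeed 1 s' v' * (ρ₁ + 1 * T))⁻¹ := by positivity
  have := hc.shock_followedBy (n := 0) h hε hgap h0 hs hv hs' hρT hq0 hθ (by linarith) hr
    (fun ϑ h1 h2 => by
      rw [min_eq_left hlt.le] at h1
      rw [max_eq_right hlt.le] at h2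
      have := hL ϑ ⟨h1, h2⟩
      linarith)
    (by
      rw [mul_inv_cancel₀ (mul_pos hq0 hρT).ne', sub_self, zero_div]
      exact isSolvableFrom_rest P 1 hs'.le (inv_pos.2 hθ))
  simpa using this

/-- A compressing supersonic curve that ends with vanishing velocity at a finite value of `s`
cannot do so at a density above `β`: there the velocity vanishes at most linearly, so
that the supersonic gap would decrease to minus infinity. -/
lemma IsCurve.le_of_tendsto_zero (hc : IsCurve P {α, β} 1 ρ₁ T s v) (h : PressureShape P α β)
    (hgap : IsSupersonic P {α, β} 1 ρ₁ T s v) (h0 : 0 ≤ s 0) {s' : ℝ}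
    (hs : Tendsto s (𝓝[<] T) (𝓝 s')) (hv : Tendsto v (𝓝[<] T) (𝓝 0)) : ρ₁ + 1 * T ≤ β := by
  by_contra! hcon
  have hε : (1 : ℝ) = 1 ∨ (1 : ℝ) = -1 := Or.inl rfl
  have hρ₁ : 0 < ρ₁ := by simpa using hc.ρ_pos 0 ⟨le_rfl, hc.T_pos⟩
  have hρT : 0 < ρ₁ + 1 * T := by linarith [hc.T_pos]
  have hs' := hc.s_pos_of_tendsto hε hgap h0 hs
  have hnb := h.notMem_of_gt hcon
  have hρ := tendsto_density 1 ρ₁ T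
  have hcl : Tendsto (fun t => deriv P (ρ₁ + 1 * t)) (𝓝[<] T) (𝓝 (deriv P (ρ₁ + 1 * T))) :=
    (h.continuousAt_deriv hρT hnb).tendsto.comp hρ
  have hc2 : ContinuousAt (deriv (deriv P)) (ρ₁ + 1 * T) := by
    have := ((h.contDiffAt_deriv hρT hnb).fderiv_right (m := 0) (by norm_num)).clm_apply
      (contDiffAt_const (c := (1 : ℝ)))
    exact this.continuousAt
  have hE := (((hcl.const_mul 2).add (hρ.mul (hc2.tendsto.comp hρ))).mul (hs.pow 2)).div
    (hρ.pow 2) (by positivity)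
  have hEpos : 0 < (2 * deriv P (ρ₁ + 1 * T) + (ρ₁ + 1 * T) * deriv (deriv P) (ρ₁ + 1 * T)) *
      s' ^ 2 / (ρ₁ + 1 * T) ^ 2 := by
    have := h.deriv2_pos _ hρT (Or.inr hcon)
    positivity
  set E := (2 * deriv P (ρ₁ + 1 * T) + (ρ₁ + 1 * T) * deriv (deriv P) (ρ₁ + 1 * T)) *
      s' ^ 2 / (ρ₁ + 1 * T) ^ 2 with hEdef
  -- the rate at which the velocity decreases is bounded
  have hF := ((hcl.mul hs).div (hρ.mul (tendsto_relSpeed (ε := 1) hs hv))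
    (mul_pos hρT (by simp [relSpeed])).ne')
  set F := deriv P (ρ₁ + 1 * T) * s' / ((ρ₁ + 1 * T) * relSpeed 1 s' 0) with hFdef
  have hF0 : 0 ≤ F := by
    have := h.deriv_nonneg hρT hnb
    have : relSpeed 1 s' 0 = 1 := by simp [relSpeed]
    rw [hFdef, this]; positivity
  obtain ⟨a, ha, hsub⟩ := mem_nhdsLT_iff_exists_Ioo_subset.1
    ((hE.eventually (lt_mem_nhds (half_lt_self hEpos))).and
      ((hF.eventually (gt_mem_nhds (lt_add_one F))).and
        ((hρ.eventually (lt_mem_nhds hcon)).and hc.eventually_mem)))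
  have hvle : ∀ t ∈ Ioo a T, v t ≤ (F + 1) * (T - t) := by
    intro t ht
    have h1 : ∀ r ∈ Ioo t T, v t - v r ≤ (F + 1) * (r - t) := by
      intro r hr
      have hsub2 : Icc t r ⊆ Ioo a T := fun x hx => ⟨ht.1.trans_le hx.1, hx.2.trans_lt hr.2⟩
      have hd : ∀ x ∈ Icc t r, HasDerivAt v _ x := fun x hx =>
        hc.deriv_v x (hsub (hsub2 hx)).2.2.2 (h.notMem_of_gt (hsub (hsub2 hx)).2.2.1)
      have := (convex_Icc t r).mul_sub_le_image_sub_of_le_deriv (f := v) (C := -(F + 1))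
        (fun x hx => (hd x hx).continuousAt.continuousWithinAt)
        (fun x hx => (hd x (interior_subset hx)).differentiableAt.differentiableWithinAt)
        (fun x hx => ?_) t ⟨le_rfl, hr.1.le⟩ r ⟨hr.1.le, le_rfl⟩ hr.1.le
      · linarith
      · rw [(hd x (interior_subset hx)).deriv]
        have := (hsub (hsub2 (interior_subset hx))).2.1
        simp only [Pi.div_apply] at this
        linarith
    have h2 : Tendsto (fun r => (F + 1) * (r - t)) (𝓝[<] T) (𝓝 ((F + 1) * (T - t))) :=
      (Continuous.tendsto (by fun_prop) T).mono_left nhdsWithin_le_nhds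
    have h3 := le_of_tendsto_of_tendsto (hv.const_sub (v t)) h2 (by
      filter_upwards [Ioo_mem_nhdsLT ht.2] with r hr using h1 r hr)
    linarith
  refine false_of_log_growth (t₀ := a) (T := T) (κ := E / 2 / (F + 1)) (C := 0) ha (by positivity)
    (fun t ht => ⟨(hc.hasDerivAt_gap h hε (hsub ht).2.2.2
      (h.notMem_of_gt (hsub ht).2.2.1)).neg, ?_⟩) (fun t ht => ?_)
  · have ht' := Ioo_subset_Ico_self (hsub ht).2.2.2
    have h1 := (hsub ht).1
    simp only [Function.comp_apply] at h1
    have h2 := hc.v_pos t ht'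
    have h3 := hvle t ht
    have h4 := hc.ρ_pos t ht'
    have h5 : 0 < T - t := by linarith [ht.2]
    have h6 : -(-1 * (2 * deriv P (ρ₁ + 1 * t) + (ρ₁ + 1 * t) * deriv (deriv P) (ρ₁ + 1 * t)) *
        s t ^ 2 / ((ρ₁ + 1 * t) ^ 2 * v t)) =
        (2 * deriv P (ρ₁ + 1 * t) + (ρ₁ + 1 * t) * deriv (deriv P) (ρ₁ + 1 * t)) *
        s t ^ 2 / (ρ₁ + 1 * t) ^ 2 / v t := by field_simp
    simp only [Pi.div_apply] at h1
    rw [h6, div_div]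
    exact div_le_div₀ (by linarith) h1.le h2 h3
  · have ht' := (hsub ht).2.2.2
    have h1 := hgap t ht' (h.notMem_of_gt (hsub ht).2.2.1)
    have h2 := hc.v_pos t (Ioo_subset_Ico_self ht')
    have h3 := hc.ρ_pos t (Ioo_subset_Ico_self ht')
    have : 0 < sonicGap (deriv P (ρ₁ + 1 * t)) 1 (s t) (v t) / ((ρ₁ + 1 * t) * v t) := by
      positivity
    simp only [Pi.neg_apply]
    linarith

end curve

section curve

variable {P : ℝ → ℝ} {α β ε ρ₁ T : ℝ} {s v : ℝ → ℝ}

/-- The condition on the Rayleigh line under which gas of density `ρ` that moves inwards with speed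
`v` can be compressed smoothly from `s` on: the line lies above the graph of the pressure up to the
rest state. At `s = 0` the line is vertical and there is no condition. -/
def LineCondition (P : ℝ → ℝ) (s v ρ : ℝ) : Prop :=
  s = 0 ∨ (0 < s ∧ rayleigh P s (relSpeed 1 s v) ρ (relSpeed 1 s v * ρ)⁻¹ < 0 ∧
    ∀ ϑ ∈ Ioo (relSpeed 1 s v * ρ)⁻¹ ρ⁻¹, rayleigh P s (relSpeed 1 s v) ρ ϑ ≤ 0)

lemma LineCondition.nonneg {s v ρ : ℝ} (h : LineCondition P s v ρ) : 0 ≤ s := by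
  rcases h with h | h
  · exact h.ge
  · exact h.1.le

lemma IsCurve.gap_pos_of_middle (hc : IsCurve P {α, β} 1 ρ₁ T s v) (h : PressureShape P α β)
    (hα : α ≤ ρ₁) (hl : LineCondition P (s 0) (v 0) ρ₁) {t : ℝ} (ht : t ∈ Ioo 0 T)
    (hβ : ρ₁ + 1 * t < β) : 0 < sonicGap (deriv P (ρ₁ + 1 * t)) 1 (s t) (v t) := by
  have hε : (1 : ℝ) = 1 ∨ (1 : ℝ) = -1 := Or.inl rfl
  have hρ₁ : 0 < ρ₁ := h.α_pos.trans_le hα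
  have hq := hc.q_pos t (Ioo_subset_Ico_self ht)
  rcases h.middle with hm | hm
  · obtain ⟨c, hlim, -⟩ := h.right_limit ρ₁ hρ₁
    have hρ : Tendsto (fun t => ρ₁ + 1 * t) (𝓝[>] 0) (𝓝[>] ρ₁) := by
      refine tendsto_nhdsWithin_iff.2 ⟨?_, ?_⟩
      · have : Tendsto (fun t => ρ₁ + 1 * t) (𝓝 0) (𝓝 (ρ₁ + 1 * 0)) :=
          Continuous.tendsto (by fun_prop) 0
        rw [mul_zero, add_zero] at this
        exact this.mono_left nhdsWithin_le_nhds
      · filter_upwards [self_mem_nhdsWithin] with t ht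
        simp only [mem_Ioi] at *; linarith
    refine hc.gap_pos_of_convexity h hε (min_le_left T (β - ρ₁)) (hlim.comp hρ) ?_ (fun r hr => ?_) t
      ⟨ht.1, lt_min ht.2 (by linarith)⟩
    · rcases hl with hl | ⟨hl0, -, hl⟩
      · rw [hl, zero_pow two_ne_zero, zero_mul]; positivity
      · have h0 : (0 : ℝ) ∈ Ico 0 T := ⟨le_rfl, hc.T_pos⟩
        have hq1 := one_lt_relSpeed hl0 (hc.v_pos 0 h0)
        exact h.sonic_le_of_middle hα (by linarith [ht.1]) hlim (by positivity)
          (inv_mul_lt_inv hq1 hρ₁) hl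
    · have hr2 : ρ₁ + 1 * r ∈ Ioo α β :=
        ⟨by linarith [hr.1], by linarith [hr.2.trans_le (min_le_right T (β - ρ₁))]⟩
      refine ⟨notMem_of_mem_Ioo hr2, ?_⟩
      have := (hm _ hr2).2
      linarith
  · unfold sonicGap
    rw [hm _ ⟨by linarith [ht.1], hβ⟩, mul_zero, sub_zero]
    positivity

lemma IsCurve.isSupersonic_of_rest_untouched (hc : IsCurve P {α, β} 1 ρ₁ T s v)
    (h : PressureShape P α β) (hα : α ≤ ρ₁) (hl : LineCondition P (s 0) (v 0) ρ₁)
    (hs : ∀ t ∈ Ioo 0 T, 0 < s t)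
    (hk : ∀ t ∈ Ioo 0 T, rayleighAlong P 1 ρ₁ s v t (restVolume 1 ρ₁ s v t) < 0) :
    IsSupersonic P {α, β} 1 ρ₁ T s v := by
  intro t ht hb
  rcases lt_or_ge (ρ₁ + 1 * t) β with hβ | hβ
  · exact hc.gap_pos_of_middle h hα hl ht hβ
  have ht' : t ∈ Ico 0 T := Ioo_subset_Ico_self ht
  have hρ := hc.ρ_pos t ht'
  have h1 := inv_mul_lt_inv (one_lt_relSpeed (hs t ht) (hc.v_pos t ht')) hρ
  have h2 : (ρ₁ + 1 * t)⁻¹ ≤ β⁻¹ := (inv_le_inv₀ hρ h.β_pos).2 hβ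
  have h3 := hk t ht
  have h4 := h.le_rayleigh (s := s t) (q := relSpeed 1 (s t) (v t)) h.convex_dense hρ hb
    ⟨inv_pos.2 hρ, h2⟩ ⟨hc.restVolume_pos ht', h1.le.trans h2⟩
  have h5 : (ρ₁ + 1 * t) ^ 2 * (restVolume 1 ρ₁ s v t - (ρ₁ + 1 * t)⁻¹) < 0 :=
    mul_neg_of_pos_of_neg (by positivity) (sub_neg.2 h1)
  exact (neg_iff_pos_of_mul_neg (h4.trans_lt h3)).1 h5

lemma IsCurve.eventually_initial_compression (hc : IsCurve P {α, β} 1 ρ₁ T s v)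
    (h : PressureShape P α β) (hl : LineCondition P (s 0) (v 0) ρ₁) :
    ∀ᶠ t in 𝓝[>] 0, 0 < s t ∧ rayleighAlong P 1 ρ₁ s v t (restVolume 1 ρ₁ s v t) < 0 := by
  rcases hl with hl | ⟨hl0, hl, -⟩
  · refine (hc.eventually_initial h (Or.inl rfl) hl).mono fun t ht => ⟨ht.1, ?_⟩
    linarith [ht.2]
  · have h0 : (0 : ℝ) ∈ Ico 0 T := ⟨le_rfl, hc.T_pos⟩
    have hle0 : 𝓝[>] (0 : ℝ) ≤ 𝓝[Ico 0 T] 0 := by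
      rw [nhdsWithin_le_iff]
      filter_upwards [Ioo_mem_nhdsGT hc.T_pos] with t ht using ⟨ht.1.le, ht.2⟩
    have h1 : ContinuousOn (fun t => rayleighAlong P 1 ρ₁ s v t (restVolume 1 ρ₁ s v t))
        (Ico 0 T) :=
      (hc.continuousOn_rayleighAlong h).comp (continuousOn_id.prodMk hc.continuousOn_restVolume)
        fun t ht => ⟨ht, hc.restVolume_pos ht⟩
    refine (((hc.cont_s 0 h0).tendsto.mono_left hle0).eventually (lt_mem_nhds hl0)).and
      (((h1 0 h0).tendsto.mono_left hle0).eventually (gt_mem_nhds ?_))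
    unfold rayleighAlong restVolume
    simpa using hl

/-- A compressing curve that starts at a density of at least `α` either never has a Rayleigh line
that meets the graph at the rest state, or can be followed by a shock that brings the gas to
rest. -/
lemma IsCurve.untouched_or_shock (hc : IsCurve P {α, β} 1 ρ₁ T s v) (h : PressureShape P α β)
    (hα : α ≤ ρ₁) (hl : LineCondition P (s 0) (v 0) ρ₁) :
    (IsSupersonic P {α, β} 1 ρ₁ T s v ∧
      ∀ t ∈ Ioo 0 T, rayleighAlong P 1 ρ₁ s v t (restVolume 1 ρ₁ s v t) < 0) ∨
    IsSolvableFrom P 1 (s 0) (-v 0) ρ₁ 1 := by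
  have hinit := hc.eventually_initial_compression h hl
  have hspos : ∀ T' ≤ T, (∀ t ∈ Ioo 0 T', rayleighAlong P 1 ρ₁ s v t (restVolume 1 ρ₁ s v t) < 0) →
      ∀ t ∈ Ioo 0 T', 0 < s t := fun T' hT' hk =>
    hc.s_pos_of_untouched hT' (hinit.mono fun t ht => ht.1) fun t ht => (hk t ht).ne
  rcases exists_first_touch (k := fun t θ => -rayleighAlong P 1 ρ₁ s v t θ)
    hc.continuousOn_restVolume hc.continuousOn_restVolume
    (fun t ht => hc.restVolume_pos ht) (fun t _ => le_rfl)
    (hc.continuousOn_rayleighAlong h).neg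
    (hinit.mono fun t ht θ hθ => by
      rw [← le_antisymm hθ.1 hθ.2]; linarith [ht.2]) with hun | ⟨t₁, ht₁, hun, -, θ, hθ, hθ0⟩
  · left
    have hk : ∀ t ∈ Ioo 0 T, rayleighAlong P 1 ρ₁ s v t (restVolume 1 ρ₁ s v t) < 0 :=
      fun t ht => neg_pos.1 (hun t ht _ ⟨le_rfl, le_rfl⟩)
    exact ⟨hc.isSupersonic_of_rest_untouched h hα hl (hspos T le_rfl hk) hk, hk⟩
  · right
    have ht₁' : t₁ ∈ Ico 0 T := Ioo_subset_Ico_self ht₁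
    have hk : ∀ t ∈ Ioo 0 t₁, rayleighAlong P 1 ρ₁ s v t (restVolume 1 ρ₁ s v t) < 0 :=
      fun t ht => neg_pos.1 (hun t ht _ ⟨le_rfl, le_rfl⟩)
    have hc₁ := hc.mono ht₁.1 ht₁.2.le
    have hgap := hc₁.isSupersonic_of_rest_untouched h hα hl (hspos t₁ ht₁.2.le hk) hk
    rw [← le_antisymm hθ.1 hθ.2, neg_eq_zero] at hθ0
    have hs' := tendsto_left_of_continuousOn hc.cont_s ht₁
    have hv' := tendsto_left_of_continuousOn hc.cont_v ht₁
    have hs₁ := hc₁.s_pos_of_tendsto (Or.inl rfl) hgap hl.nonneg hs'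
    refine hc₁.shock_to_rest h hgap hl.nonneg hs' hv' (hc.v_pos t₁ ht₁') hθ0 fun ϑ hϑ => ?_
    have hρ := hc.ρ_pos t₁ ht₁'
    have hlt := inv_mul_lt_inv (one_lt_relSpeed hs₁ (hc.v_pos t₁ ht₁')) hρ
    have hgapβ := hc.gap_pos_of_middle h hα hl ht₁
    have hθpos := hc.restVolume_pos ht₁'
    unfold rayleighAlong at hθ0
    unfold restVolume at hθ0 hθpos
    have hαρ : α < ρ₁ + 1 * t₁ := by linarith [ht₁.1]
    set q := relSpeed 1 (s t₁) (v t₁)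
    set ρ := ρ₁ + 1 * t₁
    have hconv := convexOn_rayleigh h.convex_dense (s t₁) q ρ
    rcases le_or_gt β ρ with hβ | hβ
    · have h1 : ρ⁻¹ ≤ β⁻¹ := (inv_le_inv₀ hρ h.β_pos).2 hβ
      exact (hconv.le_max_of_mem_Icc ⟨hθpos, hlt.le.trans h1⟩ ⟨inv_pos.2 hρ, h1⟩
        ⟨hϑ.1.le, hϑ.2.le⟩).trans (max_le hθ0.le (rayleigh_self _ _ _ _).le)
    · have h1 : β⁻¹ < ρ⁻¹ := (inv_lt_inv₀ h.β_pos hρ).2 hβ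
      have h2 : ρ⁻¹ ≤ α⁻¹ := (inv_le_inv₀ hρ h.α_pos).2 hαρ.le
      have h3 : ∀ x ∈ Icc β⁻¹ ρ⁻¹, rayleigh P (s t₁) q ρ x ≤ 0 := fun x hx =>
        (h.rayleigh_le h.concave_middle hρ (notMem_of_mem_Ioo ⟨hαρ, hβ⟩) ⟨h1.le, h2⟩
          ⟨hx.1, hx.2.trans h2⟩).trans (mul_nonpos_of_nonpos_of_nonneg
            (mul_nonpos_of_nonneg_of_nonpos (sq_nonneg _) (by linarith [hx.2])) (hgapβ hβ).le)
      rcases le_or_gt β⁻¹ ϑ with h4 | h4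
      · exact h3 ϑ ⟨h4, hϑ.2.le⟩
      · exact (hconv.le_max_of_mem_Icc ⟨hθpos, (hϑ.1.trans h4).le⟩ ⟨inv_pos.2 h.β_pos, le_rfl⟩
          ⟨hϑ.1.le, h4.le⟩).trans (max_le hθ0.le (h3 _ ⟨le_rfl, h1.le⟩))

end curve

/-- Gas of density at least `α` that moves inwards is brought to rest by a shock, or smoothly at a
density of at most `β`. -/
theorem PressureShape.isSolvableFrom_dense {P : ℝ → ℝ} {α β ρ₁ s₁ v₁ κ : ℝ}
    (h : PressureShape P α β) (hκ : 0 < κ) (hd : ∀ᶠ ρ in atTop, κ ≤ deriv P ρ)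
    (hα : α ≤ ρ₁) (hv₁ : 0 < v₁) (hl : LineCondition P s₁ v₁ ρ₁) :
    IsSolvableFrom P 1 s₁ (-v₁) ρ₁ 1 ∨ (ρ₁ < β ∧ IsSolvableFrom P 1 s₁ (-v₁) ρ₁ 0) := by
  have hε : (1 : ℝ) = 1 ∨ (1 : ℝ) = -1 := Or.inl rfl
  have hρ₁ : 0 < ρ₁ := h.α_pos.trans_le hα
  have hs₁ := hl.nonneg
  obtain ⟨s, v, hs0, hv0, hcurve⟩ := h.exists_maximal_curve hε (isOpen_Ioi (a := (0 : ℝ)))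
    Subset.rfl hρ₁ hv₁ (lt_of_lt_of_le one_pos (one_le_relSpeed hs₁ hv₁.le))
  have hres : ∀ {n}, IsSolvableFrom P 1 (s 0) (-v 0) ρ₁ n →
      IsSolvableFrom P 1 s₁ (-v₁) ρ₁ n := fun {n} hn => by rwa [hs0, hv0] at hn
  rw [← hs0, ← hv0] at hl
  have hs00 := hl.nonneg
  rcases hcurve with ⟨T, hc, -, hmax⟩ | hglob
  · rcases hc.untouched_or_shock h hα hl with ⟨hgap, hk⟩ | hshock
    swap
    · exact Or.inl (hres hshock)
    right
    have hanti := hc.antitoneOn h hε (hc.nonneg_s hε hgap hs00)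
    obtain ⟨v', hv', hv'0, -⟩ := exists_tendsto_of_antitoneOn hc.T_pos hanti hc.v_pos
    have hρT : 0 < ρ₁ + 1 * T := by linarith [hc.T_pos]
    obtain ⟨s', hs', -⟩ := hc.tendsto_s_finite_of_compression h (tendsto_pressure_atTop h hκ hd)
      hgap hs00 hk
    have hs'pos := hc.s_pos_of_tendsto hε hgap hs00 hs'
    rcases hv'0.eq_or_lt with hv0' | hv0'
    · rw [← hv0'] at hv'
      have := hc.le_of_tendsto_zero h hgap hs00 hs' hv'
      refine ⟨by linarith [hc.T_pos], hres ?_⟩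
      have h1 := (hc.followedBy h hε hgap hs00 hs' hv'
        (isSolvableFrom_rest P 1 hs'pos.le hρT)).1 (by simp) rfl
      simpa using h1
    · have h1 := hmax s' v' hs' hv' hρT hv0'
      have h2 := one_lt_relSpeed hs'pos hv0'
      linarith
  · left
    by_contra hcon
    -- otherwise the density grows forever, and the velocity decreases too fast to remain positive
    have hun : ∀ T > 0, IsSupersonic P {α, β} 1 ρ₁ T s v := fun T hT => by
      rcases (hglob T hT).1.untouched_or_shock h hα hl with h1 | h1
      · exact h1.1
      · exact absurd (hres h1) hcon
    obtain ⟨M, hM⟩ := eventually_atTop.1 (hd.and (eventually_gt_atTop β))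
    set σ := s 1 with hσ
    have hσ0 : 0 < σ := by
      have hc := (hglob 2 two_pos).1
      have := hc.strictMonoOn hε (hun 2 two_pos) ⟨le_rfl, two_pos⟩ ⟨zero_le_one, one_lt_two⟩
        one_pos
      linarith
    set t₀ := max 1 M with ht₀
    have ht₀1 : 1 ≤ t₀ := le_max_left _ _
    have ht₀M : M ≤ t₀ := le_max_right _ _
    refine false_of_log_decay (f := v) (t₀ := t₀) (ρ₁ := ρ₁) (κ := κ * (σ / (1 + v₁ * σ)))
      (by linarith) (by positivity)
      (f' := fun t => -(deriv P (ρ₁ + 1 * t) * s t / ((ρ₁ + 1 * t) * relSpeed 1 (s t) (v t))))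
      (fun t ht => ?_) fun t ht =>
        ((hglob (t + 1) (by linarith)).1.v_pos t ⟨by linarith, by linarith⟩).le
    have hT : 0 < t + 1 := by linarith
    have hc := (hglob (t + 1) hT).1
    have htm : t ∈ Ioo 0 (t + 1) := ⟨by linarith, by linarith⟩
    have htm' := Ioo_subset_Ico_self htm
    have h1 := hM (ρ₁ + 1 * t) (by linarith)
    refine ⟨hc.deriv_v t htm (h.notMem_of_gt h1.2), neg_le_neg ?_⟩
    have h2 : σ ≤ s t := ((hc.strictMonoOn hε (hun _ hT)) ⟨zero_le_one, by linarith⟩ htm'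
      (by linarith)).le
    have h3 : v t ≤ v₁ := hv0 ▸ hc.antitoneOn h hε (hc.nonneg_s hε (hun _ hT) hs00)
      ⟨le_rfl, hT⟩ htm' htm.1.le
    have h4 := hc.ρ_pos t htm'
    have h5 := hc.q_pos t htm'
    have h6 := hc.v_pos t htm'
    have h7 : σ / (1 + v₁ * σ) ≤ s t / relSpeed 1 (s t) (v t) := by
      rw [div_le_div_iff₀ (by positivity) h5]
      unfold relSpeed
      have h8 : 0 < s t := hσ0.trans_le h2
      have : v t * (σ * s t) ≤ v₁ * (σ * s t) := by gcongr
      nlinarith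
    calc κ * (σ / (1 + v₁ * σ)) / (ρ₁ + t)
        ≤ deriv P (ρ₁ + 1 * t) * (s t / relSpeed 1 (s t) (v t)) / (ρ₁ + 1 * t) := by
          have h8 : ρ₁ + t = ρ₁ + 1 * t := by ring
          have h9 : 0 ≤ deriv P (ρ₁ + 1 * t) := hκ.le.trans h1.1
          rw [h8]
          gcongr
          exact h1.1
      _ = _ := by field_simp

section curve

variable {P : ℝ → ℝ} {α β ε ρ₁ T : ℝ} {s v : ℝ → ℝ}

lemma IsCurve.isSupersonic_dilute_of_untouched (hc : IsCurve P {α, β} 1 ρ₁ T s v)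
    (h : PressureShape P α β) (hD : ∀ t ∈ Ico 0 T, ρ₁ + 1 * t < α) (hs : ∀ t ∈ Ioo 0 T, 0 < s t)
    (hk : ∀ t ∈ Ioo 0 T, ∀ θ ∈ Icc (restVolume 1 ρ₁ s v t) (max α⁻¹ (restVolume 1 ρ₁ s v t)),
      0 < -rayleighAlong P 1 ρ₁ s v t θ) : IsSupersonic P {α, β} 1 ρ₁ T s v := by
  intro t ht hb
  have ht' : t ∈ Ico 0 T := Ioo_subset_Ico_self ht
  have hρ := hc.ρ_pos t ht'
  have h1 : α⁻¹ < (ρ₁ + 1 * t)⁻¹ := (inv_lt_inv₀ h.α_pos hρ).2 (hD t ht')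
  have h2 := inv_mul_lt_inv (one_lt_relSpeed (hs t ht) (hc.v_pos t ht')) hρ
  have h3 : max α⁻¹ (restVolume 1 ρ₁ s v t) < (ρ₁ + 1 * t)⁻¹ := max_lt h1 h2
  have h4 := h.le_rayleigh (s := s t) (q := relSpeed 1 (s t) (v t)) h.convex_dilute hρ hb
    h1.le (le_max_left α⁻¹ (restVolume 1 ρ₁ s v t))
  have h5 := neg_pos.1 (hk t ht _ ⟨le_max_right _ _, le_rfl⟩)
  have h6 : (ρ₁ + 1 * t) ^ 2 * (max α⁻¹ (restVolume 1 ρ₁ s v t) - (ρ₁ + 1 * t)⁻¹) < 0 :=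
    mul_neg_of_pos_of_neg (by positivity) (sub_neg.2 h3)
  exact (neg_iff_pos_of_mul_neg (h4.trans_lt h5)).1 h6

end curve

/-- Gas that moves inwards is brought to rest with at most two shocks, and with exactly one if its
density is at least `β`. The first shock starts when the Rayleigh line touches the graph of the
pressure between the rest state and the volume `α⁻¹`. -/
theorem PressureShape.isSolvableFrom_compression {P : ℝ → ℝ} {α β ρ₁ v₁ κ : ℝ}
    (h : PressureShape P α β) (hκ : 0 < κ) (hd : ∀ᶠ ρ in atTop, κ ≤ deriv P ρ) (hρ : 0 < ρ₁)
    (hv₁ : 0 < v₁) : ∃ n ≤ 2, IsSolvableFrom P 1 0 (-v₁) ρ₁ n ∧ (β ≤ ρ₁ → n = 1) := by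
  have hε : (1 : ℝ) = 1 ∨ (1 : ℝ) = -1 := Or.inl rfl
  rcases le_or_gt α ρ₁ with hρα | hρα
  · rcases h.isSolvableFrom_dense hκ hd hρα hv₁ (Or.inl rfl) with h1 | ⟨h1, h2⟩
    · exact ⟨1, one_le_two, h1, fun _ => rfl⟩
    · exact ⟨0, zero_le_two, h2, fun h3 => absurd h1 (not_lt.2 h3)⟩
  suffices hmain : ∃ n ≤ 2, IsSolvableFrom P 1 0 (-v₁) ρ₁ n by
    obtain ⟨n, hn, hsol⟩ := hmain
    exact ⟨n, hn, hsol, fun h1 => absurd (h1.trans_lt hρα) (not_lt.2 h.le)⟩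
  obtain ⟨s, v, hs0, hv0, hcurve⟩ := h.exists_maximal_curve hε (isOpen_Ioo (a := 0) (b := α))
    (fun x hx => hx.1) ⟨hρ, hρα⟩ hv₁ (lt_of_lt_of_le one_pos (one_le_relSpeed le_rfl hv₁.le))
  have hTle : ∀ T, 0 < T → (∀ t ∈ Ico 0 T, ρ₁ + 1 * t ∈ Ioo 0 α) → T ≤ α - ρ₁ := fun T hT hc => by
    by_contra hcon
    have := (hc (α - ρ₁) ⟨by linarith, not_le.1 hcon⟩).2
    linarith
  rcases hcurve with ⟨T, hc, hD', hmax⟩ | hglob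
  swap
  · have := hTle α h.α_pos (hglob α h.α_pos).2
    linarith
  have hT := hTle T hc.T_pos hD'
  have hD : ∀ t ∈ Ico 0 T, ρ₁ + 1 * t < α := fun t ht => (hD' t ht).2
  have hres : ∀ {n}, IsSolvableFrom P 1 (s 0) (-v 0) ρ₁ n →
      IsSolvableFrom P 1 0 (-v₁) ρ₁ n := fun {n} hn => by rwa [hs0, hv0] at hn
  have hres' : ∀ {n}, IsSolvableFrom P 1 (s 0) (-1 * v 0) ρ₁ n →
      IsSolvableFrom P 1 0 (-v₁) ρ₁ n := fun {n} hn => by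
    rw [neg_one_mul] at hn; exact hres hn
  have h0mem : (0 : ℝ) ∈ Ico 0 T := ⟨le_rfl, hc.T_pos⟩
  have hle0 : 𝓝[>] (0 : ℝ) ≤ 𝓝[Ico 0 T] 0 := by
    rw [nhdsWithin_le_iff]
    filter_upwards [Ioo_mem_nhdsGT hc.T_pos] with t ht using ⟨ht.1.le, ht.2⟩
  have hinit := hc.eventually_initial_compression h (Or.inl hs0)
  have hinit' : ∀ᶠ t in 𝓝[>] 0, ∀ θ ∈ Icc (restVolume 1 ρ₁ s v t)
      (max α⁻¹ (restVolume 1 ρ₁ s v t)), 0 < -rayleighAlong P 1 ρ₁ s v t θ := by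
    have h1 : α⁻¹ < restVolume 1 ρ₁ s v 0 := by
      unfold restVolume
      rw [hs0, mul_zero, add_zero]
      simp only [relSpeed, mul_zero, add_zero, one_mul]
      exact (inv_lt_inv₀ h.α_pos hρ).2 hρα
    filter_upwards [hinit, ((hc.continuousOn_restVolume 0 h0mem).tendsto.mono_left hle0).eventually
      (lt_mem_nhds h1)] with t h2 h3 θ hθ
    rw [max_eq_right h3.le] at hθ
    rw [← le_antisymm hθ.1 hθ.2]
    linarith [h2.2]
  have hs00 : 0 ≤ s 0 := hs0.ge
  rcases exists_first_touch (k := fun t θ => -rayleighAlong P 1 ρ₁ s v t θ)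
    hc.continuousOn_restVolume (continuousOn_const.sup hc.continuousOn_restVolume)
    (fun t ht => hc.restVolume_pos ht) (fun t _ => le_max_right _ _)
    (hc.continuousOn_rayleighAlong h).neg hinit' with hun | ⟨t₁, ht₁, hun, htouch, θ, hθ, hθ0⟩
  · have hk : ∀ t ∈ Ioo 0 T, rayleighAlong P 1 ρ₁ s v t (restVolume 1 ρ₁ s v t) < 0 :=
      fun t ht => neg_pos.1 (hun t ht _ ⟨le_rfl, le_max_right _ _⟩)
    have hspos := hc.s_pos_of_untouched le_rfl (hinit.mono fun t ht => ht.1) fun t ht => (hk t ht).ne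
    have hgap := hc.isSupersonic_dilute_of_untouched h hD hspos hun
    have hanti := hc.antitoneOn h hε (hc.nonneg_s hε hgap hs00)
    obtain ⟨v', hv', hv'0, -⟩ := exists_tendsto_of_antitoneOn hc.T_pos hanti hc.v_pos
    have hρT : 0 < ρ₁ + 1 * T := by linarith [hc.T_pos]
    obtain ⟨s', hs', -⟩ := hc.tendsto_s_finite_of_compression h (tendsto_pressure_atTop h hκ hd)
      hgap hs00 hk
    have hs'pos := hc.s_pos_of_tendsto hε hgap hs00 hs'
    rcases hv'0.eq_or_lt with hv0' | hv0'
    · rw [← hv0'] at hv'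
      exact ⟨0, zero_le_two, hres' ((hc.followedBy h hε hgap hs00 hs' hv'
        (isSolvableFrom_rest P 1 hs'pos.le hρT)).1 (by simp) rfl)⟩
    have hq := one_lt_relSpeed hs'pos hv0'
    have hTα : ρ₁ + 1 * T = α := by
      by_contra hne
      have := hmax s' v' hs' hv' ⟨hρT, lt_of_le_of_ne (by linarith) hne⟩ hv0'
      linarith
    have hqρ := (tendsto_relSpeed (ε := 1) hs' hv').mul (tendsto_density 1 ρ₁ T)
    have hr := fun ϑ => h.tendsto_rayleighAlong hs' hv' hρT ϑ
    rw [hTα] at hqρ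
    simp only [hTα] at hr
    have hlt := inv_mul_lt_inv hq h.α_pos
    have hL : ∀ ϑ ∈ Ioo (relSpeed 1 s' v' * α)⁻¹ α⁻¹,
        rayleigh P s' (relSpeed 1 s' v') α ϑ ≤ 0 := fun ϑ hϑ => by
      have hq0 : 0 < relSpeed 1 s' v' * α := mul_pos (by linarith) h.α_pos
      have hϑ0 : 0 < ϑ := (inv_pos.2 hq0).trans hϑ.1
      refine le_of_tendsto (hr ϑ) ?_
      filter_upwards [hc.eventually_mem, hqρ.eventually (lt_mem_nhds
        ((inv_lt_comm₀ hq0 hϑ0).1 hϑ.1))] with t ht1 ht2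
      have h3 : restVolume 1 ρ₁ s v t < ϑ :=
        (inv_lt_comm₀ hϑ0 (mul_pos (hc.q_pos t (Ioo_subset_Ico_self ht1))
          (hc.ρ_pos t (Ioo_subset_Ico_self ht1)))).1 ht2
      exact (neg_pos.1 (hun t ht1 ϑ ⟨h3.le, hϑ.2.le.trans (le_max_left _ _)⟩)).le
    have hθ0 : 0 < (relSpeed 1 s' v' * α)⁻¹ :=
      inv_pos.2 (mul_pos (by linarith) h.α_pos)
    have hL' : rayleigh P s' (relSpeed 1 s' v') α (relSpeed 1 s' v' * α)⁻¹ ≤ 0 := by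
      have hcont : ContinuousAt (rayleigh P s' (relSpeed 1 s' v') α) (relSpeed 1 s' v' * α)⁻¹ := by
        have := h.continuousOn_volume.continuousAt (Ioi_mem_nhds hθ0)
        unfold rayleigh
        fun_prop
      refine le_of_tendsto (hcont.tendsto.mono_left (nhdsWithin_le_nhds (s := Ioi (relSpeed 1 s' v' * α)⁻¹))) ?_
      filter_upwards [Ioo_mem_nhdsGT hlt] with ϑ hϑ using hL ϑ hϑ
    rcases hL'.eq_or_lt with hz | hneg
    · exact ⟨1, one_le_two, hres (hc.shock_to_rest h hgap hs00 hs' hv' hv0' (by rw [hTα]; exact hz)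
        (by rw [hTα]; exact hL))⟩
    · have hkink := fun {n} => (hc.followedBy (ur := -v') (ρr := α) (n := n) h hε hgap hs00 hs' hv')
      rcases h.isSolvableFrom_dense hκ hd le_rfl hv0' (Or.inr ⟨hs'pos, hneg, hL⟩) with
        h1 | ⟨-, h1⟩
      · exact ⟨1, one_le_two, hres' ((hkink h1).1 (by ring) hTα)⟩
      · exact ⟨0, zero_le_two, hres' ((hkink h1).1 (by ring) hTα)⟩
  · have ht₁' : t₁ ∈ Ico 0 T := Ioo_subset_Ico_self ht₁
    have hk : ∀ t ∈ Ioo 0 t₁, rayleighAlong P 1 ρ₁ s v t (restVolume 1 ρ₁ s v t) < 0 :=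
      fun t ht => neg_pos.1 (hun t ht _ ⟨le_rfl, le_max_right _ _⟩)
    have hspos := hc.s_pos_of_untouched ht₁.2.le (hinit.mono fun t ht => ht.1)
      fun t ht => (hk t ht).ne
    have hc₁ := hc.mono ht₁.1 ht₁.2.le
    have hgap := hc₁.isSupersonic_dilute_of_untouched h
      (fun t ht => hD t ⟨ht.1, ht.2.trans ht₁.2⟩) hspos hun
    have hs' := tendsto_left_of_continuousOn hc.cont_s ht₁
    have hv' := tendsto_left_of_continuousOn hc.cont_v ht₁
    have hs₁ := hc₁.s_pos_of_tendsto hε hgap hs00 hs'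
    have hv₁' := hc.v_pos t₁ ht₁'
    have hq1 := one_lt_relSpeed hs₁ hv₁'
    have hρ' := hc.ρ_pos t₁ ht₁'
    have hα' := hD t₁ ht₁'
    have hlt := inv_mul_lt_inv hq1 hρ'
    have hrv := hc.restVolume_pos ht₁'
    have hsh := fun {θ n} => hc₁.shock_followedBy (θ := θ) (n := n) h hε hgap hs00 hs' hv' hs₁ hρ'
      (by linarith)
    have hrest := hc₁.shock_to_rest h hgap hs00 hs' hv' hv₁'
    unfold rayleighAlong restVolume at htouch
    unfold rayleighAlong at hθ0
    unfold restVolume at hθ hrv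
    set q := relSpeed 1 (s t₁) (v t₁) with hqdef
    set ρ := ρ₁ + 1 * t₁ with hρdef
    set θr := (q * ρ)⁻¹ with hθr
    have hbτ : α⁻¹ < ρ⁻¹ := (inv_lt_inv₀ h.α_pos hρ').2 hα'
    have hhi : max α⁻¹ θr < ρ⁻¹ := max_lt hbτ hlt
    have hle : ∀ ϑ ∈ Ioo θr ρ⁻¹, rayleigh P (s t₁) q ρ ϑ ≤ 0 := fun ϑ hϑ => by
      rcases le_or_gt ϑ (max α⁻¹ θr) with h1 | h1
      · exact neg_nonneg.1 (htouch ϑ ⟨hϑ.1.le, h1⟩)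
      · exact ((convexOn_rayleigh h.convex_dilute (s t₁) q ρ).le_max_of_mem_Icc
          (le_max_left α⁻¹ θr) hbτ.le ⟨h1.le, hϑ.2.le⟩).trans
          (max_le (neg_nonneg.1 (htouch _ ⟨le_max_right _ _, le_rfl⟩)) (rayleigh_self _ _ _ _).le)
    have hr0 := neg_nonneg.1 (htouch θr ⟨le_rfl, le_max_right _ _⟩)
    rcases hr0.eq_or_lt with hz | hneg
    · exact ⟨1, one_le_two, hres (hrest hz hle)⟩
    rw [neg_eq_zero] at hθ0
    have hθlt : θr < θ := hθ.1.lt_of_ne fun h1 => hneg.ne (by rw [h1]; exact hθ0)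
    have hθα : θ ≤ α⁻¹ := by
      rcases le_max_iff.1 hθ.2 with h1 | h1
      · exact h1
      · linarith
    have hθpos : 0 < θ := hrv.trans hθlt
    have hθτ : θ < ρ⁻¹ := hθα.trans_lt hbτ
    have hαθ : α ≤ θ⁻¹ := (le_inv_comm₀ hθpos h.α_pos).1 hθα
    have hqρ : 0 < q * ρ := mul_pos (by linarith) hρ'
    have hu : 1 < q * ρ * θ := by
      have := mul_lt_mul_of_pos_left hθlt hqρ
      rwa [hθr, mul_inv_cancel₀ hqρ.ne'] at this
    set v₂ := (q * ρ * θ - 1) / s t₁ with hv₂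
    have hv₂pos : 0 < v₂ := div_pos (by linarith) hs₁
    have hq₂ : relSpeed 1 (s t₁) v₂ = q * ρ * θ := by
      rw [hv₂]; unfold relSpeed; field_simp; ring
    have hline : LineCondition P (s t₁) v₂ θ⁻¹ := by
      refine Or.inr ⟨hs₁, ?_, ?_⟩
      · rw [hq₂, rayleigh_shift P hθpos hθ0 rfl, mul_inv_cancel_right₀ hθpos.ne']
        exact hneg
      · intro ϑ hϑ
        rw [hq₂, mul_inv_cancel_right₀ hθpos.ne', inv_inv] at hϑ
        rw [hq₂, rayleigh_shift P hθpos hθ0 rfl]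
        exact hle ϑ ⟨hϑ.1, hϑ.2.trans hθτ⟩
    have hfin : ∀ {n}, IsSolvableFrom P 1 (s t₁) (-v₂) θ⁻¹ n →
        IsSolvableFrom P 1 0 (-v₁) ρ₁ (n + 1) := fun {n} hn => by
      refine hres' (hsh hθpos (by linarith) hθ0 (fun ϑ h1 h2 => ?_) ?_)
      · rw [min_eq_left hθτ.le] at h1
        rw [max_eq_right hθτ.le] at h2
        have := hle ϑ ⟨hθlt.trans h1, h2⟩
        linarith
      · rwa [show (1 - q * ρ * θ) / s t₁ = -v₂ by rw [hv₂]; ring]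
    rcases h.isSolvableFrom_dense hκ hd hαθ hv₂pos hline with h1 | ⟨-, h1⟩
    · exact ⟨2, le_rfl, hfin h1⟩
    · exact ⟨1, one_le_two, hfin h1⟩

/-! ### The weak formulation -/

lemma integrable_mul_of_bounded {k χ : ℝ × ℝ → ℝ} {μ : Measure (ℝ × ℝ)} (hμ : μ ≤ volume)
    (hk : Measurable k) {C : ℝ} (hC : ∀ᵐ z ∂μ, |k z| ≤ C) (hχ : Continuous χ)
    (hs : HasCompactSupport χ) : Integrable (fun z => k z * χ z) μ :=
  ((hχ.integrable_of_hasCompactSupport hs).mono_measure hμ).bdd_mul hk.aestronglyMeasurable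
    (by simpa only [Real.norm_eq_abs] using hC)

/-- The weak form of a conservation law with a geometric source, `a_t + b_x + 2 c / x = 0`, for
functions of `s = t / x`. In the coordinates `(x, s)` the left-hand side, integrated against a test
function `ψ`, is the sum of the `s`-derivative of `(a - s b) ψ` and of the `x`-derivative of
`x b ψ`. -/
theorem integral_selfSimilar_eq_zero {a b c : ℝ → ℝ} (ha : Measurable a) (hb : Measurable b)
    (hc : Measurable c) {C : ℝ} (hC : ∀ s > 0, |a s| ≤ C ∧ |b s| ≤ C ∧ |c s| ≤ C)
    {F : Set ℝ} (hF : F.Countable) (hcont : ContinuousOn (fun s => a s - s * b s) (Ici 0))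
    (hder : ∀ s > 0, s ∉ F → HasDerivAt (fun s => a s - s * b s) (-(b s + 2 * c s)) s)
    {φ : ℝ × ℝ → ℝ} (hφ : ContDiff ℝ ∞ φ) (hφc : HasCompactSupport φ)
    (hφs : tsupport φ ⊆ {z : ℝ × ℝ | 0 < z.1}) :
    (∫ z : ℝ × ℝ in Ioi (0 : ℝ) ×ˢ Ioi (0 : ℝ), (a (z.2 / z.1) * fderiv ℝ φ z (0, 1)
      + b (z.2 / z.1) * fderiv ℝ φ z (1, 0) - 2 * c (z.2 / z.1) / z.1 * φ z))
      + ∫ x : ℝ in Ioi (0 : ℝ), a 0 * φ (x, 0) = 0 := by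
  -- the test function and its derivatives vanish outside a box
  obtain ⟨x₁, hx₁, hx₁'⟩ := hφc.isCompact.exists_forall_le' (f := Prod.fst)
    continuous_fst.continuousOn (a := (0 : ℝ)) fun z hz => hφs hz
  obtain ⟨r, hr⟩ := hφc.isCompact.isBounded.subset_closedBall (0 : ℝ × ℝ)
  have hbox : ∀ z ∈ tsupport φ, |z.1| ≤ r ∧ |z.2| ≤ r := fun z hz => by
    have := hr hz
    rw [mem_closedBall_zero_iff, Prod.norm_def] at this
    exact max_le_iff.1 this
  set L : ℝ := r / x₁ with hL
  set K : Set (ℝ × ℝ) := Icc x₁ r ×ˢ Icc (-L) L with hK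
  have hKc : IsCompact K := isCompact_Icc.prod isCompact_Icc
  have hKout : ∀ z : ℝ × ℝ, z ∉ K → (z.1, z.2 * z.1) ∉ tsupport φ := by
    intro z hz hmem
    have h1 := hx₁' _ hmem
    obtain ⟨h2, h3⟩ := hbox _ hmem
    simp only at h1 h2 h3
    have h4 : 0 < z.1 := hx₁.trans_le h1
    refine hz ⟨⟨h1, (le_abs_self _).trans h2⟩, abs_le.1 ?_⟩
    rw [abs_mul, abs_of_pos h4] at h3
    rw [hL, le_div_iff₀ hx₁]
    exact (mul_le_mul_of_nonneg_left h1 (abs_nonneg _)).trans h3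
  have hφ0 : ∀ z, z ∉ tsupport φ → φ z = 0 := fun z hz => image_eq_zero_of_notMem_tsupport hz
  have hdφ0 : ∀ z, z ∉ tsupport φ → fderiv ℝ φ z = 0 := fun z hz => by
    by_contra hne
    exact hz (support_fderiv_subset ℝ hne)
  have hφcont : Continuous φ := hφ.continuous
  have hdφ : Continuous (fderiv ℝ φ) := hφ.continuous_fderiv (by simp)
  have hdiff : ∀ z, HasFDerivAt φ (fderiv ℝ φ z) z := fun z =>
    (hφ.differentiable (by simp) z).hasFDerivAt
  set D₁ : ℝ × ℝ → ℝ := fun z => fderiv ℝ φ z (1, 0) with hD₁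
  set D₂ : ℝ × ℝ → ℝ := fun z => fderiv ℝ φ z (0, 1) with hD₂
  have hD₁c : Continuous D₁ := hdφ.clm_apply continuous_const
  have hD₂c : Continuous D₂ := hdφ.clm_apply continuous_const
  have hD₁0 : ∀ z, z ∉ tsupport φ → D₁ z = 0 := fun z hz => by simp [hD₁, hdφ0 z hz]
  have hD₂0 : ∀ z, z ∉ tsupport φ → D₂ z = 0 := fun z hz => by simp [hD₂, hdφ0 z hz]
  set w : ℝ × ℝ → ℝ × ℝ := fun z => (z.1, z.2 * z.1) with hw
  have hwc : Continuous w := by fun_prop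
  set μ : Measure ℝ := volume.restrict (Ioi 0) with hμ
  have hμμ : μ.prod μ = (volume : Measure (ℝ × ℝ)).restrict (Ioi 0 ×ˢ Ioi 0) := by
    rw [hμ, Measure.prod_restrict]; rfl
  have hμle : μ.prod μ ≤ volume := by rw [hμμ]; exact Measure.restrict_le_self
  have hae : ∀ᵐ z ∂(μ.prod μ), 0 < z.1 ∧ 0 < z.2 := by
    rw [hμμ]
    exact ae_restrict_of_forall_mem (measurableSet_Ioi.prod measurableSet_Ioi) fun z hz => hz
  have hcomp : ∀ {χ : ℝ × ℝ → ℝ}, (∀ z, (z.1, z.2 * z.1) ∉ tsupport φ → χ z = 0) →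
      HasCompactSupport χ := fun h => HasCompactSupport.intro hKc fun z hz => h z (hKout z hz)
  -- the two parts of the integrand in the coordinates `(x, s)`
  set H₁ : ℝ × ℝ → ℝ := fun z =>
    (a z.2 - z.2 * b z.2) * (z.1 * D₂ (w z)) - (b z.2 + 2 * c z.2) * φ (w z) with hH₁
  set H₂ : ℝ × ℝ → ℝ := fun z =>
    b z.2 * (φ (w z) + z.1 * (D₁ (w z) + z.2 * D₂ (w z))) with hH₂
  have hbd : ∀ {k : ℝ → ℝ}, (∀ s > 0, |k s| ≤ C) → ∀ᵐ z ∂(μ.prod μ), |k z.2| ≤ C := fun h =>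
    hae.mono fun z hz => h _ hz.2
  have hbd' : ∀ {k : ℝ → ℝ}, (∀ s > 0, |k s| ≤ C) → ∀ᵐ z ∂(μ.prod μ), |k (z.2 / z.1)| ≤ C :=
    fun h => hae.mono fun z hz => h _ (div_pos hz.2 hz.1)
  have hCa := fun s hs => (hC s hs).1
  have hCb := fun s hs => (hC s hs).2.1
  have hCc := fun s hs => (hC s hs).2.2
  have hmd : Measurable fun z : ℝ × ℝ => z.2 / z.1 := measurable_snd.div measurable_fst
  have hH₁i : Integrable H₁ (μ.prod μ) := by
    have e1 := integrable_mul_of_bounded hμle (ha.comp measurable_snd) (hbd hCa)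
      (χ := fun z => z.1 * D₂ (w z)) (by fun_prop)
      (hcomp fun z hz => by simp only [hw, hD₂0 _ hz, mul_zero])
    have e2 := integrable_mul_of_bounded hμle (hb.comp measurable_snd) (hbd hCb)
      (χ := fun z => z.2 * (z.1 * D₂ (w z)) + φ (w z)) (by fun_prop)
      (hcomp fun z hz => by simp only [hw, hD₂0 _ hz, hφ0 _ hz, mul_zero, add_zero])
    have e3 := integrable_mul_of_bounded hμle (hc.comp measurable_snd) (hbd hCc)
      (χ := fun z => 2 * φ (w z)) (by fun_prop)
      (hcomp fun z hz => by simp only [hw, hφ0 _ hz, mul_zero])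
    refine ((e1.sub e2).sub e3).congr (Eventually.of_forall fun z => ?_)
    simp only [hH₁, Pi.sub_apply, Function.comp_apply]; ring
  have hH₂i : Integrable H₂ (μ.prod μ) :=
    integrable_mul_of_bounded hμle (hb.comp measurable_snd) (hbd hCb) (by fun_prop)
      (hcomp fun z hz => by
        simp only [hw, hD₁0 _ hz, hD₂0 _ hz, hφ0 _ hz, mul_zero, add_zero])
  set G : ℝ × ℝ → ℝ := fun z => a (z.2 / z.1) * D₂ z + b (z.2 / z.1) * D₁ z -
    2 * c (z.2 / z.1) / z.1 * φ z with hG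
  have hGi : Integrable G (μ.prod μ) := by
    have e1 := integrable_mul_of_bounded hμle (ha.comp hmd) (hbd' hCa) hD₂c
      (HasCompactSupport.intro hφc.isCompact hD₂0)
    have e2 := integrable_mul_of_bounded hμle (hb.comp hmd) (hbd' hCb) hD₁c
      (HasCompactSupport.intro hφc.isCompact hD₁0)
    have e3 := integrable_mul_of_bounded hμle (hc.comp hmd) (hbd' hCc)
      (χ := fun z => 2 * φ z / z.1) (continuous_iff_continuousAt.2 fun z => by
        by_cases hz : z ∈ tsupport φ
        · exact (hφcont.continuousAt.const_mul 2).div continuousAt_fst (hφs hz).ne'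
        · refine continuousAt_const (y := (0 : ℝ)) |>.congr ?_
          filter_upwards [(isClosed_tsupport φ).isOpen_compl.mem_nhds hz] with y hy
          rw [hφ0 y hy]; simp) (HasCompactSupport.intro hφc.isCompact fun z hz => by
            simp only [hφ0 z hz, mul_zero, zero_div])
    refine ((e1.add e2).sub e3).congr (Eventually.of_forall fun z => ?_)
    simp only [hG, Pi.sub_apply, Pi.add_apply, Function.comp_apply]; ring
  have hchange : ∀ x ∈ Ioi (0 : ℝ), ∫ t, G (x, t) ∂μ = ∫ s, (H₁ + H₂) (x, s) ∂μ := by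
    intro x hx
    have hx0 : x ≠ 0 := ne_of_gt hx
    have h1 := integral_comp_mul_left_Ioi (fun t => G (x, t)) 0 (b := x) hx
    rw [mul_zero] at h1
    have h2 : ∫ t, G (x, t) ∂μ = x * ∫ s in Ioi 0, G (x, x * s) := by
      rw [h1, smul_eq_mul, mul_inv_cancel_left₀ hx0]
    rw [h2, ← integral_const_mul]
    refine integral_congr_ae (Eventually.of_forall fun s => ?_)
    simp only [hG, hH₁, hH₂, hw, Pi.add_apply, mul_comm x s]
    field_simp
    ring
  have hint₁ : ∀ x ∈ Ioi (0 : ℝ), ∫ s, H₁ (x, s) ∂μ = -(a 0 * φ (x, 0)) := by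
    intro x hx
    have hL1 : ∀ s, L < s → (x, s * x) ∉ tsupport φ := fun s hs =>
      hKout (x, s) fun hmem => not_lt.2 hmem.2.2 hs
    set L' := max L 0 + 1 with hL'
    have hL'0 : 0 ≤ L' := by positivity
    have hL'L : L < L' := by have := le_max_left L 0; linarith
    have h1 : ∫ s, H₁ (x, s) ∂μ = ∫ s in Ioc 0 L', H₁ (x, s) := by
      refine setIntegral_eq_of_subset_of_forall_sdiff_eq_zero measurableSet_Ioi
        (fun s hs => hs.1) fun s hs => ?_
      have h3 : L' < s := not_le.1 fun h4 => hs.2 ⟨hs.1, h4⟩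
      have h2 := hL1 s (hL'L.trans h3)
      simp only [hH₁, hw, hD₂0 _ h2, hφ0 _ h2, mul_zero, sub_zero]
    have hdψ : ∀ s, HasDerivAt (fun s => φ (x, s * x)) (x * D₂ (x, s * x)) s := fun s => by
      have h2 : HasDerivAt (fun s : ℝ => (x, s * x)) ((0 : ℝ), x) s := by
        simpa using (hasDerivAt_const s x).prodMk ((hasDerivAt_id s).mul_const x)
      have h3 := (hdiff (x, s * x)).comp_hasDerivAt s h2
      have h4 : ((0 : ℝ), x) = x • ((0 : ℝ), (1 : ℝ)) := by simp
      rw [h4, map_smul, smul_eq_mul] at h3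
      exact h3
    have hcψ : Continuous fun s => φ (x, s * x) :=
      continuous_iff_continuousAt.2 fun s => (hdψ s).continuousAt
    have hcx : Continuous fun s => x * D₂ (x, s * x) := by fun_prop
    have hbmi : ∀ {k : ℝ → ℝ} {χ : ℝ → ℝ}, Measurable k → (∀ s > 0, |k s| ≤ C) → Continuous χ →
        IntervalIntegrable (fun s => k s * χ s) volume 0 L' := fun {k χ} hk hkC hχ => by
      rw [intervalIntegrable_iff_integrableOn_Ioc_of_le hL'0]
      refine Integrable.bdd_mul (c := C) ((hχ.continuousOn.integrableOn_Icc (a := 0)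
        (b := L')).mono_set Ioc_subset_Icc_self) hk.aestronglyMeasurable ?_
      exact ae_restrict_of_forall_mem measurableSet_Ioc fun s hs => by
        simpa using hkC s hs.1
    have hd : ∀ s ∈ Ioo 0 L' \ F,
        HasDerivAt (fun s => (a s - s * b s) * φ (x, s * x)) (H₁ (x, s)) s := fun s hs => by
      refine ((hder s hs.1.1 hs.2).mul (hdψ s)).congr_deriv ?_
      simp only [hH₁, hw]; ring
    have hi : IntervalIntegrable (fun s => H₁ (x, s)) volume 0 L' := by
      refine (((hbmi ha hCa hcx).sub (hbmi hb hCb (χ := fun s =>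
        s * (x * D₂ (x, s * x)) + φ (x, s * x)) (by fun_prop))).sub
        (hbmi hc hCc (χ := fun s => 2 * φ (x, s * x)) (by fun_prop))).congr ?_
      intro s _
      simp only [hH₁, hw]; ring
    rw [h1, ← intervalIntegral.integral_of_le hL'0,
      integral_eq_of_hasDerivAt_off_countable_of_le _ _ hL'0 hF
        ((hcont.mono fun s hs => hs.1).mul hcψ.continuousOn) hd hi]
    simp only [Pi.mul_apply, hφ0 _ (hL1 L' hL'L)]
    simp
  have hint₂ : ∀ s, ∫ x, H₂ (x, s) ∂μ = 0 := by
    intro s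
    set f : ℝ → ℝ := fun x => x * φ (x, s * x) with hf
    have hfs : ContDiff ℝ 1 f := by
      have : ContDiff ℝ 1 φ := hφ.of_le (by simp)
      fun_prop
    have hfc : HasCompactSupport f := HasCompactSupport.intro (isCompact_Icc (a := x₁) (b := r))
      fun x hx => by
        simp only [hf]
        rw [hφ0 _ (hKout (x, s) fun hmem => hx hmem.1), mul_zero]
    have h1 := hfc.integral_Ioi_deriv_eq hfs 0
    have h2 : ∀ x, deriv f x = φ (x, s * x) + x * (D₁ (x, s * x) + s * D₂ (x, s * x)) := fun x => by
      have h3 : HasDerivAt (fun x : ℝ => (x, s * x)) ((1 : ℝ), s) x := by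
        simpa using (hasDerivAt_id x).prodMk ((hasDerivAt_id x).const_mul s)
      have h4 := (hdiff (x, s * x)).comp_hasDerivAt x h3
      have h5 : ((1 : ℝ), s) = (1, 0) + s • ((0 : ℝ), (1 : ℝ)) := by simp
      rw [h5, map_add, map_smul, smul_eq_mul] at h4
      have h6 := ((hasDerivAt_id x).mul h4).deriv
      rw [one_mul] at h6
      exact h6
    simp only [H₂, hw]
    rw [integral_const_mul]
    have h7 : ∫ x, (φ (x, s * x) + x * (D₁ (x, s * x) + s * D₂ (x, s * x))) ∂μ = 0 := by
      simp only [← h2]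
      rw [hμ, h1]; simp [hf]
    rw [h7, mul_zero]
  change (∫ z in Ioi (0 : ℝ) ×ˢ Ioi (0 : ℝ), G z) + _ = 0
  rw [← hμμ, integral_prod _ hGi, setIntegral_congr_fun measurableSet_Ioi hchange,
    ← integral_prod _ (hH₁i.add hH₂i), integral_add' hH₁i hH₂i, integral_prod _ hH₁i,
    setIntegral_congr_fun measurableSet_Ioi hint₁, integral_prod_symm _ hH₂i]
  simp only [hint₂, integral_zero]
  rw [integral_neg, add_zero]
  exact neg_add_cancel _

lemma measurable_indicator_of_continuousAt {f : ℝ → ℝ} {S : Finset ℝ}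
    (h : ∀ s > 0, s ∉ S → ContinuousAt f s) : Measurable ((Ici 0).indicator f) := by
  have hm : MeasurableSet (Ioi (0 : ℝ) \ S) := measurableSet_Ioi.diff S.measurableSet
  have h1 : Measurable ((Ioi (0 : ℝ) \ S).piecewise f 0) :=
    ContinuousOn.measurable_piecewise
      (fun s hs => (h s hs.1 hs.2).continuousWithinAt) continuousOn_const hm
  refine h1.measurable_of_countable_ne ((S.countable_toSet.insert 0).mono fun s hs => ?_)
  by_contra hcon
  simp only [mem_insert_iff, not_or] at hcon
  refine hs ?_
  rcases lt_or_gt_of_ne hcon.1 with h0 | h0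
  · have h2 : s ∉ Ioi (0 : ℝ) \ S := fun hmem => not_lt.2 h0.le hmem.1
    have h3 : s ∉ Ici (0 : ℝ) := fun hmem => not_lt.2 hmem h0
    simp [h2, h3]
  · have h2 : s ∈ Ioi (0 : ℝ) \ S := ⟨h0, hcon.2⟩
    have h3 : s ∈ Ici (0 : ℝ) := le_of_lt h0
    rw [piecewise_eq_of_mem _ _ _ h2, indicator_of_mem h3]

section profile

variable {P U R : ℝ → ℝ} {ε : ℝ} {S K : Finset ℝ}

lemma IsProfileOn.continuousAt {I : Set ℝ} (hp : IsProfileOn P ε U R I S K) {s : ℝ} (hs : s ∈ I)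
    (hS : s ∉ S) : ContinuousAt U s ∧ ContinuousAt R s := by
  by_cases hK : s ∈ K
  · exact (hp.kink s hK).2
  rcases hp.smooth s hs hS hK with ⟨h, -⟩ | h
  · exact ⟨h.deriv_u.continuousAt, h.deriv_ρ.continuousAt⟩
  · exact ⟨continuousAt_const.congr (h.mono fun r hr => hr.2.symm),
      continuousAt_const.congr (h.mono fun r hr => hr.1.symm)⟩

/-- The fluxes of mass and momentum across the rays `x = t / s` are continuous: this is what the
Rankine-Hugoniot conditions say at a shock. -/
lemma IsProfileOn.continuousAt_flux (hP : ContinuousOn P (Ici 0))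
    (hp : IsProfileOn P ε U R (Ioi 0) S K) {s : ℝ} (hs : 0 < s) :
    ContinuousAt (fun s => R s - s * (R s * U s)) s ∧
      ContinuousAt (fun s => R s * U s - s * (R s * U s ^ 2 + P (R s))) s := by
  by_cases hS : s ∈ S
  · obtain ⟨-, u₁, ρ₁, h, -⟩ := hp.shock s hS
    have hP1 := (hP.continuousAt (Ici_mem_nhds h.shock.pos₁)).tendsto.comp h.front_ρ
    have hP2 := (hP.continuousAt (Ici_mem_nhds h.shock.pos₂)).tendsto.comp h.back_ρ
    have hid1 : Tendsto (fun s : ℝ => s) (𝓝[<] s) (𝓝 s) := nhdsWithin_le_nhds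
    have hid2 : Tendsto (fun s : ℝ => s) (𝓝[>] s) (𝓝 s) := nhdsWithin_le_nhds
    obtain ⟨hr1, hr2⟩ := h.shock.rankineHugoniot
    field_simp at hr1 hr2
    constructor <;> refine continuousAt_iff_continuous_left'_right'.2 ⟨?_, ?_⟩
    · have := h.front_ρ.sub (hid1.mul (h.front_ρ.mul h.front_u))
      rwa [show ρ₁ - s * (ρ₁ * u₁) = R s - s * (R s * U s) by linarith] at this
    · exact h.back_ρ.sub (hid2.mul (h.back_ρ.mul h.back_u))
    · have := (h.front_ρ.mul h.front_u).sub
        (hid1.mul ((h.front_ρ.mul (h.front_u.pow 2)).add hP1))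
      rwa [show ρ₁ * u₁ - s * (ρ₁ * u₁ ^ 2 + P ρ₁) =
        R s * U s - s * (R s * U s ^ 2 + P (R s)) by linarith] at this
    · exact (h.back_ρ.mul h.back_u).sub
        (hid2.mul ((h.back_ρ.mul (h.back_u.pow 2)).add hP2))
  · obtain ⟨hU, hR⟩ := hp.continuousAt hs hS
    have hPR : ContinuousAt (fun s => P (R s)) s := by
      by_cases hK : s ∈ K ∨ 0 < R s
      · rcases hK with hK | hK
        · refine ContinuousWithinAt.tendsto (s := Ici 0) (hP (R s) (hp.nonneg s hs)) |>.comp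
            (tendsto_nhdsWithin_iff.2 ⟨hR, ?_⟩)
          filter_upwards [Ioi_mem_nhds hs] with r hr using hp.nonneg r hr
        · exact ContinuousAt.comp (g := P) (hP.continuousAt (Ici_mem_nhds hK)) hR
      · refine ContinuousWithinAt.tendsto (s := Ici 0) (hP (R s) (hp.nonneg s hs)) |>.comp
            (tendsto_nhdsWithin_iff.2 ⟨hR, ?_⟩)
        filter_upwards [Ioi_mem_nhds hs] with r hr using hp.nonneg r hr
    exact ⟨hR.sub (continuousAt_id.mul (hR.mul hU)),
      (hR.mul hU).sub (continuousAt_id.mul ((hR.mul (hU.pow 2)).add hPR))⟩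

lemma RegularAt.hasDerivAt_flux {s : ℝ} (h : RegularAt P U R s) :
    HasDerivAt (fun s => R s - s * (R s * U s)) (-(R s * U s + 2 * (R s * U s))) s ∧
      HasDerivAt (fun s => R s * U s - s * (R s * U s ^ 2 + P (R s)))
        (-(R s * U s ^ 2 + P (R s) + 2 * (R s * U s ^ 2))) s := by
  rcases h with ⟨h, hPR⟩ | h
  · have hne := h.ne
    have hU := h.deriv_u
    have hR := h.deriv_ρ
    generalize deriv P (R s) = c at *
    constructor
    · refine (hR.sub ((hasDerivAt_id s).mul (hR.mul hU))).congr_deriv ?_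
      simp only [Pi.mul_apply, id]
      field_simp
      ring
    · refine ((hR.mul hU).sub ((hasDerivAt_id s).mul
        ((hR.mul (hU.pow 2)).add hPR))).congr_deriv ?_
      simp only [Pi.mul_apply, Pi.add_apply, Pi.pow_apply, id]
      field_simp
      ring
  · have h0 : R s = 0 := h.self_of_nhds.1
    rw [h0]
    constructor
    · refine ((hasDerivAt_const s (0 : ℝ)).congr_of_eventuallyEq (h.mono fun r hr => ?_)).congr_deriv
        (by simp)
      simp only [hr.1]; ring
    · refine (((hasDerivAt_id s).mul_const (-P 0)).congr_of_eventuallyEq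
        (h.mono fun r hr => ?_)).congr_deriv (by simp)
      simp only [hr.1, id]; ring

/-- A self-similar profile defines a weak solution. -/
theorem IsProfileOn.isWeakSolution (hP : ContinuousOn P (Ici 0))
    (hp : IsProfileOn P ε U R (Ioi 0) S K) (hU₀ : ContinuousWithinAt U (Ici 0) 0)
    (hR₀ : ContinuousWithinAt R (Ici 0) 0) (hρ₀ : 0 ≤ R 0)
    (hend : Tendsto (fun s => R s * U s) atTop (𝓝 0)) :
    IsWeakSolution P (U 0) (R 0) (fun x t => U (t / x)) (fun x t => R (t / x)) := by
  obtain ⟨C, hC⟩ := hp.bounded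
  have hnonneg : ∀ s ≥ 0, 0 ≤ R s := fun s hs => by
    rcases hs.eq_or_lt with h | h
    · rwa [← h]
    · exact hp.nonneg s h
  obtain ⟨CP, hCP⟩ := isCompact_Icc.exists_bound_of_continuousOn
    (hP.mono (fun x hx => hx.1 : Icc 0 C ⊆ Ici 0))
  have hmd : Measurable fun z : ℝ × ℝ => z.2 / z.1 := measurable_snd.div measurable_fst
  -- measurable modifications on the irrelevant set `s < 0`
  set U' := (Ici (0 : ℝ)).indicator U with hU'
  set R' := (Ici (0 : ℝ)).indicator R with hR'
  set p' : ℝ → ℝ := fun s => P (max (R' s) 0) with hp'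
  have hU'm : Measurable U' :=
    measurable_indicator_of_continuousAt fun s hs hS => (hp.continuousAt hs hS).1
  have hR'm : Measurable R' :=
    measurable_indicator_of_continuousAt fun s hs hS => (hp.continuousAt hs hS).2
  have hp'm : Measurable p' := by
    have : Continuous fun r => P (max r 0) :=
      hP.comp_continuous (by fun_prop) fun r => mem_Ici.2 (le_max_right _ _)
    exact this.measurable.comp hR'm
  have hU'e : ∀ s ≥ 0, U' s = U s := fun s hs => indicator_of_mem hs U
  have hR'e : ∀ s ≥ 0, R' s = R s := fun s hs => indicator_of_mem hs R
  have hp'e : ∀ s ≥ 0, p' s = P (R s) := fun s hs => by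
    simp only [hp', hR'e s hs, max_eq_left (hnonneg s hs)]
  have hmQ : MeasurableSet (Ioi (0 : ℝ) ×ˢ Ioi (0 : ℝ)) := measurableSet_Ioi.prod measurableSet_Ioi
  have hC0 : 0 ≤ C := (abs_nonneg _).trans (hC 1 (mem_Ioi.2 one_pos)).1
  have hCP0 : 0 ≤ CP := (norm_nonneg _).trans (hCP 0 ⟨le_rfl, hC0⟩)
  have hR1 : ∀ s > 0, |R' s| ≤ C := fun s hs => by
    rw [hR'e s (le_of_lt hs), abs_of_nonneg (hp.nonneg s hs)]; exact (hC s hs).2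
  have hU1 : ∀ s > 0, |U' s| ≤ C := fun s hs => by
    rw [hU'e s (le_of_lt hs)]; exact (hC s hs).1
  have hRU1 : ∀ s > 0, |R' s * U' s| ≤ C * C := fun s hs => by
    rw [abs_mul]; exact mul_le_mul (hR1 s hs) (hU1 s hs) (abs_nonneg _) hC0
  have hRUU1 : ∀ s > 0, |R' s * U' s ^ 2| ≤ C * C * C := fun s hs => by
    rw [pow_two, ← mul_assoc, abs_mul]
    exact mul_le_mul (hRU1 s hs) (hU1 s hs) (abs_nonneg _) (by positivity)
  have hp1 : ∀ s > 0, |p' s| ≤ CP := fun s hs => by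
    rw [hp'e s (le_of_lt hs)]; exact hCP _ ⟨hp.nonneg s hs, (hC s hs).2⟩
  have hCC : 0 ≤ C * C := by positivity
  have hCCC : 0 ≤ C * C * C := by positivity
  set F : Set ℝ := S ∪ K with hF
  have hFc : F.Countable := S.countable_toSet.union K.countable_toSet
  have hreg : ∀ s > 0, s ∉ F → RegularAt P U R s := fun s hs hsF =>
    hp.smooth s hs (fun h => hsF (Or.inl h)) fun h => hsF (Or.inr h)
  have hev : ∀ s > 0, ∀ᶠ r in 𝓝 s, U' r = U r ∧ R' r = R r ∧ p' r = P (R r) := fun s hs => by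
    filter_upwards [Ioi_mem_nhds hs] with r hr
    exact ⟨hU'e r (le_of_lt hr), hR'e r (le_of_lt hr), hp'e r (le_of_lt hr)⟩
  have hPR₀ : ContinuousWithinAt (fun s => P (R s)) (Ici 0) 0 :=
    (hP (R 0) hρ₀).comp hR₀ fun s hs => hnonneg s hs
  refine ⟨?_, ?_, ⟨C, fun x hx t ht => hC _ (div_pos ht hx)⟩,
    fun x hx t ht => hp.nonneg _ (div_pos ht hx), fun φ h1 h2 h3 => ?_, fun φ h1 h2 h3 => ?_,
    fun x hx => by simp, fun x hx => ?_, fun x hx => ?_, fun t ht => ?_⟩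
  · refine ((hU'm.comp hmd).aestronglyMeasurable).congr (ae_restrict_of_forall_mem hmQ ?_)
    exact fun z hz => hU'e _ (div_pos hz.2 hz.1).le
  · refine ((hR'm.comp hmd).aestronglyMeasurable).congr (ae_restrict_of_forall_mem hmQ ?_)
    exact fun z hz => hR'e _ (div_pos hz.2 hz.1).le
  · have := integral_selfSimilar_eq_zero hR'm (hR'm.mul hU'm) (hR'm.mul hU'm) (C := C + C * C)
      (fun s hs => ⟨(hR1 s hs).trans (by linarith), (hRU1 s hs).trans (by linarith),
        (hRU1 s hs).trans (by linarith)⟩) hFc ?_ ?_ h1 h2 h3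
    · rw [hR'e 0 le_rfl] at this
      refine Eq.trans (congrArg₂ (· + ·) (setIntegral_congr_fun hmQ fun z hz => ?_) rfl) this
      simp only [Pi.mul_apply, hR'e _ (div_pos hz.2 hz.1).le, hU'e _ (div_pos hz.2 hz.1).le]
      ring
    · refine ContinuousOn.congr (f := fun s => R s - s * (R s * U s)) (fun s hs => ?_)
        fun s hs => by simp only [Pi.mul_apply, hR'e s hs, hU'e s hs]
      rcases (mem_Ici.1 hs).eq_or_lt with h | h
      · rw [← h]; exact hR₀.sub (continuousWithinAt_id.mul (hR₀.mul hU₀))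
      · exact (hp.continuousAt_flux hP h).1.continuousWithinAt
    · intro s hs hsF
      refine ((hreg s hs hsF).hasDerivAt_flux.1.congr_of_eventuallyEq
        ((hev s hs).mono fun r hr => ?_)).congr_deriv ?_
      · simp only [Pi.mul_apply, hr.1, hr.2.1]
      · simp only [Pi.mul_apply, hR'e s (le_of_lt hs), hU'e s (le_of_lt hs)]
  · have := integral_selfSimilar_eq_zero (hR'm.mul hU'm)
      ((hR'm.mul (hU'm.pow_const 2)).add hp'm) (hR'm.mul (hU'm.pow_const 2))
      (C := C * C + C * C * C + CP)
      (fun s hs => ⟨(hRU1 s hs).trans (by linarith), (abs_add_le _ _).trans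
        ((add_le_add (hRUU1 s hs) (hp1 s hs)).trans (by linarith)),
        (hRUU1 s hs).trans (by linarith)⟩) hFc ?_ ?_ h1 h2 h3
    · simp only [Pi.mul_apply, hR'e 0 le_rfl, hU'e 0 le_rfl] at this
      refine Eq.trans (congrArg₂ (· + ·) (setIntegral_congr_fun hmQ fun z hz => ?_) rfl) this
      simp only [Pi.mul_apply, Pi.add_apply, hR'e _ (div_pos hz.2 hz.1).le,
        hU'e _ (div_pos hz.2 hz.1).le, hp'e _ (div_pos hz.2 hz.1).le]
      ring
    · refine ContinuousOn.congr (f := fun s => R s * U s - s * (R s * U s ^ 2 + P (R s)))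
        (fun s hs => ?_) fun s hs => by
          simp only [Pi.mul_apply, Pi.add_apply, hR'e s hs, hU'e s hs, hp'e s hs]
      rcases (mem_Ici.1 hs).eq_or_lt with h | h
      · rw [← h]
        exact (hR₀.mul hU₀).sub (continuousWithinAt_id.mul ((hR₀.mul (hU₀.pow 2)).add hPR₀))
      · exact (hp.continuousAt_flux hP h).2.continuousWithinAt
    · intro s hs hsF
      refine ((hreg s hs hsF).hasDerivAt_flux.2.congr_of_eventuallyEq
        ((hev s hs).mono fun r hr => ?_)).congr_deriv ?_
      · simp only [Pi.mul_apply, Pi.add_apply, hr.1, hr.2.1, hr.2.2]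
      · simp only [Pi.mul_apply, Pi.add_apply, hR'e s (le_of_lt hs), hU'e s (le_of_lt hs),
          hp'e s (le_of_lt hs)]
  all_goals try
    have hdiv : Tendsto (fun t => t / x) (𝓝[>] 0) (𝓝[≥] 0) := by
      refine tendsto_nhdsWithin_iff.2 ⟨?_, ?_⟩
      · have : Tendsto (fun t => t / x) (𝓝 0) (𝓝 (0 / x)) := Continuous.tendsto (by fun_prop) 0
        rw [zero_div] at this
        exact this.mono_left nhdsWithin_le_nhds
      · filter_upwards [self_mem_nhdsWithin] with t ht using div_nonneg (le_of_lt ht) (le_of_lt hx)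
  · exact hU₀.tendsto.comp hdiv
  · exact hR₀.tendsto.comp hdiv
  · have : Tendsto (fun x => t / x) (𝓝[>] 0) atTop := by
      simpa only [div_eq_mul_inv] using tendsto_inv_nhdsGT_zero.const_mul_atTop ht
    exact hend.comp this

end profile

/-! ### The equations of state -/

section volume

variable {P : ℝ → ℝ} {α β : ℝ}

lemma eq_pressureOfVolume_comp_inv (P : ℝ → ℝ) : P = fun ρ => pressureOfVolume P ρ⁻¹ := by
  funext ρ; simp [pressureOfVolume]

lemma deriv_eq_volume {ρ : ℝ} (h0 : 0 < ρ)
    (h : DifferentiableAt ℝ (pressureOfVolume P) ρ⁻¹) :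
    deriv P ρ = -((ρ⁻¹) ^ 2 * deriv (pressureOfVolume P) ρ⁻¹) := by
  have h1 := (HasDerivAt.comp ρ h.hasDerivAt (hasDerivAt_inv h0.ne')).deriv
  have h2 : pressureOfVolume P ∘ (fun y => y⁻¹) = P := (eq_pressureOfVolume_comp_inv P).symm
  rw [h2] at h1
  rw [h1, inv_pow]
  ring

lemma contDiffAt_of_volume {ρ : ℝ} (h0 : 0 < ρ)
    (h : ContDiffAt ℝ 2 (pressureOfVolume P) ρ⁻¹) : ContDiffAt ℝ 2 P ρ := by
  have h1 := ContDiffAt.comp ρ h (contDiffAt_inv ℝ h0.ne')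
  have h2 : pressureOfVolume P ∘ Inv.inv = P := (eq_pressureOfVolume_comp_inv P).symm
  rwa [h2] at h1

lemma ContDiffAt.deriv_two {f : ℝ → ℝ} {x : ℝ} (h : ContDiffAt ℝ 2 f x) :
    ContDiffAt ℝ 1 (deriv f) x :=
  (h.fderiv_right (m := 1) (by norm_num)).clm_apply (contDiffAt_const (c := (1 : ℝ)))

lemma deriv2_eq_volume {ρ : ℝ} (h0 : 0 < ρ)
    (h : ContDiffAt ℝ 2 (pressureOfVolume P) ρ⁻¹) :
    2 * deriv P ρ + ρ * deriv (deriv P) ρ =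
      (ρ⁻¹) ^ 3 * deriv (deriv (pressureOfVolume P)) ρ⁻¹ := by
  have hev : deriv P =ᶠ[𝓝 ρ] fun r => -((r⁻¹) ^ 2 * deriv (pressureOfVolume P) r⁻¹) := by
    have h1 := (continuousAt_inv₀ h0.ne').eventually (h.eventually (by simp))
    filter_upwards [h1, Ioi_mem_nhds h0] with r h2 h3
    exact deriv_eq_volume h3 (h2.differentiableAt (by norm_num))
  have hd := (h.deriv_two.differentiableAt (by norm_num)).hasDerivAt
  have hi := hasDerivAt_inv h0.ne'
  have h2 := (((hi.pow 2).mul (HasDerivAt.comp ρ hd hi)).neg.congr_of_eventuallyEq hev).deriv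
  rw [h2, hev.eq_of_nhds]
  simp only [Function.comp_apply, Pi.pow_apply, show (2 : ℕ) - 1 = 1 from rfl, pow_one]
  push_cast
  field_simp
  ring

/-- The shape of the pressure, in terms of its dependence on the specific volume. -/
lemma PressureShape.of_volume (hα : 0 < α) (hle : α ≤ β) (hcont : ContinuousOn P (Ici 0))
    (hC : ∀ τ > 0, τ ∉ ({α⁻¹, β⁻¹} : Set ℝ) → ContDiffAt ℝ 2 (pressureOfVolume P) τ)
    (hout : ∀ τ > 0, τ < β⁻¹ ∨ α⁻¹ < τ →
      deriv (pressureOfVolume P) τ < 0 ∧ 0 < deriv (deriv (pressureOfVolume P)) τ)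
    (hmid : (∀ τ ∈ Ioo β⁻¹ α⁻¹,
        deriv (pressureOfVolume P) τ < 0 ∧ deriv (deriv (pressureOfVolume P)) τ < 0) ∨
      ∀ τ ∈ Ioo β⁻¹ α⁻¹, deriv (pressureOfVolume P) τ = 0)
    (hleft : ∀ τ ∈ ({α⁻¹, β⁻¹} : Set ℝ), ∃ d, Tendsto (deriv (pressureOfVolume P)) (𝓝[<] τ) (𝓝 d) ∧
      (d < 0 ∨ ∀ᶠ r in 𝓝[<] τ, deriv (pressureOfVolume P) r = 0))
    (hright : ∀ τ ∈ ({α⁻¹, β⁻¹} : Set ℝ),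
      ∃ d, Tendsto (deriv (pressureOfVolume P)) (𝓝[>] τ) (𝓝 d) ∧
        (d < 0 ∨ ∀ᶠ r in 𝓝[>] τ, deriv (pressureOfVolume P) r = 0)) :
    PressureShape P α β := by
  have hβ : 0 < β := hα.trans_le hle
  set p := pressureOfVolume P with hp
  have hmem : ∀ {ρ : ℝ}, ρ ∉ ({α, β} : Set ℝ) → ρ⁻¹ ∉ ({α⁻¹, β⁻¹} : Set ℝ) := fun {ρ} h => by
    simpa only [mem_insert_iff, mem_singleton_iff, inv_inj] using h
  have hC' : ∀ ρ > 0, ρ ∉ ({α, β} : Set ℝ) → ContDiffAt ℝ 2 p ρ⁻¹ := fun ρ h0 hb =>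
    hC _ (inv_pos.2 h0) (hmem hb)
  have hd1 : ∀ ρ > 0, ρ ∉ ({α, β} : Set ℝ) → deriv P ρ = -((ρ⁻¹) ^ 2 * deriv p ρ⁻¹) :=
    fun ρ h0 hb => deriv_eq_volume h0 ((hC' ρ h0 hb).differentiableAt (by norm_num))
  have hd2 := fun ρ (h0 : 0 < ρ) hb => deriv2_eq_volume h0 (hC' ρ h0 hb)
  have hnb : ∀ ρ, ρ < α ∨ β < ρ → ρ ∉ ({α, β} : Set ℝ) := fun ρ h hb => by
    simp only [mem_insert_iff, mem_singleton_iff] at hb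
    rcases h with h | h <;> rcases hb with hb | hb <;> linarith
  have hout' : ∀ ρ > 0, ρ < α ∨ β < ρ → ρ⁻¹ < β⁻¹ ∨ α⁻¹ < ρ⁻¹ := fun ρ h0 h =>
    h.symm.imp (fun h => (inv_lt_inv₀ h0 hβ).2 h) fun h => (inv_lt_inv₀ hα h0).2 h
  have hpc : ContinuousOn p (Ioi 0) :=
    hcont.comp (continuousOn_inv₀.mono fun x hx => ne_of_gt hx) fun x hx =>
      mem_Ici.2 (inv_nonneg.2 (le_of_lt hx))
  -- one-sided limits of `p'` away from the exceptional points
  have hgen : ∀ τ > 0, τ ∉ ({α⁻¹, β⁻¹} : Set ℝ) → ContinuousAt (deriv p) τ ∧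
      (deriv p τ < 0 ∨ ∀ᶠ r in 𝓝 τ, deriv p r = 0) := by
    intro τ h0 hb
    refine ⟨(hC τ h0 hb).deriv_two.continuousAt, ?_⟩
    simp only [mem_insert_iff, mem_singleton_iff, not_or] at hb
    rcases lt_or_gt_of_ne hb.2 with h1 | h1
    · exact Or.inl (hout τ h0 (Or.inl h1)).1
    rcases lt_or_gt_of_ne hb.1 with h2 | h2
    · rcases hmid with hm | hm
      · exact Or.inl (hm τ ⟨h1, h2⟩).1
      · right
        filter_upwards [Ioo_mem_nhds h1 h2] with r hr using hm r hr
    · exact Or.inl (hout τ h0 (Or.inr h2)).1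
  have hleft' : ∀ τ > 0, ∃ d, Tendsto (deriv p) (𝓝[<] τ) (𝓝 d) ∧
      (d < 0 ∨ ∀ᶠ r in 𝓝[<] τ, deriv p r = 0) := fun τ h0 => by
    by_cases hb : τ ∈ ({α⁻¹, β⁻¹} : Set ℝ)
    · exact hleft τ hb
    · obtain ⟨h1, h2⟩ := hgen τ h0 hb
      exact ⟨_, h1.tendsto.mono_left nhdsWithin_le_nhds,
        h2.imp id fun h => h.filter_mono nhdsWithin_le_nhds⟩
  have hright' : ∀ τ > 0, ∃ d, Tendsto (deriv p) (𝓝[>] τ) (𝓝 d) ∧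
      (d < 0 ∨ ∀ᶠ r in 𝓝[>] τ, deriv p r = 0) := fun τ h0 => by
    by_cases hb : τ ∈ ({α⁻¹, β⁻¹} : Set ℝ)
    · exact hright τ hb
    · obtain ⟨h1, h2⟩ := hgen τ h0 hb
      exact ⟨_, h1.tendsto.mono_left nhdsWithin_le_nhds,
        h2.imp id fun h => h.filter_mono nhdsWithin_le_nhds⟩
  have hfin : ∀ ρ : ℝ, ∀ᶠ r in 𝓝[≠] ρ, r ∉ ({α, β} : Set ℝ) := fun ρ => by
    have h1 : (({α, β} : Set ℝ) \ {ρ}).Finite := (toFinite _).sdiff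
    have := h1.isClosed.isOpen_compl.mem_nhds (show ρ ∈ (_ \ {ρ})ᶜ by simp)
    filter_upwards [nhdsWithin_le_nhds this, self_mem_nhdsWithin] with r h2 h3 hb
    exact h2 ⟨hb, h3⟩
  have htransfer : ∀ ρ > 0, ∀ l l' : Filter ℝ, l ≤ 𝓝[≠] ρ → Tendsto (fun r : ℝ => r⁻¹) l l' →
      (∃ d, Tendsto (deriv p) l' (𝓝 d) ∧ (d < 0 ∨ ∀ᶠ r in l', deriv p r = 0)) →
      ∃ c, Tendsto (deriv P) l (𝓝 c) ∧ (0 < c ∨ ∀ᶠ r in l, deriv P r = 0) := by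
    rintro ρ h0 l l' hl hinv ⟨d, hd, hd'⟩
    have hln : l ≤ 𝓝 ρ := hl.trans nhdsWithin_le_nhds
    have heq : ∀ᶠ r in l, deriv P r = -((r⁻¹) ^ 2 * deriv p r⁻¹) := by
      filter_upwards [hl (hfin ρ), hln (Ioi_mem_nhds h0)] with r h1 h2 using hd1 r h2 h1
    have hinv' : Tendsto (fun r : ℝ => r⁻¹) l (𝓝 ρ⁻¹) :=
      (continuousAt_inv₀ h0.ne').tendsto.mono_left hln
    refine ⟨-((ρ⁻¹) ^ 2 * d), ((hinv'.pow 2).mul (hd.comp hinv)).neg.congr'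
      (heq.mono fun r hr => hr.symm), hd'.imp (fun hneg => ?_) fun hz => ?_⟩
    · have : (ρ⁻¹) ^ 2 * d < 0 := mul_neg_of_pos_of_neg (by positivity) hneg
      linarith
    · filter_upwards [heq, hinv.eventually hz] with r h1 h2
      rw [h1, h2]; simp
  have hdiff : ∀ {D : Set ℝ}, D ⊆ Ioi 0 → (∀ τ ∈ D, τ ∉ ({α⁻¹, β⁻¹} : Set ℝ)) →
      DifferentiableOn ℝ p D ∧ DifferentiableOn ℝ (deriv p) D := fun {D} hD hb =>
    ⟨fun τ hτ => ((hC τ (hD hτ) (hb τ hτ)).differentiableAt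
        (by norm_num)).differentiableWithinAt, fun τ hτ =>
      ((hC τ (hD hτ) (hb τ hτ)).deriv_two.differentiableAt (by norm_num)).differentiableWithinAt⟩
  have hαβ : β⁻¹ ≤ α⁻¹ := (inv_le_inv₀ hβ hα).2 hle
  have hαi : 0 < α⁻¹ := inv_pos.2 hα
  have hβi : 0 < β⁻¹ := inv_pos.2 hβ
  refine ⟨hα, hle, hcont, fun ρ h0 hb => contDiffAt_of_volume h0 (hC' ρ h0 hb), fun ρ h0 h => ?_,
    fun ρ h0 h => ?_, ?_, fun ρ h0 => ?_, fun ρ h0 => ?_, ?_, ?_, ?_⟩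
  · have h1 := (hout _ (inv_pos.2 h0) (hout' ρ h0 h)).1
    rw [hd1 ρ h0 (hnb ρ h)]
    have : (ρ⁻¹) ^ 2 * deriv p ρ⁻¹ < 0 := mul_neg_of_pos_of_neg (by positivity) h1
    linarith
  · rw [hd2 ρ h0 (hnb ρ h)]
    have := (hout _ (inv_pos.2 h0) (hout' ρ h0 h)).2
    positivity
  · have hin : ∀ ρ ∈ Ioo α β, 0 < ρ ∧ ρ ∉ ({α, β} : Set ℝ) ∧ ρ⁻¹ ∈ Ioo β⁻¹ α⁻¹ := fun ρ hρ =>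
      have h0 := hα.trans hρ.1
      ⟨h0, notMem_of_mem_Ioo hρ, (inv_lt_inv₀ hβ h0).2 hρ.2, (inv_lt_inv₀ h0 hα).2 hρ.1⟩
    refine hmid.imp (fun hm ρ hρ => ?_) fun hm ρ hρ => ?_
    · obtain ⟨h0, h1, h2⟩ := hin ρ hρ
      obtain ⟨h3, h4⟩ := hm _ h2
      rw [hd2 ρ h0 h1, hd1 ρ h0 h1]
      have : (ρ⁻¹) ^ 2 * deriv p ρ⁻¹ < 0 := mul_neg_of_pos_of_neg (by positivity) h3
      exact ⟨by linarith, mul_neg_of_pos_of_neg (by positivity) h4⟩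
    · obtain ⟨h0, h1, h2⟩ := hin ρ hρ
      rw [hd1 ρ h0 h1, hm _ h2]; simp
  · refine htransfer ρ h0 _ _ (nhdsWithin_mono _ fun x hx => ne_of_lt hx) ?_
      (hright' _ (inv_pos.2 h0))
    refine tendsto_nhdsWithin_iff.2 ⟨(continuousAt_inv₀ h0.ne').tendsto.mono_left
      nhdsWithin_le_nhds, ?_⟩
    filter_upwards [Ioo_mem_nhdsLT h0] with r hr using (inv_lt_inv₀ h0 hr.1).2 hr.2
  · refine htransfer ρ h0 _ _ (nhdsWithin_mono _ fun x hx => ne_of_gt hx) ?_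
      (hleft' _ (inv_pos.2 h0))
    refine tendsto_nhdsWithin_iff.2 ⟨(continuousAt_inv₀ h0.ne').tendsto.mono_left
      nhdsWithin_le_nhds, ?_⟩
    filter_upwards [self_mem_nhdsWithin] with r hr using (inv_lt_inv₀ (h0.trans hr) h0).2 hr
  · obtain ⟨h1, h2⟩ := hdiff (D := Ioo 0 β⁻¹) (fun x hx => hx.1) fun x hx hb => by
      simp only [mem_insert_iff, mem_singleton_iff] at hb
      rcases hb with hb | hb <;> linarith [hx.2]
    refine convexOn_of_deriv2_nonneg (convex_Ioc _ _) (hpc.mono fun x hx => hx.1)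
      (by rwa [interior_Ioc]) (by rwa [interior_Ioc]) fun x hx => ?_
    rw [interior_Ioc] at hx
    exact (hout x hx.1 (Or.inl hx.2)).2.le
  · obtain ⟨h1, h2⟩ := hdiff (D := Ioo β⁻¹ α⁻¹) (fun x hx => hβi.trans hx.1) fun x hx hb => by
      simp only [mem_insert_iff, mem_singleton_iff] at hb
      rcases hb with hb | hb <;> linarith [hx.1, hx.2]
    refine concaveOn_of_deriv2_nonpos (convex_Icc _ _) (hpc.mono fun x hx => hβi.trans_le hx.1)
      (by rwa [interior_Icc]) (by rwa [interior_Icc]) fun x hx => ?_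
    rw [interior_Icc] at hx
    rcases hmid with hm | hm
    · exact (hm x hx).2.le
    · refine le_of_eq ?_
      have h3 : deriv p =ᶠ[𝓝 x] fun _ => 0 := by
        filter_upwards [Ioo_mem_nhds hx.1 hx.2] with r hr using hm r hr
      have h4 := h3.deriv_eq
      rw [deriv_const] at h4
      exact h4
  · obtain ⟨h1, h2⟩ := hdiff (D := Ioi α⁻¹) (fun x hx => hαi.trans hx) fun x hx hb => by
      simp only [mem_insert_iff, mem_singleton_iff] at hb
      rcases hb with hb | hb <;> linarith [mem_Ioi.1 hx]
    refine convexOn_of_deriv2_nonneg (convex_Ici _) (hpc.mono fun x hx => hαi.trans_le hx)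
      (by rwa [interior_Ici]) (by rwa [interior_Ici]) fun x hx => ?_
    rw [interior_Ici] at hx
    exact (hout x (hαi.trans hx) (Or.inr hx)).2.le

lemma IsTypeI.pressureShape (h : IsTypeI (pressureOfVolume P)) (hcont : ContinuousOn P (Ici 0))
    (hα : 0 < α) : PressureShape P α α := by
  have hC : ∀ τ > 0, ContDiffAt ℝ 2 (pressureOfVolume P) τ := fun τ h0 =>
    h.contDiffOn.contDiffAt (Ioi_mem_nhds h0)
  have hc : ∀ τ ∈ ({α⁻¹, α⁻¹} : Set ℝ), ContinuousAt (deriv (pressureOfVolume P)) τ ∧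
      deriv (pressureOfVolume P) τ < 0 := fun τ hτ => by
    have h0 : 0 < τ := by
      simp only [mem_insert_iff, mem_singleton_iff, or_self] at hτ
      rw [hτ]; exact inv_pos.2 hα
    exact ⟨(hC τ h0).deriv_two.continuousAt, h.deriv_neg τ h0⟩
  exact PressureShape.of_volume hα le_rfl hcont (fun τ h0 _ => hC τ h0)
    (fun τ h0 _ => ⟨h.deriv_neg τ h0, h.deriv2_pos τ h0⟩)
    (Or.inl fun τ hτ => absurd (hτ.1.trans hτ.2) (lt_irrefl _))
    (fun τ hτ => ⟨_, (hc τ hτ).1.tendsto.mono_left nhdsWithin_le_nhds, Or.inl (hc τ hτ).2⟩)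
    fun τ hτ => ⟨_, (hc τ hτ).1.tendsto.mono_left nhdsWithin_le_nhds, Or.inl (hc τ hτ).2⟩

lemma IsTypeII.pressureShape {τ₁ τ₂ : ℝ} (h : IsTypeII (pressureOfVolume P) τ₁ τ₂)
    (hcont : ContinuousOn P (Ici 0)) : PressureShape P τ₂⁻¹ τ₁⁻¹ := by
  have hτ₂ : 0 < τ₂ := h.pos.trans h.lt
  have hC : ∀ τ > 0, ContDiffAt ℝ 2 (pressureOfVolume P) τ := fun τ h0 =>
    h.contDiffOn.contDiffAt (Ioi_mem_nhds h0)
  have hc : ∀ τ ∈ ({τ₂⁻¹⁻¹, τ₁⁻¹⁻¹} : Set ℝ), ContinuousAt (deriv (pressureOfVolume P)) τ ∧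
      deriv (pressureOfVolume P) τ < 0 := fun τ hτ => by
    have h0 : 0 < τ := by
      simp only [inv_inv, mem_insert_iff, mem_singleton_iff] at hτ
      rcases hτ with rfl | rfl
      · exact hτ₂
      · exact h.pos
    exact ⟨(hC τ h0).deriv_two.continuousAt, h.deriv_neg τ h0⟩
  refine PressureShape.of_volume (inv_pos.2 hτ₂) ((inv_le_inv₀ hτ₂ h.pos).2 h.lt.le) hcont
    (fun τ h0 _ => hC τ h0) (fun τ h0 hτ => ⟨h.deriv_neg τ h0, ?_⟩) (Or.inl fun τ hτ => ?_)
    (fun τ hτ => ⟨_, (hc τ hτ).1.tendsto.mono_left nhdsWithin_le_nhds, Or.inl (hc τ hτ).2⟩)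
    fun τ hτ => ⟨_, (hc τ hτ).1.tendsto.mono_left nhdsWithin_le_nhds, Or.inl (hc τ hτ).2⟩
  · rw [inv_inv, inv_inv] at hτ
    exact h.deriv2_pos τ (hτ.imp (fun h1 => ⟨h0, h1⟩) id)
  · rw [inv_inv, inv_inv] at hτ
    exact ⟨h.deriv_neg τ (h.pos.trans hτ.1), h.deriv2_neg τ hτ⟩

lemma IsTypeIII.pressureShape {τ₁ τ₂ : ℝ} (h : IsTypeIII (pressureOfVolume P) τ₁ τ₂)
    (hA : AssumptionA2 (pressureOfVolume P) τ₁ τ₂) (hcont : ContinuousOn P (Ici 0)) :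
    PressureShape P τ₂⁻¹ τ₁⁻¹ := by
  set p := pressureOfVolume P with hp
  have hτ₁ := h.pos
  have hτ₂ : 0 < τ₂ := h.pos.trans h.lt
  have hCl : ∀ τ ∈ Ioo 0 τ₁, ContDiffAt ℝ 2 p τ := fun τ hτ =>
    h.contDiffOn_left.contDiffAt (Ioc_mem_nhds hτ.1 hτ.2)
  have hCr : ∀ τ > τ₂, ContDiffAt ℝ 2 p τ := fun τ hτ =>
    h.contDiffOn_right.contDiffAt (Ici_mem_nhds hτ)
  have hev : ∀ τ ∈ Ioo τ₁ τ₂, p =ᶠ[𝓝 τ] fun _ => p τ₁ := fun τ hτ => by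
    filter_upwards [Icc_mem_nhds hτ.1 hτ.2] with r hr using h.plateau r hr
  have hmid : ∀ τ ∈ Ioo τ₁ τ₂, deriv p τ = 0 := fun τ hτ => by
    rw [(hev τ hτ).deriv_eq, deriv_const]
  have hmid_right : ∀ᶠ r in 𝓝[>] τ₁, deriv p r = 0 := by
    filter_upwards [Ioo_mem_nhdsGT h.lt] with r hr using hmid r hr
  have hmid_left : ∀ᶠ r in 𝓝[<] τ₂, deriv p r = 0 := by
    filter_upwards [Ioo_mem_nhdsLT h.lt] with r hr using hmid r hr
  have hzero : ∀ l : Filter ℝ, (∀ᶠ r in l, deriv p r = 0) → Tendsto (deriv p) l (𝓝 0) :=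
    fun l hl => tendsto_const_nhds.congr' (hl.mono fun r hr => hr.symm)
  obtain ⟨τc, L, hτc, -, hL, hLlt⟩ := hA
  have hL0 : L < 0 := hLlt.trans (h.deriv_neg τc (Or.inr hτc))
  have hlim : ∃ d, Tendsto (deriv p) (𝓝[>] τ₂) (𝓝 d) ∧ d < 0 := by
    have h1 : ContinuousWithinAt (derivWithin p (Ici τ₂)) (Ici τ₂) τ₂ :=
      (h.contDiffOn_right.continuousOn_derivWithin (uniqueDiffOn_Ici τ₂) (by norm_num)) τ₂
        (mem_Ici.2 le_rfl)
    have h2 : Tendsto (deriv p) (𝓝[>] τ₂) (𝓝 (derivWithin p (Ici τ₂) τ₂)) :=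
      (h1.tendsto.mono_left (nhdsWithin_mono _ Ioi_subset_Ici_self)).congr'
        (eventually_mem_nhdsWithin.mono fun r hr => derivWithin_of_mem_nhds (Ici_mem_nhds hr))
    refine ⟨_, h2, ?_⟩
    have hmono : StrictMonoOn (deriv p) (Ioi τ₂) := by
      refine strictMonoOn_of_deriv_pos (convex_Ioi _)
        (fun r hr => (hCr r hr).deriv_two.continuousAt.continuousWithinAt) fun r hr => ?_
      rw [interior_Ioi] at hr
      exact h.deriv2_pos r (Or.inr hr)
    refine (le_of_tendsto h2 ?_).trans_lt (h.deriv_neg (τ₂ + 1) (Or.inr (lt_add_one τ₂)))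
    filter_upwards [Ioo_mem_nhdsGT (lt_add_one τ₂)] with r hr
    exact (hmono hr.1 (lt_add_one τ₂) hr.2).le
  obtain ⟨d, hd, hd0⟩ := hlim
  refine PressureShape.of_volume (inv_pos.2 hτ₂) ((inv_le_inv₀ hτ₂ h.pos).2 h.lt.le) hcont
    (fun τ h0 hb => ?_) (fun τ h0 hτ => ?_) (Or.inr fun τ hτ => ?_) (fun τ hτ => ?_) fun τ hτ => ?_
  · simp only [inv_inv, mem_insert_iff, mem_singleton_iff, not_or] at hb
    rcases lt_or_gt_of_ne hb.2 with h1 | h1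
    · exact hCl τ ⟨h0, h1⟩
    rcases lt_or_gt_of_ne hb.1 with h2 | h2
    · exact contDiffAt_const.congr_of_eventuallyEq (hev τ ⟨h1, h2⟩)
    · exact hCr τ h2
  · rw [inv_inv, inv_inv] at hτ
    have hmem : τ ∈ Ioo 0 τ₁ ∪ Ioi τ₂ := hτ.imp (fun h1 => ⟨h0, h1⟩) id
    exact ⟨h.deriv_neg τ hmem, h.deriv2_pos τ hmem⟩
  · rw [inv_inv, inv_inv] at hτ
    exact hmid τ hτ
  · simp only [inv_inv, mem_insert_iff, mem_singleton_iff] at hτ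
    rcases hτ with rfl | rfl
    · exact ⟨0, hzero _ hmid_left, Or.inr hmid_left⟩
    · exact ⟨L, hL, Or.inl hL0⟩
  · simp only [inv_inv, mem_insert_iff, mem_singleton_iff] at hτ
    rcases hτ with rfl | rfl
    · exact ⟨d, hd, Or.inl hd0⟩
    · exact ⟨0, hzero _ hmid_right, Or.inr hmid_right⟩

lemma AssumptionA1.tendsto_deriv (h : AssumptionA1 P) : Tendsto (deriv P) (𝓝[>] 0) (𝓝 0) := by
  obtain ⟨ν, hν, hlim⟩ := h
  have h1 : Tendsto (fun ρ : ℝ => ρ ^ ν) (𝓝[>] 0) (𝓝 0) := by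
    have := (Real.continuousAt_rpow_const (0 : ℝ) ν (Or.inr hν.le)).tendsto
    rw [Real.zero_rpow hν.ne'] at this
    exact this.mono_left nhdsWithin_le_nhds
  have h2 := hlim.mul h1
  rw [mul_zero] at h2
  refine h2.congr' ?_
  filter_upwards [self_mem_nhdsWithin] with ρ hρ
  have : ρ ^ ν ≠ 0 := (Real.rpow_pos_of_pos hρ ν).ne'
  field_simp

end volume

/-! ### Self-similar solutions of the initial-boundary value problem -/

/-- A profile on `[0, ∞)` provides a solution of the initial-boundary value problem. -/
lemma IsSolvableFrom.exists_solution {P : ℝ → ℝ} {ε u₀ ρ₀ : ℝ} {n : ℕ}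
    (h : IsSolvableFrom P ε 0 u₀ ρ₀ n) (hP : ContinuousOn P (Ici 0)) (hρ₀ : 0 < ρ₀) :
    ∃ (U R : ℝ → ℝ) (S K : Finset ℝ),
      IsWeakSolution P u₀ ρ₀ (fun x t => U (t / x)) (fun x t => R (t / x)) ∧
      IsAdmissibleProfile P U R S K ∧ S.card = n ∧
      (ε = -1 → (∀ s ∈ S, IsRarefactionShockAt P U R s) ∧
        (EndsInVacuum U R ∨ EndsAtRest U R ∨ DecaysAtInfinity U R)) ∧
      (ε = 1 → (∀ s ∈ S, IsCompressionShockAt P U R s) ∧ EndsAtRest U R) := by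
  obtain ⟨U, R, S, K, rfl, rfl, hcU, hcR, hp, hcard, hend⟩ := h
  have hrest : ((∀ s ≥ 0, 0 < R s) ∧ ∃ s₂ > 0, ∃ ρ₂ > 0, ∀ s > s₂, U s = 0 ∧ R s = ρ₂) →
      EndsAtRest U R := fun h => ⟨fun s hs => h.1 s (le_of_lt hs), h.2⟩
  have hends : EndsAtRest U R ∨ (ε = -1 ∧ EndsInVacuum U R) ∨ (ε = -1 ∧ DecaysAtInfinity U R) := by
    rcases hend with h1 | ⟨h1, s₂, h2, h3, h4⟩ | ⟨h1, h2, h3⟩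
    · exact Or.inl (hrest h1)
    · refine Or.inr (Or.inl ⟨h1, s₂, h2.lt_of_ne fun h5 => ?_,
        fun s hs => h3 s ⟨hs.1.le, hs.2⟩, h4⟩)
      exact hρ₀.ne' (h4 0 h5.ge).2
    · exact Or.inr (Or.inr ⟨h1, fun s hs => h2 s (le_of_lt hs), h3⟩)
  have hlim : Tendsto (fun s => R s * U s) atTop (𝓝 0) := by
    rcases hends with ⟨-, s₁, -, ρ₁, -, h1⟩ | ⟨-, s₁, -, -, h1⟩ | ⟨-, -, h1, h2⟩
    · refine tendsto_const_nhds.congr' ((eventually_gt_atTop s₁).mono fun s hs => ?_)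
      simp only [(h1 s hs).1, mul_zero]
    · refine tendsto_const_nhds.congr' ((eventually_ge_atTop s₁).mono fun s hs => ?_)
      simp only [(h1 s hs).2, zero_mul]
    · simpa using h2.mul h1
  have hjump : ∀ s ∈ S, (ε = -1 → IsRarefactionShockAt P U R s) ∧
      (ε = 1 → IsCompressionShockAt P U R s) ∧
      (IsCompressionShockAt P U R s ∨ IsRarefactionShockAt P U R s) := fun s hs => by
    obtain ⟨-, u₁, ρ₁, h1, h2⟩ := hp.shock s hs
    refine ⟨fun he => ⟨u₁, ρ₁, U s, R s, h1, ?_⟩, fun he => ⟨u₁, ρ₁, U s, R s, h1, ?_⟩, ?_⟩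
    · rw [he] at h2; linarith
    · rw [he] at h2; linarith
    · rcases lt_or_gt_of_ne h1.shock.ne with h3 | h3
      · exact Or.inl ⟨u₁, ρ₁, U s, R s, h1, h3⟩
      · exact Or.inr ⟨u₁, ρ₁, U s, R s, h1, h3⟩
  refine ⟨U, R, S, K, hp.isWeakSolution hP hcU hcR hρ₀.le hlim, ⟨fun s hs => (hp.shock s hs).1,
    fun s hs => (hp.kink s hs).1, fun s h0 hS hK => ?_, fun s hs => (hp.kink s hs).2,
    fun s hs => (hjump s hs).2.2⟩, hcard, fun he => ⟨fun s hs => (hjump s hs).1 he, ?_⟩,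
    fun he => ⟨fun s hs => (hjump s hs).2.1 he, ?_⟩⟩
  · exact (hp.smooth s h0 hS hK).imp And.left fun h => h.mono fun r hr => hr.1
  · tauto
  · rcases hends with h | ⟨h, -⟩ | ⟨h, -⟩
    · exact h
    · linarith
    · linarith

theorem theorem1p1 (P : ℝ → ℝ) (u₀ ρ₀ : ℝ) (hρ₀ : 0 < ρ₀)
    (hP : ContinuousOn P (Ici 0))
    (hstate : IsTypeI (pressureOfVolume P) ∨
      (∃ τ₁ τ₂ : ℝ, IsTypeII (pressureOfVolume P) τ₁ τ₂) ∨
      (∃ τ₁ τ₂ : ℝ, IsTypeIII (pressureOfVolume P) τ₁ τ₂ ∧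
        AssumptionA2 (pressureOfVolume P) τ₁ τ₂))
    (hA1 : AssumptionA1 P)
    (hdense : u₀ < 0 → ∃ c > 0, ∀ᶠ ρ in atTop, c ≤ deriv P ρ) :
    ∃ (U R : ℝ → ℝ) (S K : Finset ℝ),
      IsWeakSolution P u₀ ρ₀ (fun x t => U (t / x)) (fun x t => R (t / x)) ∧
      IsAdmissibleProfile P U R S K ∧
      (0 < u₀ → S.card ≤ 1 ∧ (∀ s ∈ S, IsRarefactionShockAt P U R s) ∧
        (EndsInVacuum U R ∨ EndsAtRest U R ∨ DecaysAtInfinity U R)) ∧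
      (u₀ ≤ 0 → S.card ≤ 2 ∧ (∀ s ∈ S, IsCompressionShockAt P U R s) ∧ EndsAtRest U R) ∧
      (IsTypeI (pressureOfVolume P) → (0 < u₀ → S = ∅) ∧ (u₀ < 0 → S.card = 1)) := by
  have hA := hA1.tendsto_deriv
  -- for type I any density can play the role of the two inflection points
  obtain ⟨α, β, h, hI⟩ : ∃ α β, PressureShape P α β ∧
      (IsTypeI (pressureOfVolume P) → α = ρ₀ ∧ β = ρ₀) := by
    by_cases hI : IsTypeI (pressureOfVolume P)
    · exact ⟨ρ₀, ρ₀, hI.pressureShape hP hρ₀, fun _ => ⟨rfl, rfl⟩⟩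
    rcases hstate with h | ⟨τ₁, τ₂, h⟩ | ⟨τ₁, τ₂, h, h2⟩
    · exact absurd h hI
    · exact ⟨_, _, h.pressureShape hP, fun h => absurd h hI⟩
    · exact ⟨_, _, h.pressureShape h2 hP, fun h => absurd h hI⟩
  rcases lt_trichotomy u₀ 0 with hu | hu | hu
  · obtain ⟨κ, hκ, hd⟩ := hdense hu
    obtain ⟨n, hn, hsol, hone⟩ := h.isSolvableFrom_compression hκ hd hρ₀ (neg_pos.2 hu)
    rw [neg_neg] at hsol
    obtain ⟨U, R, S, K, h1, h2, h3, -, h4⟩ := hsol.exists_solution hP hρ₀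
    exact ⟨U, R, S, K, h1, h2, fun h5 => absurd h5 (not_lt.2 hu.le),
      fun _ => ⟨h3.trans_le hn, h4 rfl⟩,
      fun h5 => ⟨fun h6 => absurd h6 (not_lt.2 hu.le), fun _ => by
        rw [h3, hone (hI h5).2.le]⟩⟩
  · subst hu
    obtain ⟨U, R, S, K, h1, h2, h3, -, h4⟩ :=
      (isSolvableFrom_rest P 1 le_rfl hρ₀).exists_solution hP hρ₀
    exact ⟨U, R, S, K, h1, h2, fun h5 => absurd h5 (lt_irrefl _),
      fun _ => ⟨by omega, h4 rfl⟩,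
      fun _ => ⟨fun h6 => absurd h6 (lt_irrefl _), fun h6 => absurd h6 (lt_irrefl _)⟩⟩
  · obtain ⟨n, hn, hsol, hzero⟩ : ∃ n ≤ 1, IsSolvableFrom P (-1) 0 u₀ ρ₀ n ∧
        (ρ₀ ≤ α → n = 0) := by
      rcases h.isSolvableFrom_expansion hA hρ₀ hu with h1 | ⟨h1, h2⟩
      · exact ⟨0, zero_le_one, h1, fun _ => rfl⟩
      · exact ⟨1, le_rfl, h2, fun h3 => absurd h1 (not_lt.2 h3)⟩
    obtain ⟨U, R, S, K, h1, h2, h3, h4, -⟩ := hsol.exists_solution hP hρ₀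
    exact ⟨U, R, S, K, h1, h2, fun _ => ⟨h3.trans_le hn, h4 rfl⟩,
      fun h5 => absurd hu (not_lt.2 h5),
      fun h5 => ⟨fun _ => Finset.card_eq_zero.1 (h3.trans (hzero (hI h5).1.ge)),
        fun h6 => absurd h6 (not_lt.2 hu.le)⟩⟩
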